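/- Let $X$ be a complex Banach space, and for $0<\sigma<\pi$ let $\Sigma_\sigma=\{z\in\mathbb C\setminus\{0\}: |\arg z|<\sigma\}$. Let $A$ be a sectorial operator of type $\omega\in[0,\pi)$ on $X$, that is, a closed, densely defined, one-one operator with dense range such that $R(\lambda,A)=(\lambda-A)^{-1}$ exists as a bounded operator for all $\lambda\neq 0$ with $|\arg\lambda|>\omega$, and $\sup_{|\arg\lambda|\ge\nu}\|\lambda R(\lambda,A)\|<\infty$ for every $\nu\in(\omega,\pi]$. Let $\mathcal A$ be the algebra of all bounded operators on $X$ which commute with $R(\lambda,A)$ for all $|\arg\lambda|>\omega$, and let $H^\infty(\Sigma_\sigma;\mathcal A)$ be the space of all bounded functions $F:\Sigma_\sigma\to\mathcal A$ such that $z\mapsto F(z)x$ is analytic for every $x\in X$. Let $\mathcal B$ be the smallest set of pairs $(F,T)$, where $T\in\mathcal A$ and $F$ is the germ of a function in $\bigcup_{\omega<\sigma<\pi}H^\infty(\Sigma_\sigma;\mathcal A)$ (functions being identified if they agree on some $\Sigma_\sigma$, $\sigma>\omega$), such that * $\mathcal B$ contains $\bigl(\sum_{i=1}^n(\lambda_i-z)^{-p_i}S_i,\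 \sum_{i=1}^n R(\lambda_i,A)^{p_i}S_i\bigr)$ whenever $n,p_i\in\mathbb N\cup\{0\}$, $|\arg\lambda_i|>\omega$, $S_i\in\mathcal A$; * if $(F_n,T_n)\in\mathcal B$, all $F_n$ and $F$ are in $H^\infty(\Sigma_\sigma;\mathcal A)$ for one $\sigma\in(\omega,\pi)$, $\sup_n\sup_{z\in\Sigma_\sigma}\|F_n(z)\|<\infty$, $F_n(z)x\to F(z)x$ for all $z\in\Sigma_\sigma$, $x\in X$, and $T_nx\to Tx$ for all $x\in X$ with $T\in\mathcal A$, then $(F,T)\in\mathcal B$. One says that $F(A)$ is defined, and writes $F\in\mathcal H(A;\mathcal A)$ and $F(A)=T$, if there is a (necessarily unique) $T$ with $(F,T)\in\mathcal B$. The operator $A$ has an $H^\infty(\Sigma_\sigma)$-calculus if $f(A)$ is defined for every bounded analytic $f:\Sigma_\sigma\to\mathbb C$, identified with $z\mapsto f(z)I$. A set $\mathcal F$ of bounded operators on $X$ is U-bounded if there is a constant $C$ such that for all $n$, all $x_1,\dots,x_n\in X$, $x_1^*,\dots,x_n^*\in X^*$ and $T_1,\dots,T_n\in\mathcal F$, $$\sum_{k=1}^n|\langle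 T_kx_k,x_k^*\rangle|\le C\max_{\epsilon_k=\pm1}\Bigl\|\sum_{k=1}^n\epsilon_kx_k\Bigr\|\max_{\epsilon_k=\pm1}\Bigl\|\sum_{k=1}^n\epsilon_kx_k^*\Bigr\|.$$ With independent Rademacher variables $\epsilon_k$, it is WR-bounded if the same holds with the two maxima replaced by $(\mathbb E\|\sum_k\epsilon_kx_k\|^2)^{1/2}$ and $(\mathbb E\|\sum_k\epsilon_kx_k^*\|^2)^{1/2}$, and R-bounded if there is $C$ with $(\mathbb E\|\sum_k\epsilon_kT_kx_k\|^2)^{1/2}\le C(\mathbb E\|\sum_k\epsilon_kx_k\|^2)^{1/2}$ for all such $n$, $x_k$, $T_k$. **Theorem.** Let $\omega<\sigma<\rho<\pi$, suppose that $A$ has an $H^\infty(\Sigma_\sigma)$-calculus, and let $F\in H^\infty(\Sigma_\rho;\mathcal A)$. If the set $\{F(z):z\in\Sigma_\rho\}$ is U-bounded (in particular, if it is WR-bounded or R-bounded), then $F\in\mathcal H(A;\mathcal A)$: there is exactly one bounded operator $T=F(A)$ with $(F,T)\in\mathcal B$. -/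

import Mathlib

section Definitions

variable {X : Type*} [NormedAddCommGroup X] [NormedSpace ℂ X]

/-- The open sector `Σ_σ = {z ≠ 0 : |arg z| < σ}`. -/
def sector (σ : ℝ) : Set ℂ := {z | z ≠ 0 ∧ |z.arg| < σ}

/-- `R` is the resolvent `R(μ, A) = (μ - A)⁻¹` of the (possibly unbounded) operator `A`:
a bounded two-sided inverse of `μ - A : D(A) → X`. Such an `R` is unique if it exists. -/
structure IsResolventAt (A : X →ₗ.[ℂ] X) (μ : ℂ) (R : X →L[ℂ] X) : Prop where
  right_inv : ∀ x : X, ∃ h : R x ∈ A.domain, μ • R x - A ⟨R x, h⟩ = x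
  left_inv : ∀ y : A.domain, R (μ • (y : X) - A y) = y

/-- `A` is a sectorial operator of type `ω`: closed, densely defined, one-one, with dense range,
`R(μ, A)` exists whenever `ω < |arg μ|`, and `‖μ R(μ, A)‖ ≤ C_σ` on `|arg μ| ≥ σ`
for every `σ > ω`. -/
structure IsSectorial (A : X →ₗ.[ℂ] X) (ω : ℝ) : Prop where
  nonneg : 0 ≤ ω
  lt_pi : ω < Real.pi
  closed : A.IsClosed
  dense_domain : Dense (A.domain : Set X)
  injective : Function.Injective A
  dense_range : DenseRange A
  exists_resolvent : ∀ μ : ℂ, μ ≠ 0 → ω < |μ.arg| → ∃ R : X →L[ℂ] X, IsResolventAt A μ R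
  resolvent_bound : ∀ σ : ℝ, ω < σ → ∃ C : ℝ, ∀ (μ : ℂ) (R : X →L[ℂ] X),
    μ ≠ 0 → σ ≤ |μ.arg| → IsResolventAt A μ R → ‖μ • R‖ ≤ C

/-- The algebra `𝒜` of the bounded operators which commute with `A`, that is, with every
resolvent `R(μ, A)`, `|arg μ| > ω`. -/
def commutingAlgebra (A : X →ₗ.[ℂ] X) (ω : ℝ) : Subalgebra ℂ (X →L[ℂ] X) :=
  Subalgebra.centralizer ℂ {R | ∃ μ : ℂ, μ ≠ 0 ∧ ω < |μ.arg| ∧ IsResolventAt A μ R}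

/-- The scalar space `H^∞(Σ_σ)`; only the values of `f` on `Σ_σ` matter. -/
structure MemHInf (σ : ℝ) (f : ℂ → ℂ) : Prop where
  analytic : DifferentiableOn ℂ f (sector σ)
  bounded : ∃ C : ℝ, ∀ z ∈ sector σ, ‖f z‖ ≤ C

/-- The space `H^∞(Σ_σ; 𝒜)` of the bounded functions `F : Σ_σ → 𝒜` that are analytic for the
strong operator topology; only the values of `F` on `Σ_σ` matter. -/
structure MemOpHInf (𝒜 : Subalgebra ℂ (X →L[ℂ] X)) (σ : ℝ) (F : ℂ → X →L[ℂ] X) : Prop where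
  mem : ∀ z ∈ sector σ, F z ∈ 𝒜
  analytic : ∀ x : X, DifferentiableOn ℂ (fun z => F z x) (sector σ)
  bounded : ∃ C : ℝ, ∀ z ∈ sector σ, ‖F z‖ ≤ C

/-- The set `ℬ` of the pairs `(F, T)` with `T = F(A)`: the smallest set which contains all pairs
`(∑ᵢ (μᵢ - z)^(-pᵢ) Sᵢ, ∑ᵢ R(μᵢ, A)^(pᵢ) Sᵢ)`, `|arg μᵢ| > ω`, `pᵢ ∈ ℕ`, `Sᵢ ∈ 𝒜`, and is closed
under the sequential convergence `(Fₙ, Tₙ) → (F, T)` which means: for some `σ > ω` all `Fₙ` and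
`F` are in `H^∞(Σ_σ; 𝒜)`, the `Fₙ` are uniformly bounded on `Σ_σ` and converge there to `F`
pointwise in the strong operator topology, and `Tₙ → T ∈ 𝒜` in the strong operator topology.
A function `F` stands here for its germ: functions which coincide on some `Σ_σ`, `σ > ω`, (and
are in `H^∞(Σ_σ; 𝒜)`) are identified by the limits of constant sequences. -/
inductive CalculusGraph (A : X →ₗ.[ℂ] X) (ω : ℝ) : (ℂ → X →L[ℂ] X) → (X →L[ℂ] X) → Prop
  | rational (n : ℕ) (μ : Fin n → ℂ) (p : Fin n → ℕ) (R S : Fin n → X →L[ℂ] X)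
      (hμ : ∀ i, μ i ≠ 0 ∧ ω < |(μ i).arg|)
      (hR : ∀ i, IsResolventAt A (μ i) (R i))
      (hS : ∀ i, S i ∈ commutingAlgebra A ω) :
      CalculusGraph A ω (fun z => ∑ i, ((μ i - z) ^ p i)⁻¹ • S i) (∑ i, R i ^ p i * S i)
  | limit (Fs : ℕ → ℂ → X →L[ℂ] X) (Ts : ℕ → X →L[ℂ] X)
      (F : ℂ → X →L[ℂ] X) (T : X →L[ℂ] X) (σ C : ℝ)
      (h : ∀ n, CalculusGraph A ω (Fs n) (Ts n))
      (hωσ : ω < σ) (hσ : σ < Real.pi)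
      (hFs : ∀ n, MemOpHInf (commutingAlgebra A ω) σ (Fs n))
      (hF : MemOpHInf (commutingAlgebra A ω) σ F)
      (hT : T ∈ commutingAlgebra A ω)
      (hC : ∀ n, ∀ z ∈ sector σ, ‖Fs n z‖ ≤ C)
      (hlim : ∀ z ∈ sector σ, ∀ x : X,
        Filter.Tendsto (fun n => Fs n z x) Filter.atTop (nhds (F z x)))
      (hTlim : ∀ x : X, Filter.Tendsto (fun n => Ts n x) Filter.atTop (nhds (T x))) :
      CalculusGraph A ω F T

/-- `A` has an `H^∞(Σ_σ)`-calculus: `f(A)` is defined for every `f ∈ H^∞(Σ_σ)`, where `f` is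
identified with `z ↦ f(z) I`. -/
def HasHInfCalculus (A : X →ₗ.[ℂ] X) (ω σ : ℝ) : Prop :=
  ∀ f : ℂ → ℂ, MemHInf σ f →
    ∃ T : X →L[ℂ] X, CalculusGraph A ω (fun z => f z • ContinuousLinearMap.id ℂ X) T

/-- `max_{ε_k = ±1} ‖∑_k ε_k x_k‖`. -/
noncomputable def maxSignNorm {Y : Type*} [NormedAddCommGroup Y] {n : ℕ} (x : Fin n → Y) : ℝ :=
  ⨆ ε : Fin n → ℤˣ, ‖∑ k, (ε k : ℤ) • x k‖

/-- `(𝔼 ‖∑_k ε_k x_k‖²)^(1/2)` for independent Rademacher variables `ε_k`, whose joint law is the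
uniform distribution on `{1, -1}ⁿ`. -/
noncomputable def rademacherNorm {Y : Type*} [NormedAddCommGroup Y] {n : ℕ} (x : Fin n → Y) : ℝ :=
  Real.sqrt ((∑ ε : Fin n → ℤˣ, ‖∑ k, (ε k : ℤ) • x k‖ ^ 2) / 2 ^ n)

/-- Rademacher-boundedness (R-boundedness). -/
def IsRBounded (𝓕 : Set (X →L[ℂ] X)) : Prop :=
  ∃ C : ℝ, ∀ (n : ℕ) (x : Fin n → X) (T : Fin n → X →L[ℂ] X), (∀ k, T k ∈ 𝓕) →
    rademacherNorm (fun k => T k (x k)) ≤ C * rademacherNorm x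

/-- Weak Rademacher-boundedness (WR-boundedness). -/
def IsWRBounded (𝓕 : Set (X →L[ℂ] X)) : Prop :=
  ∃ C : ℝ, ∀ (n : ℕ) (x : Fin n → X) (x' : Fin n → X →L[ℂ] ℂ) (T : Fin n → X →L[ℂ] X),
    (∀ k, T k ∈ 𝓕) →
      ∑ k, ‖x' k (T k (x k))‖ ≤ C * rademacherNorm x * rademacherNorm x'

/-- Unconditional boundedness (U-boundedness). -/
def IsUBounded (𝓕 : Set (X →L[ℂ] X)) : Prop :=
  ∃ C : ℝ, ∀ (n : ℕ) (x : Fin n → X) (x' : Fin n → X →L[ℂ] ℂ) (T : Fin n → X →L[ℂ] X),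
    (∀ k, T k ∈ 𝓕) →
      ∑ k, ‖x' k (T k (x k))‖ ≤ C * maxSignNorm x * maxSignNorm x'

end Definitions

/-! In the coordinate `w = log z` sectors become strips. For `σ < ν < ρ`, Cauchy's formula on the
lines `Im w = ±ν`, with the rapidly decreasing kernel `e^{-2(w - log z)²} / (w - log z)`, recovers
`F(z)`, `z ∈ Σ_σ`, from the operators `F(e^w)`. The kernel is split into two scalar factors, `a_w =
gaussAt w` and `b_w = cauchyAt w`, each decreasing along the lines. The integral is replaced by
Riemann sums of mesh `1/N`, grouped into `N` grids of integer spacing, so that each Riemann sum is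
an average of sums `∑ₘ a_{wₘ}(z) b_{wₘ}(z) F(e^{wₘ})` over one grid.

The operator belonging to one grid is `∑ₘ b_{wₘ}(A) F(e^{wₘ}) a_{wₘ}(A)`. On integer translates `∑ₘ
|a_{wₘ}(z)|` and `∑ₘ |b_{wₘ}(z)|` are bounded uniformly in `z`, and the calculus is bounded by the
closed graph theorem (`exists_norm_calculus_le`). Hence all signed sums `∑ₘ ±a_{wₘ}(A)` and `∑ₘ
±b_{wₘ}(A)` are uniformly bounded. Tested against `x` and `x'`, these are exactly the two maxima in
the definition of U-boundedness, which therefore bounds the operators uniformly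
(`norm_sum_mul_mul_le`, `exists_graph_nodeSum`).

It remains to see that such bounded operators converge strongly. With the weights `φ_ε(λ) = exp(-(ε
log λ)²)`, every pair `(F, T)` of the calculus satisfies `T φ_ε(A) x = (2πi)⁻¹ ∫ φ_ε(λ) F(λ) R(λ, A)
x dλ` (`exists_isRepresented`), and `φ_ε(A) → 1` strongly (`tendsto_contourIntegral_one`). So `F`
determines `T` (`calculusGraph_unique`), and bounded pointwise convergence of functions with bounded
operators forces strong convergence of the operators (`exists_graph_of_norm_le`). WR- and
R-boundedness both imply U-boundedness. -/

namespace HInftyCalculus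

open Complex Filter Set MeasureTheory Topology

/-! ### Cauchy's theorem for strips -/

section LineIntegrals

variable {E : Type*} [NormedAddCommGroup E] [NormedSpace ℂ E]

lemma integrable_const_mul_inv_one_add_sq (C : ℝ) :
    Integrable fun t : ℝ => C * (1 + t ^ 2)⁻¹ :=
  integrable_inv_one_add_sq.const_mul C

lemma continuous_line {E : Type*} [TopologicalSpace E] {f : ℂ → E} {c : ℝ} {s : Set ℂ} (hc : ContinuousOn f s)
    (hs : ∀ w : ℂ, w.im = c → w ∈ s) : Continuous fun t : ℝ => f (t + c * I) :=
  hc.comp_continuous (by fun_prop) fun t => hs _ (by simp)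

lemma integrable_line {E : Type*} [NormedAddCommGroup E] {f : ℂ → E} {c C : ℝ} {s : Set ℂ} (hc : ContinuousOn f s)
    (hs : ∀ w : ℂ, w.im = c → w ∈ s)
    (hb : ∀ w : ℂ, w.im = c → ‖f w‖ ≤ C * (1 + w.re ^ 2)⁻¹) :
    Integrable fun t : ℝ => f (t + c * I) := by
  refine (integrable_const_mul_inv_one_add_sq C).mono'
    (continuous_line hc hs).aestronglyMeasurable (Eventually.of_forall fun t => ?_)
  simpa using hb (t + c * I) (by simp)

lemma tendsto_inv_one_add_sq : Tendsto (fun R : ℝ => (1 + R ^ 2)⁻¹) atTop (𝓝 0) := by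
  refine tendsto_inv_atTop_zero.comp ?_
  exact tendsto_atTop_add_const_left _ _ (tendsto_pow_atTop two_ne_zero)

/-- Cauchy's theorem for a strip. -/
theorem integral_line_eq_integral_line {f : ℂ → E} {a b C : ℝ} (hab : a ≤ b)
    (hc : ContinuousOn f {w | w.im ∈ Icc a b})
    (hd : ∀ w : ℂ, w.im ∈ Ioo a b → DifferentiableAt ℂ f w)
    (hb : ∀ w : ℂ, w.im ∈ Icc a b → ‖f w‖ ≤ C * (1 + w.re ^ 2)⁻¹) :
    ∫ t : ℝ, f (t + a * I) = ∫ t : ℝ, f (t + b * I) := by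
  have hia : Integrable fun t : ℝ => f (t + a * I) :=
    integrable_line hc (fun w hw => by simp [hw, hab]) fun w hw => hb w (by simp [hw, hab])
  have hib : Integrable fun t : ℝ => f (t + b * I) :=
    integrable_line hc (fun w hw => by simp [hw, hab]) fun w hw => hb w (by simp [hw, hab])
  have h1 := intervalIntegral_tendsto_integral hia tendsto_neg_atTop_atBot tendsto_id
  have h2 := intervalIntegral_tendsto_integral hib tendsto_neg_atTop_atBot tendsto_id
  -- Both vertical sides of the rectangle are treated at once: `s R` is `R` or `-R`, and the bound
  -- only sees its square.
  have side : ∀ s : ℝ → ℝ, (∀ R, s R ^ 2 = R ^ 2) →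
      Tendsto (fun R : ℝ => I • ∫ y : ℝ in a..b, f (s R + y * I)) atTop (𝓝 0) := by
    intro s hs
    refine squeeze_zero_norm (a := fun R : ℝ => C * (1 + R ^ 2)⁻¹ * |b - a|) (fun R => ?_) ?_
    · rw [norm_smul, norm_I, one_mul]
      refine intervalIntegral.norm_integral_le_of_norm_le_const fun y hy => ?_
      rw [uIoc_of_le hab] at hy
      have := hb (s R + y * I) (by simpa using ⟨hy.1.le, hy.2⟩)
      simpa [hs] using this
    · simpa using (tendsto_inv_one_add_sq.const_mul C).mul_const |b - a|
  have h3 := ((h1.sub h2).add (side id fun R => rfl)).sub (side (fun R => -R) fun R => by ring)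
  have h0 : ∀ R : ℝ, 0 < R → (∫ x in -R..R, f (x + a * I)) - (∫ x in -R..R, f (x + b * I)) +
      I • (∫ y : ℝ in a..b, f (R + y * I)) - I • (∫ y : ℝ in a..b, f ((-R : ℝ) + y * I)) = 0 := by
    intro R hR
    have := integral_boundary_rect_eq_zero_of_continuousOn_of_differentiableOn f
      (⟨-R, a⟩ : ℂ) (⟨R, b⟩ : ℂ) (hc.mono fun w hw => by
        have := hw.2; rwa [uIcc_of_le hab] at this) (fun w hw => by
        have := hw.2
        simp only [min_eq_left hab, max_eq_right hab] at this
        exact (hd w this).differentiableWithinAt)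
    simpa using this
  have h4 := h3.congr' (f₂ := fun _ => 0) (by
    filter_upwards [eventually_gt_atTop 0] with R hR
    simpa using h0 R hR)
  have := tendsto_nhds_unique h4 tendsto_const_nhds
  simpa [sub_eq_zero] using this

end LineIntegrals

/-! ### Gaussian weights -/

section Gaussian

lemma norm_exp_neg_mul_sq (ε : ℝ) (w : ℂ) :
    ‖exp (-(ε * w) ^ 2)‖ = Real.exp (ε ^ 2 * w.im ^ 2) * Real.exp (-(ε ^ 2 * w.re ^ 2)) := by
  rw [norm_exp, ← Real.exp_add]
  congr 1
  simp [sq]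
  ring

lemma exp_neg_le_inv_one_add {x : ℝ} (hx : 0 ≤ x) : Real.exp (-x) ≤ (1 + x)⁻¹ := by
  rw [Real.exp_neg]
  exact inv_anti₀ (by positivity) (by linarith [Real.add_one_le_exp x])

lemma exists_norm_gaussian_le {ε : ℝ} (hε : 0 < ε) (Y : ℝ) :
    ∃ C, 0 ≤ C ∧ ∀ w : ℂ, |w.im| ≤ Y → ‖exp (-(ε * w) ^ 2)‖ ≤ C * (1 + w.re ^ 2)⁻¹ := by
  -- The second factor comes from `1 + x² ≤ (1 + ε⁻²)(1 + ε² x²)`. Gaussian decay is weakened to `(1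
  -- + x²)⁻¹`, the decay rate used for the line integrals throughout.
  refine ⟨Real.exp (ε ^ 2 * Y ^ 2) * (1 + (ε ^ 2)⁻¹), by positivity, fun w hw => ?_⟩
  rw [norm_exp_neg_mul_sq, mul_assoc]
  have h1 : w.im ^ 2 ≤ Y ^ 2 := sq_le_sq' (by linarith [neg_abs_le w.im]) ((le_abs_self _).trans hw)
  refine mul_le_mul (Real.exp_le_exp.2 (by gcongr)) ?_ (by positivity) (by positivity)
  refine (exp_neg_le_inv_one_add (by positivity)).trans ?_
  rw [← div_eq_mul_inv, inv_eq_one_div, div_le_div_iff₀ (by positivity) (by positivity)]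
  have : (ε ^ 2)⁻¹ * ε ^ 2 = 1 := inv_mul_cancel₀ (by positivity)
  nlinarith [sq_nonneg w.re, sq_nonneg ε, inv_pos.2 (sq_pos_of_pos hε),
    mul_nonneg (sq_nonneg ε) (sq_nonneg w.re)]

lemma differentiable_gaussian (ε : ℂ) : Differentiable ℂ fun w : ℂ => exp (-(ε * w) ^ 2) := by
  fun_prop

lemma norm_gaussian_le (ε : ℝ) {Y : ℝ} {w : ℂ} (hw : |w.im| ≤ Y) :
    ‖exp (-(ε * w) ^ 2)‖ ≤ Real.exp (ε ^ 2 * Y ^ 2) := by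
  rw [norm_exp_neg_mul_sq, ← Real.exp_add]
  have h1 : w.im ^ 2 ≤ Y ^ 2 := sq_le_sq' (by linarith [neg_abs_le w.im]) ((le_abs_self _).trans hw)
  refine Real.exp_le_exp.2 ?_
  have : ε ^ 2 * w.im ^ 2 ≤ ε ^ 2 * Y ^ 2 := by gcongr
  nlinarith [mul_nonneg (sq_nonneg ε) (sq_nonneg w.re)]

end Gaussian

/-! ### The Cauchy kernel with Gaussian decay -/

section CauchyKernel

/-- `e^{-w²} / w`, which replaces the Cauchy kernel on a strip. -/
noncomputable def cauchyKernel (w : ℂ) : ℂ := exp (-w ^ 2) * w⁻¹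

lemma continuousOn_cauchyKernel : ContinuousOn cauchyKernel {w | w ≠ 0} := by
  unfold cauchyKernel
  exact (by fun_prop : Continuous fun w : ℂ => exp (-w ^ 2)).continuousOn.mul
    (continuousOn_inv₀)

lemma differentiableAt_cauchyKernel {w : ℂ} (hw : w ≠ 0) : DifferentiableAt ℂ cauchyKernel w := by
  unfold cauchyKernel
  exact (by fun_prop : DifferentiableAt ℂ (fun w : ℂ => exp (-w ^ 2)) w).mul
    (differentiableAt_inv hw)

lemma exists_norm_cauchyKernel_le {a : ℝ} (ha : 0 < a) (Y : ℝ) :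
    ∃ C, 0 ≤ C ∧ ∀ w : ℂ, a ≤ |w.im| → |w.im| ≤ Y → ‖cauchyKernel w‖ ≤ C * (1 + w.re ^ 2)⁻¹ := by
  obtain ⟨C, hC0, hC⟩ := exists_norm_gaussian_le one_pos Y
  refine ⟨C * a⁻¹, by positivity, fun w h1 h2 => ?_⟩
  have h3 : ‖w‖⁻¹ ≤ a⁻¹ := inv_anti₀ ha (h1.trans (abs_im_le_norm w))
  have h4 := hC w h2
  simp only [ofReal_one, one_mul] at h4
  rw [cauchyKernel, norm_mul, norm_inv]
  calc _ ≤ C * (1 + w.re ^ 2)⁻¹ * a⁻¹ := by gcongr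
    _ = _ := by ring

lemma integral_cauchyKernel_line_eq {a b : ℝ} (hab : a ≤ b) (h : 0 < a ∨ b < 0) :
    ∫ t : ℝ, cauchyKernel (t + a * I) = ∫ t : ℝ, cauchyKernel (t + b * I) := by
  have key : ∃ d > 0, ∀ w : ℂ, w.im ∈ Icc a b → d ≤ |w.im| := by
    rcases h with h | h
    · exact ⟨a, h, fun w hw => hw.1.trans (le_abs_self _)⟩
    · exact ⟨-b, by linarith, fun w hw => by linarith [hw.2, neg_abs_le w.im]⟩
  obtain ⟨d, hd, hdw⟩ := key
  have hne : ∀ w : ℂ, w.im ∈ Icc a b → w ≠ 0 := by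
    rintro w hw rfl
    have := hdw 0 hw
    simp at this
    linarith
  obtain ⟨C, -, hC⟩ := exists_norm_cauchyKernel_le hd (max |a| |b|)
  refine integral_line_eq_integral_line (C := C) hab (continuousOn_cauchyKernel.mono hne)
    (fun w hw => differentiableAt_cauchyKernel (hne w (Ioo_subset_Icc_self hw)))
    (fun w hw => hC w (hdw w hw) (abs_le_max_abs_abs hw.1 hw.2))

/-- The measure `dw / w` is invariant under scaling, so lines at heights `±c` can be traded for
lines at heights `±1` with the Gaussian `e^{-(cw)²}`, which tends to `1` as `c → 0`. -/
lemma integral_cauchyKernel_scale {c : ℝ} (hc : 0 < c) (s : ℝ) :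
    ∫ t : ℝ, cauchyKernel (t + (c * s : ℝ) * I) =
      ∫ t : ℝ, exp (-(c * (t + s * I)) ^ 2) * (t + s * I)⁻¹ := by
  have h := Measure.integral_comp_mul_left (fun t : ℝ => cauchyKernel (t + (c * s : ℝ) * I)) c
  have h2 : ∀ t : ℝ, cauchyKernel ((c * t : ℝ) + (c * s : ℝ) * I) =
      (c : ℂ)⁻¹ * (exp (-(c * (t + s * I)) ^ 2) * (t + s * I)⁻¹) := by
    intro t
    have : ((c * t : ℝ) : ℂ) + (c * s : ℝ) * I = c * (t + s * I) := by push_cast; ring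
    rw [this, cauchyKernel, mul_inv]
    ring
  simp_rw [h2] at h
  rw [integral_const_mul, abs_of_pos (inv_pos.2 hc), real_smul, ofReal_inv] at h
  exact (mul_left_cancel₀ (by simpa using hc.ne') h).symm

/-- The values on the two lines are complex conjugates, so the difference is `2i` times an imaginary
part. It tends to `2i / (1 + t²)` as `c → 0`. -/
lemma kernel_difference (c t : ℝ) :
    exp (-(c * (t + (-1 : ℝ) * I)) ^ 2) * (t + (-1 : ℝ) * I)⁻¹ -
      exp (-(c * (t + (1 : ℝ) * I)) ^ 2) * (t + (1 : ℝ) * I)⁻¹ =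
      Real.exp (c ^ 2 - c ^ 2 * t ^ 2) * (2 * I *
        ((t * Real.sin (2 * c ^ 2 * t) + Real.cos (2 * c ^ 2 * t)) * (1 + t ^ 2)⁻¹ : ℝ)) := by
  have e1 : exp (-(c * (t + (-1 : ℝ) * I)) ^ 2) = exp ((c ^ 2 - c ^ 2 * t ^ 2 : ℝ)) *
      (Complex.cos ((2 * c ^ 2 * t : ℝ)) + Complex.sin ((2 * c ^ 2 * t : ℝ)) * I) := by
    rw [← exp_mul_I, ← exp_add]; congr 1; push_cast
    linear_combination (-(c:ℂ)^2) * I_sq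
  have e2 : exp (-(c * (t + (1 : ℝ) * I)) ^ 2) = exp ((c ^ 2 - c ^ 2 * t ^ 2 : ℝ)) *
      (Complex.cos ((2 * c ^ 2 * t : ℝ)) - Complex.sin ((2 * c ^ 2 * t : ℝ)) * I) := by
    have : Complex.cos ((2 * c ^ 2 * t : ℝ)) - Complex.sin ((2 * c ^ 2 * t : ℝ)) * I =
      Complex.cos (-(2 * c ^ 2 * t : ℝ)) + Complex.sin (-(2 * c ^ 2 * t : ℝ)) * I := by
      rw [Complex.cos_neg, Complex.sin_neg]; ring
    rw [this, ← exp_mul_I, ← exp_add]; congr 1; push_cast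
    linear_combination (-(c:ℂ)^2) * I_sq
  have hp : (t : ℂ) + I ≠ 0 := fun h => by simpa using congrArg Complex.im h
  have hm : (t : ℂ) - I ≠ 0 := fun h => by simpa using congrArg Complex.im h
  have hq : (1 + (t : ℂ) ^ 2) = (t + I) * (t - I) := by linear_combination I_sq
  rw [e1, e2]
  push_cast
  rw [hq]
  have : (t : ℂ) + -1 * I = t - I := by ring
  rw [this, one_mul]
  field_simp
  ring

end CauchyKernel

/-! ### Cauchy's integral formula on a strip -/

section CauchyFormula

lemma integral_cauchyKernel_line_eq_of_pos {a b : ℝ} (ha : 0 < a) (hb : 0 < b) :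
    ∫ t : ℝ, cauchyKernel (t + a * I) = ∫ t : ℝ, cauchyKernel (t + b * I) := by
  rcases le_total a b with h | h
  · exact integral_cauchyKernel_line_eq h (.inl ha)
  · exact (integral_cauchyKernel_line_eq h (.inl hb)).symm

lemma integral_cauchyKernel_line_eq_of_neg {a b : ℝ} (ha : a < 0) (hb : b < 0) :
    ∫ t : ℝ, cauchyKernel (t + a * I) = ∫ t : ℝ, cauchyKernel (t + b * I) := by
  rcases le_total a b with h | h
  · exact integral_cauchyKernel_line_eq h (.inr hb)
  · exact (integral_cauchyKernel_line_eq h (.inr ha)).symm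

lemma integrable_gaussian_mul_inv {ε s : ℝ} (hε : 0 < ε) (hs : s ≠ 0) :
    Integrable fun t : ℝ => exp (-(ε * (t + s * I)) ^ 2) * (t + s * I)⁻¹ := by
  obtain ⟨C, hC0, hC⟩ := exists_norm_gaussian_le hε |s|
  refine integrable_line (f := fun w => exp (-(ε * w) ^ 2) * w⁻¹) (C := C * |s|⁻¹)
    (s := {w | w ≠ 0}) ?_ ?_ ?_
  · exact (differentiable_gaussian ε).continuous.continuousOn.mul continuousOn_inv₀
  · rintro w hw rfl
    exact hs (by simpa using hw.symm)
  · intro w hw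
    have h3 : ‖w‖⁻¹ ≤ |s|⁻¹ := inv_anti₀ (abs_pos.2 hs) (hw ▸ abs_im_le_norm w)
    rw [norm_mul, norm_inv]
    calc _ ≤ C * (1 + w.re ^ 2)⁻¹ * |s|⁻¹ := by
          gcongr
          exact hC w (by rw [hw])
      _ = _ := by ring

lemma tendsto_integral_kernel_difference :
    Tendsto (fun n : ℕ => ∫ t : ℝ, (Real.exp ((1 / ((n : ℝ) + 1)) ^ 2 -
        (1 / ((n : ℝ) + 1)) ^ 2 * t ^ 2) * (2 * I *
        ((t * Real.sin (2 * (1 / ((n : ℝ) + 1)) ^ 2 * t) +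
          Real.cos (2 * (1 / ((n : ℝ) + 1)) ^ 2 * t)) * (1 + t ^ 2)⁻¹ : ℝ)) : ℂ))
      atTop (𝓝 (2 * Real.pi * I)) := by
  have hlim : ∫ t : ℝ, (2 * I * ((1 + t ^ 2)⁻¹ : ℝ) : ℂ) = 2 * Real.pi * I := by
    rw [integral_const_mul, integral_complex_ofReal, integral_univ_inv_one_add_sq]; ring
  rw [← hlim]
  refine tendsto_integral_of_dominated_convergence
    (fun t => (Real.exp 1 * 6) * (1 + t ^ 2)⁻¹) (fun n => ?_)
    (integrable_const_mul_inv_one_add_sq _) (fun n => Eventually.of_forall fun t => ?_)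
    (Eventually.of_forall fun t => ?_)
  · refine Continuous.aestronglyMeasurable ?_
    have : Continuous fun t : ℝ => (1 + t ^ 2)⁻¹ :=
      Continuous.inv₀ (by fun_prop) fun t => by positivity
    fun_prop
  · set c : ℝ := 1 / ((n : ℝ) + 1) with hc
    have hc1 : c ^ 2 ≤ 1 := by
      have : c ≤ 1 := by
        rw [hc, div_le_one (by positivity)]
        linarith [(Nat.cast_nonneg n : (0 : ℝ) ≤ n)]
      exact pow_le_one₀ (by positivity) this
    -- The unbounded factor `t` is compensated by the sine; the resulting `c² t²` is absorbed by
    -- `e^{-c² t²}`, uniformly in `c`.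
    have h1 : |t * Real.sin (2 * c ^ 2 * t)| ≤ 2 * (c ^ 2 * t ^ 2) := by
      rw [abs_mul]
      calc |t| * |Real.sin (2 * c ^ 2 * t)| ≤ |t| * |2 * c ^ 2 * t| := by
            exact mul_le_mul_of_nonneg_left Real.abs_sin_le_abs (abs_nonneg _)
        _ = _ := by
            rw [abs_mul, abs_of_nonneg (by positivity : 0 ≤ 2 * c ^ 2), ← sq_abs t]; ring
    have h2 : Real.exp (-(c ^ 2 * t ^ 2)) * (2 * (c ^ 2 * t ^ 2) + 1) ≤ 3 := by
      have := exp_neg_le_inv_one_add (x := c ^ 2 * t ^ 2) (by positivity)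
      have h0 : 0 ≤ c ^ 2 * t ^ 2 := by positivity
      calc _ ≤ (1 + c ^ 2 * t ^ 2)⁻¹ * (2 * (c ^ 2 * t ^ 2) + 1) := by gcongr
        _ ≤ 3 := by
          rw [inv_mul_le_iff₀ (by positivity)]; linarith
    have h3 : |t * Real.sin (2 * c ^ 2 * t) + Real.cos (2 * c ^ 2 * t)| ≤
        2 * (c ^ 2 * t ^ 2) + 1 :=
      (abs_add_le _ _).trans (add_le_add h1 (Real.abs_cos_le_one _))
    simp only [norm_mul, norm_real, Real.norm_eq_abs, Real.abs_exp, norm_I, Complex.norm_ofNat,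
      mul_one]
    rw [sub_eq_add_neg, Real.exp_add, abs_of_pos (by positivity : 0 < (1 + t ^ 2)⁻¹)]
    have h4 : Real.exp (c ^ 2) ≤ Real.exp 1 := Real.exp_le_exp.2 hc1
    calc _ = 2 * Real.exp (c ^ 2) * (Real.exp (-(c ^ 2 * t ^ 2)) *
          |t * Real.sin (2 * c ^ 2 * t) + Real.cos (2 * c ^ 2 * t)|) * (1 + t ^ 2)⁻¹ := by ring
      _ ≤ 2 * Real.exp 1 * 3 * (1 + t ^ 2)⁻¹ := by
          gcongr
          exact (mul_le_mul_of_nonneg_left h3 (by positivity)).trans h2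
      _ = _ := by ring
  · have h0 : Tendsto (fun n : ℕ => 1 / ((n : ℝ) + 1)) atTop (𝓝 0) :=
      tendsto_one_div_add_atTop_nhds_zero_nat
    have hcont : Continuous fun c : ℝ => (Real.exp (c ^ 2 - c ^ 2 * t ^ 2) * (2 * I *
        ((t * Real.sin (2 * c ^ 2 * t) + Real.cos (2 * c ^ 2 * t)) * (1 + t ^ 2)⁻¹ : ℝ)) : ℂ) := by
      fun_prop
    have := (hcont.tendsto 0).comp h0
    simpa [Function.comp_def] using this

/-- This is the residue at `0`. Neither integral changes when its line moves on its own side of the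
pole, so both may be taken at heights `±c` and rescaled; letting `c → 0` leaves `∫ 2i / (1 + t²)
dt`. -/
theorem integral_cauchyKernel_sub {a b : ℝ} (ha : 0 < a) (hb : 0 < b) :
    (∫ t : ℝ, cauchyKernel (t + (-a : ℝ) * I)) - ∫ t : ℝ, cauchyKernel (t + b * I) =
      2 * Real.pi * I := by
  refine tendsto_nhds_unique (Tendsto.congr (fun n => ?_) tendsto_const_nhds)
    tendsto_integral_kernel_difference
  set c : ℝ := 1 / ((n : ℝ) + 1) with hc
  have hc0 : 0 < c := by positivity
  rw [integral_cauchyKernel_line_eq_of_pos hb (b := c * 1) (by linarith),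
    integral_cauchyKernel_line_eq_of_neg (neg_lt_zero.2 ha) (b := c * (-1)) (by linarith),
    integral_cauchyKernel_scale hc0, integral_cauchyKernel_scale hc0, ← integral_sub
      (integrable_gaussian_mul_inv hc0 (by norm_num)) (integrable_gaussian_mul_inv hc0 (by norm_num))]
  simp_rw [kernel_difference]

lemma inv_one_add_sub_sq_le (t u : ℝ) :
    (1 + (t - u) ^ 2)⁻¹ ≤ 2 * (1 + u ^ 2) * (1 + t ^ 2)⁻¹ := by
  rw [← div_eq_mul_inv, inv_eq_one_div, div_le_div_iff₀ (by positivity) (by positivity)]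
  nlinarith [sq_nonneg (t - 2 * u), mul_nonneg (sq_nonneg u) (sq_nonneg (t - u)), sq_nonneg u]

lemma isOpen_strip (ρ : ℝ) : IsOpen {w : ℂ | |w.im| < ρ} :=
  isOpen_lt (by fun_prop) continuous_const

variable {E : Type*} [NormedAddCommGroup E] [NormedSpace ℂ E]

/-- Near `w₀` the quotient is continuous on a compact ball; away from it the denominator is bounded
below. -/
lemma exists_norm_dslope_le [CompleteSpace E] {G : ℂ → E} {ν ρ C : ℝ} (hνρ : ν < ρ)
    (hG : DifferentiableOn ℂ G {w | |w.im| < ρ}) (hb : ∀ w : ℂ, |w.im| < ρ → ‖G w‖ ≤ C)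
    {w₀ : ℂ} (hw₀ : |w₀.im| < ν) :
    ∃ M, 0 ≤ M ∧ ∀ w : ℂ, |w.im| ≤ ν → ‖dslope G w₀ w‖ ≤ M := by
  have hmem : {w : ℂ | |w.im| < ρ} ∈ 𝓝 w₀ := (isOpen_strip ρ).mem_nhds (hw₀.trans hνρ)
  have hd := (differentiableOn_dslope hmem).2 hG
  set r := ν - |w₀.im| with hr
  have hr0 : 0 < r := by linarith
  obtain ⟨M, hM⟩ := (isCompact_closedBall w₀ r).exists_bound_of_continuousOn
    (hd.continuousOn.mono (s := {w : ℂ | |w.im| < ρ}) fun w hw => by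
      have h1 : |w.im - w₀.im| ≤ r := by
        have := abs_im_le_norm (w - w₀)
        rw [Metric.mem_closedBall, dist_eq_norm] at hw
        simpa using this.trans hw
      have h2 : |w.im| ≤ |w.im - w₀.im| + |w₀.im| := by
        simpa using abs_add_le (w.im - w₀.im) w₀.im
      show |w.im| < ρ
      linarith)
  have hC0 : 0 ≤ C := (norm_nonneg _).trans (hb w₀ (hw₀.trans hνρ))
  refine ⟨max M (r⁻¹ * (C + C)), le_max_of_le_right (by positivity), fun w hw => ?_⟩
  by_cases h : w ∈ Metric.closedBall w₀ r
  · exact (hM w h).trans (le_max_left _ _)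
  · refine le_trans ?_ (le_max_right _ _)
    rw [mem_closedBall_iff_norm, not_le] at h
    have hne : w ≠ w₀ := by rintro rfl; simp at h; linarith
    rw [dslope_of_ne _ hne, slope_def_module, norm_smul, norm_inv]
    gcongr
    exact (norm_sub_le _ _).trans (add_le_add (hb w (hw.trans_lt hνρ)) (hb w₀ (hw₀.trans hνρ)))

lemma exists_norm_cauchyKernel_sub_le {w₀ : ℂ} {c : ℝ} (hc : c ≠ w₀.im) :
    ∃ C, 0 ≤ C ∧ ∀ w : ℂ, w.im = c → ‖cauchyKernel (w - w₀)‖ ≤ C * (1 + w.re ^ 2)⁻¹ := by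
  obtain ⟨C, hC0, hC⟩ := exists_norm_cauchyKernel_le (abs_pos.2 (sub_ne_zero.2 hc)) (|c - w₀.im|)
  refine ⟨C * (2 * (1 + w₀.re ^ 2)), by positivity, fun w hw => ?_⟩
  have h1 := hC (w - w₀) (by rw [sub_im, hw]) (by rw [sub_im, hw])
  rw [sub_re] at h1
  refine h1.trans ?_
  rw [mul_assoc]
  exact mul_le_mul_of_nonneg_left (inv_one_add_sub_sq_le _ _) hC0

lemma integrable_cauchyKernel_smul {G : ℂ → E} {ρ C c : ℝ}
    (hG : ContinuousOn G {w | |w.im| < ρ}) (hb : ∀ w : ℂ, |w.im| < ρ → ‖G w‖ ≤ C)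
    {w₀ : ℂ} (hc : c ≠ w₀.im) (hcρ : |c| < ρ) :
    Integrable fun t : ℝ => cauchyKernel (t + c * I - w₀) • G (t + c * I) := by
  obtain ⟨K, hK0, hK⟩ := exists_norm_cauchyKernel_sub_le hc
  refine integrable_line (f := fun w => cauchyKernel (w - w₀) • G w) (C := K * C)
    (s := {w | w ≠ w₀ ∧ |w.im| < ρ}) ?_ ?_ ?_
  · refine ContinuousOn.smul (continuousOn_cauchyKernel.comp (by fun_prop) ?_)
      (hG.mono fun w hw => hw.2)
    exact fun w hw => sub_ne_zero.2 hw.1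
  · exact fun w hw => ⟨by rintro rfl; exact hc hw.symm, by rwa [hw]⟩
  · intro w hw
    rw [norm_smul]
    have := hb w (by rwa [hw])
    calc _ ≤ K * (1 + w.re ^ 2)⁻¹ * C := by gcongr; exact hK w hw
      _ = _ := by ring

/-- Cauchy's integral formula for bounded functions on a strip. -/
theorem cauchy_formula_strip [CompleteSpace E] {G : ℂ → E} {ν ρ C : ℝ} (hνρ : ν < ρ)
    (hG : DifferentiableOn ℂ G {w | |w.im| < ρ}) (hb : ∀ w : ℂ, |w.im| < ρ → ‖G w‖ ≤ C)
    {w₀ : ℂ} (hw₀ : |w₀.im| < ν) :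
    (∫ t : ℝ, cauchyKernel (t + (-ν : ℝ) * I - w₀) • G (t + (-ν : ℝ) * I)) -
      ∫ t : ℝ, cauchyKernel (t + ν * I - w₀) • G (t + ν * I) = (2 * Real.pi * I) • G w₀ := by
  have hν : 0 < ν := (abs_nonneg _).trans_lt hw₀
  obtain ⟨M, hM0, hM⟩ := exists_norm_dslope_le hνρ hG hb hw₀
  have hmem : {w : ℂ | |w.im| < ρ} ∈ 𝓝 w₀ := (isOpen_strip ρ).mem_nhds (hw₀.trans hνρ)
  have hd := (differentiableOn_dslope hmem).2 hG
  have hsub : ∀ w : ℂ, w.im ∈ Icc (-ν) ν → |w.im| < ρ := fun w hw => (abs_le.2 hw).trans_lt hνρ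
  obtain ⟨K, hK0, hK⟩ := exists_norm_gaussian_le one_pos (ν + ν)
  -- The difference quotient of `G` at `w₀` has no pole, so its weighted integrals over the two
  -- lines agree.
  have hshift : (∫ t : ℝ, (fun w => exp (-(w - w₀) ^ 2) • dslope G w₀ w) (t + (-ν : ℝ) * I)) =
      ∫ t : ℝ, (fun w => exp (-(w - w₀) ^ 2) • dslope G w₀ w) (t + ν * I) := by
    refine integral_line_eq_integral_line (f := fun w => exp (-(w - w₀) ^ 2) • dslope G w₀ w)
      (C := K * (2 * (1 + w₀.re ^ 2)) * M) (by linarith)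
      ?_ ?_ ?_
    · exact (by fun_prop : Continuous fun w : ℂ => exp (-(w - w₀) ^ 2)).continuousOn.smul
        (hd.continuousOn.mono hsub)
    · intro w hw
      exact (by fun_prop : DifferentiableAt ℂ (fun w : ℂ => exp (-(w - w₀) ^ 2)) w).smul
        (hd.differentiableAt ((isOpen_strip ρ).mem_nhds (hsub w (Ioo_subset_Icc_self hw))))
    · intro w hw
      have h1 := hK (w - w₀) (by
        rw [sub_im]; exact (abs_sub _ _).trans (add_le_add (abs_le.2 hw) hw₀.le))
      simp only [ofReal_one, one_mul, sub_re] at h1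
      rw [norm_smul]
      calc _ ≤ K * (2 * (1 + w₀.re ^ 2) * (1 + w.re ^ 2)⁻¹) * M := by
            refine mul_le_mul (h1.trans ?_) (hM w (abs_le.2 hw)) (norm_nonneg _) (by positivity)
            exact mul_le_mul_of_nonneg_left (inv_one_add_sub_sq_le _ _) hK0
        _ = _ := by ring
  -- Each line integral splits into the Cauchy integral of `G` and a multiple of `G w₀`. The
  -- multiples for the two lines differ by the residue `2πi`.
  have hline : ∀ c : ℝ, c ≠ w₀.im → |c| < ρ →
      (∫ t : ℝ, (fun w => exp (-(w - w₀) ^ 2) • dslope G w₀ w) (t + c * I)) =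
      (∫ t : ℝ, cauchyKernel (t + c * I - w₀) • G (t + c * I)) -
        (∫ t : ℝ, cauchyKernel (t + (c - w₀.im : ℝ) * I)) • G w₀ := by
    intro c hc hcρ
    have h1 : ∀ t : ℝ, (fun w => exp (-(w - w₀) ^ 2) • dslope G w₀ w) (t + c * I) =
        cauchyKernel (t + c * I - w₀) • G (t + c * I) -
          cauchyKernel (t + c * I - w₀) • G w₀ := by
      intro t
      have hne : (t : ℂ) + c * I ≠ w₀ := fun h => hc (by simpa using congrArg Complex.im h)
      simp only
      rw [dslope_of_ne _ hne, slope_def_module, ← smul_sub, cauchyKernel, mul_smul]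
    have h2 : (∫ t : ℝ, cauchyKernel (t + c * I - w₀) • G w₀) =
        (∫ t : ℝ, cauchyKernel (t + (c - w₀.im : ℝ) * I)) • G w₀ := by
      rw [integral_smul_const, ← integral_sub_right_eq_self
        (fun t : ℝ => cauchyKernel (t + (c - w₀.im : ℝ) * I)) w₀.re]
      congr 2
      ext t
      congr 1
      apply Complex.ext <;> simp
    simp_rw [h1]
    rw [integral_sub (integrable_cauchyKernel_smul hG.continuousOn hb hc hcρ)
      (integrable_cauchyKernel_smul (G := fun _ => G w₀) continuousOn_const
        (fun _ _ => le_rfl) hc hcρ), h2]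
  have hlt := abs_lt.1 hw₀
  rw [hline _ (ne_of_lt hlt.1) (by rwa [abs_neg, abs_of_pos hν]),
    hline _ (ne_of_gt hlt.2) (by rwa [abs_of_pos hν])] at hshift
  have hκ := integral_cauchyKernel_sub (a := ν + w₀.im) (b := ν - w₀.im) (by linarith) (by linarith)
  rw [show -(ν + w₀.im) = -ν - w₀.im by ring] at hκ
  rw [← hκ, sub_smul]
  rw [sub_eq_sub_iff_sub_eq_sub] at hshift
  exact hshift

end CauchyFormula

/-! ### Riemann sums on the real line -/

section RiemannSums

variable {E : Type*} [NormedAddCommGroup E] [NormedSpace ℝ E] [CompleteSpace E]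

lemma inv_one_add_sq_le_of_abs_sub_le {s t : ℝ} (h : |s - t| ≤ 1) :
    (1 + s ^ 2)⁻¹ ≤ 3 * (1 + t ^ 2)⁻¹ := by
  rw [← div_eq_mul_inv, inv_eq_one_div, div_le_div_iff₀ (by positivity) (by positivity)]
  have : (s - t) ^ 2 ≤ 1 := by rw [← sq_abs]; exact pow_le_one₀ (abs_nonneg _) h
  nlinarith [sq_nonneg (2 * s - t)]

/-- The step function taking the value `g (j / N)` on `[j / N, (j + 1) / N)`, for
`-N² ≤ j < N²`. -/
noncomputable def stepApprox (g : ℝ → E) (N : ℕ) (t : ℝ) : E :=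
  ∑ j ∈ Finset.Ico (-(N * N : ℤ)) (N * N),
    (Ico ((j : ℝ) / N) ((j + 1 : ℝ) / N)).indicator (fun _ => g (j / N)) t

lemma stepApprox_eq {E : Type*} [NormedAddCommGroup E] (g : ℝ → E) {N : ℕ} (hN : 0 < N) (t : ℝ) :
    stepApprox g N t =
      if ⌊N * t⌋ ∈ Finset.Ico (-(N * N : ℤ)) (N * N) then g (⌊N * t⌋ / N) else 0 := by
  have hN' : (0 : ℝ) < N := by exact_mod_cast hN
  rw [stepApprox, ← Finset.sum_ite_eq _ ⌊N * t⌋ fun j : ℤ => g (j / N)]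
  refine Finset.sum_congr rfl fun j _ => ?_
  have : t ∈ Ico ((j : ℝ) / N) ((j + 1 : ℝ) / N) ↔ ⌊N * t⌋ = j := by
    rw [Int.floor_eq_iff, mem_Ico, div_le_iff₀ hN', lt_div_iff₀ hN', mul_comm t]
  rw [indicator_apply]
  by_cases h : ⌊N * t⌋ = j
  · simp [this.2 h, h]
  · rw [if_neg (fun h' => h (this.1 h')), if_neg h]

lemma integral_stepApprox (g : ℝ → E) {N : ℕ} (hN : 0 < N) :
    ∫ t, stepApprox g N t =
      (N : ℝ)⁻¹ • ∑ j ∈ Finset.Ico (-(N * N : ℤ)) (N * N), g (j / N) := by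
  have hN' : (0 : ℝ) < N := by exact_mod_cast hN
  have hvol : ∀ j : ℤ, volume.real (Ico ((j : ℝ) / N) ((j + 1 : ℝ) / N)) = (N : ℝ)⁻¹ := by
    intro j
    rw [Real.volume_real_Ico_of_le (by gcongr; linarith)]
    field_simp
    ring
  unfold stepApprox
  rw [integral_finsetSum, Finset.smul_sum]
  · refine Finset.sum_congr rfl fun j _ => ?_
    rw [integral_indicator_const _ measurableSet_Ico, hvol]
  · intro j _
    exact (integrable_indicator_iff measurableSet_Ico).2 (integrableOn_const (by simp))

/-- Division with remainder, `j = N m + r`, splits the mesh `j / N` into `N` grids `m + r / N` of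
integer spacing. The uniform estimates for the operators are available on each grid. -/
lemma sum_Ico_mul_eq {M : Type*} [AddCommMonoid M] (f : ℤ → M) {N : ℕ} (hN : 0 < N) :
    ∑ j ∈ Finset.Ico (-(N * N : ℤ)) (N * N), f j =
      ∑ r ∈ Finset.range N, ∑ m ∈ Finset.Ico (-(N : ℤ)) N, f (N * m + r) := by
  have hN' : (0 : ℤ) < N := by exact_mod_cast hN
  rw [← Finset.sum_product']
  refine Finset.sum_nbij' (fun j => ((j % N).toNat, j / N)) (fun p => N * p.2 + p.1) ?_ ?_ ?_ ?_ ?_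
  · intro j hj
    have h1 := Int.emod_nonneg j hN'.ne'
    have h2 := Int.emod_lt_of_pos j hN'
    rw [Finset.mem_Ico] at hj
    simp only [Finset.mem_product, Finset.mem_range, Finset.mem_Ico]
    refine ⟨by omega, ?_, ?_⟩
    · rw [Int.le_ediv_iff_mul_le hN']; linarith
    · rw [Int.ediv_lt_iff_lt_mul hN']; linarith
  · rintro ⟨r, m⟩ h
    simp only [Finset.mem_product, Finset.mem_range, Finset.mem_Ico] at h
    obtain ⟨hr, h1, h2⟩ := h
    have hr' : (r : ℤ) < N := by exact_mod_cast hr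
    have hr0 : (0 : ℤ) ≤ r := by positivity
    rw [Finset.mem_Ico]
    constructor <;> nlinarith
  · intro j _
    have h1 := Int.emod_nonneg j hN'.ne'
    simp only [Int.toNat_of_nonneg h1]
    exact Int.mul_ediv_add_emod j N
  · rintro ⟨r, m⟩ h
    simp only [Finset.mem_product, Finset.mem_range, Finset.mem_Ico] at h
    have hr' : (r : ℤ) < N := by exact_mod_cast h.1
    have hr0 : (0 : ℤ) ≤ r := by positivity
    ext
    · simp [Int.emod_eq_of_lt hr0 hr']
    · simp only
      rw [Int.mul_add_ediv_left _ _ hN'.ne', Int.ediv_eq_zero_of_lt hr0 hr', add_zero]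
  · intro j _
    have h1 := Int.emod_nonneg j hN'.ne'
    simp only [Int.toNat_of_nonneg h1]
    rw [Int.mul_ediv_add_emod]

/-- The window `[-N, N)` grows while the mesh `1 / N` shrinks. The step functions converge
dominatedly: a node at distance at most `1` from `t` costs a factor `3` in the bound. -/
theorem tendsto_riemann_sum {g : ℝ → E} {C : ℝ} (hg : Continuous g)
    (hb : ∀ t, ‖g t‖ ≤ C * (1 + t ^ 2)⁻¹) :
    Tendsto (fun N : ℕ => (N : ℝ)⁻¹ • ∑ r ∈ Finset.range N, ∑ m ∈ Finset.Ico (-(N : ℤ)) N,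
      g (m + r / N)) atTop (𝓝 (∫ t, g t)) := by
  have hC0 : 0 ≤ C := by simpa using (norm_nonneg _).trans (hb 0)
  -- The index is shifted because the nodes `j / N` need `N > 0`.
  have key : Tendsto (fun N : ℕ => ∫ t, stepApprox g (N + 1) t) atTop (𝓝 (∫ t, g t)) := by
    refine tendsto_integral_of_dominated_convergence (fun t => (C * 3) * (1 + t ^ 2)⁻¹)
      (fun N => ?_) (integrable_const_mul_inv_one_add_sq _)
      (fun N => Eventually.of_forall fun t => ?_) (Eventually.of_forall fun t => ?_)
    · unfold stepApprox
      refine Finset.aestronglyMeasurable_fun_sum _ fun j _ => ?_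
      exact aestronglyMeasurable_const.indicator measurableSet_Ico
    · rw [stepApprox_eq g N.succ_pos]
      split_ifs
      · refine (hb _).trans ?_
        rw [mul_assoc]
        refine mul_le_mul_of_nonneg_left (inv_one_add_sq_le_of_abs_sub_le ?_) hC0
        have hN' : (0 : ℝ) < (N + 1 : ℕ) := by positivity
        have h1 := Int.floor_le ((N + 1 : ℕ) * t)
        have h2 := Int.lt_floor_add_one ((N + 1 : ℕ) * t)
        have h3 : (1 : ℝ) ≤ (N + 1 : ℕ) := by push_cast; linarith [(Nat.cast_nonneg N : (0:ℝ) ≤ N)]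
        rw [abs_le]
        constructor
        · rw [neg_le_sub_iff_le_add, ← sub_le_iff_le_add, le_div_iff₀ hN']; nlinarith
        · rw [sub_le_iff_le_add, div_le_iff₀ hN']; nlinarith
      · rw [norm_zero]; positivity
    · have h1 : Tendsto (fun N : ℕ => (⌊(N + 1 : ℕ) * t⌋ : ℝ) / (N + 1 : ℕ)) atTop (𝓝 t) := by
        refine tendsto_of_tendsto_of_tendsto_of_le_of_le
          (g := fun N : ℕ => t - 1 / ((N : ℝ) + 1)) (h := fun _ => t)
          (by simpa using tendsto_const_nhds.sub (tendsto_one_div_add_atTop_nhds_zero_nat (𝕜 := ℝ)))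
          tendsto_const_nhds (fun N => ?_) fun N => ?_
        · have h2 := Int.lt_floor_add_one ((N + 1 : ℕ) * t)
          have hN' : (0 : ℝ) < (N + 1 : ℕ) := by positivity
          simp only
          rw [sub_le_iff_le_add, ← Nat.cast_succ, ← add_div, le_div_iff₀ hN']
          linarith
        · have h1 := Int.floor_le ((N + 1 : ℕ) * t)
          have hN' : (0 : ℝ) < (N + 1 : ℕ) := by positivity
          simp only
          rw [div_le_iff₀ hN']
          linarith
      refine ((hg.tendsto t).comp h1).congr' ?_
      filter_upwards [eventually_gt_atTop ⌈|t|⌉₊] with N hN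
      have hNt : |t| < N := Nat.lt_of_ceil_lt hN
      have h3 := abs_lt.1 hNt
      rw [stepApprox_eq g N.succ_pos, if_pos]
      · rfl
      · rw [Finset.mem_Ico]
        constructor
        · rw [Int.le_floor]; push_cast; nlinarith
        · rw [Int.floor_lt]; push_cast; nlinarith
  rw [← tendsto_add_atTop_iff_nat 1]
  refine key.congr fun N => ?_
  have hN : 0 < N + 1 := N.succ_pos
  have hN' : ((N + 1 : ℕ) : ℝ) ≠ 0 := by positivity
  rw [integral_stepApprox g hN, sum_Ico_mul_eq _ hN]
  congr 1
  refine Finset.sum_congr rfl fun r _ => Finset.sum_congr rfl fun m _ => ?_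
  congr 1
  push_cast at hN' ⊢
  field_simp

/-- The sums of `(1 + t²)⁻¹` over integer translates are uniformly bounded. -/
lemma exists_sum_inv_one_add_sq_le :
    ∃ K : ℝ, 0 ≤ K ∧ ∀ (s : Finset ℤ) (u : ℝ), ∑ m ∈ s, (1 + (m + u) ^ 2)⁻¹ ≤ K := by
  have hs : Summable fun m : ℤ => (1 + (m : ℝ) ^ 2)⁻¹ := by
    have h2 : Summable fun m : ℤ => 1 / (m : ℝ) ^ 2 :=
      Real.summable_one_div_int_pow.2 one_lt_two
    -- The extra term covers `m = 0`, where `1 / m ^ 2` is `0` by convention.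
    have h3 := h2.add (hasSum_ite_eq (0 : ℤ) (1 : ℝ)).summable
    refine Summable.of_nonneg_of_le (fun m => by positivity) (fun m => ?_) h3
    by_cases hm : m = 0
    · simp [hm]
    · have : (0 : ℝ) < (m : ℝ) ^ 2 := by positivity
      simp only [hm, if_false, add_zero, one_div]
      exact inv_anti₀ this (by linarith)
  refine ⟨3 * ∑' m : ℤ, (1 + (m : ℝ) ^ 2)⁻¹, by positivity, fun s u => ?_⟩
  -- Replacing `u` by its integer part costs a factor `3`; the integer shift then disappears in the
  -- sum over all of `ℤ`.
  have h1 : ∀ m : ℤ, (1 + ((m : ℝ) + u) ^ 2)⁻¹ ≤ 3 * (1 + ((m + ⌊u⌋ : ℤ) : ℝ) ^ 2)⁻¹ := by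
    intro m
    refine inv_one_add_sq_le_of_abs_sub_le ?_
    push_cast
    rw [abs_le]
    constructor <;> linarith [Int.floor_le u, Int.lt_floor_add_one u]
  have hs' : Summable fun m : ℤ => (1 + ((m + ⌊u⌋ : ℤ) : ℝ) ^ 2)⁻¹ :=
    (Equiv.addRight ⌊u⌋).summable_iff.2 hs
  calc _ ≤ ∑ m ∈ s, 3 * (1 + ((m + ⌊u⌋ : ℤ) : ℝ) ^ 2)⁻¹ := Finset.sum_le_sum fun m _ => h1 m
    _ = 3 * ∑ m ∈ s, (1 + ((m + ⌊u⌋ : ℤ) : ℝ) ^ 2)⁻¹ := by rw [Finset.mul_sum]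
    _ ≤ 3 * ∑' m : ℤ, (1 + ((m + ⌊u⌋ : ℤ) : ℝ) ^ 2)⁻¹ := by
        gcongr
        exact hs'.sum_le_tsum _ fun m _ => by positivity
    _ = _ := by
        congr 1
        exact (Equiv.addRight ⌊u⌋).tsum_eq fun m : ℤ => (1 + (m : ℝ) ^ 2)⁻¹

end RiemannSums

/-! ### Sectors and the exponential map -/

section Sectors

/-- Away from `0`, `|arg z|` is the angle between `1` and `z`, hence continuous even across the
negative axis, where `arg` jumps. -/
lemma continuousAt_abs_arg {z : ℂ} (hz : z ≠ 0) : ContinuousAt (fun z : ℂ => |z.arg|) z := by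
  have h := (InnerProductGeometry.continuousAt_angle (x := ((1 : ℂ), z)) one_ne_zero hz).comp
    (f := fun z : ℂ => ((1 : ℂ), z)) (by fun_prop)
  refine h.congr ?_
  filter_upwards [isOpen_ne.mem_nhds hz] with w hw
  simp [Complex.angle_one_left hw]

lemma isOpen_sector (σ : ℝ) : IsOpen (sector σ) := by
  rw [isOpen_iff_mem_nhds]
  intro z hz
  filter_upwards [isOpen_ne.mem_nhds hz.1, (continuousAt_abs_arg hz.1).eventually_lt_const hz.2]
    with w h1 h2 using ⟨h1, h2⟩

lemma isOpen_compl_sector (ω : ℝ) : IsOpen {z : ℂ | z ≠ 0 ∧ ω < |z.arg|} := by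
  rw [isOpen_iff_mem_nhds]
  intro z hz
  filter_upwards [isOpen_ne.mem_nhds hz.1, (continuousAt_abs_arg hz.1).eventually_const_lt hz.2]
    with w h1 h2 using ⟨h1, h2⟩

lemma sector_mono {σ τ : ℝ} (h : σ ≤ τ) : sector σ ⊆ sector τ :=
  fun _ hz => ⟨hz.1, hz.2.trans_le h⟩

lemma abs_arg_exp {w : ℂ} (hw : |w.im| ≤ Real.pi) : |(exp w).arg| = |w.im| := by
  obtain ⟨h1, h2⟩ := abs_le.1 hw
  rcases h1.eq_or_lt with h | h
  · have h3 : exp w = exp (w + 2 * Real.pi * I) := by rw [exp_periodic w]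
    rw [h3, ← log_im, log_exp (by simp; linarith [Real.pi_pos]) (by simp; linarith)]
    simp only [add_im, mul_im, mul_re, re_ofNat, im_ofNat, ofReal_re, ofReal_im, I_re, I_im]
    rw [show w.im + ((2 * Real.pi - 0 * 0) * 1 + (2 * 0 + 0 * Real.pi) * 0) = -w.im by
      rw [← h]; ring, abs_neg]
  · rw [← log_im, log_exp h h2]

lemma exp_mem_sector {σ : ℝ} (hσ : σ ≤ Real.pi) {w : ℂ} (hw : |w.im| < σ) : exp w ∈ sector σ :=
  ⟨exp_ne_zero w, by rwa [abs_arg_exp (hw.le.trans hσ)]⟩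

lemma exists_le_norm_sub {σ : ℝ} {μ : ℂ} (hμ : μ ≠ 0) (h : σ < |μ.arg|) :
    ∃ c > 0, ∀ z ∈ sector σ, c ≤ ‖μ - z‖ := by
  obtain ⟨c, hc, hball⟩ := Metric.isOpen_iff.1 (isOpen_compl_sector σ) μ ⟨hμ, h⟩
  refine ⟨c, hc, fun z hz => ?_⟩
  by_contra! hlt
  exact (hball (a := z) (by rwa [Metric.mem_ball, dist_comm, dist_eq_norm])).2.not_gt hz.2

end Sectors

/-! ### Resolvents of a sectorial operator -/

section Resolvent

variable {X : Type*} [NormedAddCommGroup X] [NormedSpace ℂ X] {A : X →ₗ.[ℂ] X} {ω : ℝ}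

lemma resolvent_unique {μ : ℂ} {R R' : X →L[ℂ] X} (h : IsResolventAt A μ R)
    (h' : IsResolventAt A μ R') : R = R' := by
  ext x
  obtain ⟨hx, e⟩ := h.right_inv x
  have := h'.left_inv ⟨R x, hx⟩
  simp only at this
  rw [← this, e]

open Classical in
/-- The resolvent of `A` at `μ`, and `0` if it does not exist. -/
noncomputable def res (A : X →ₗ.[ℂ] X) (μ : ℂ) : X →L[ℂ] X :=
  if h : ∃ R, IsResolventAt A μ R then h.choose else 0

lemma isResolventAt_res (hA : IsSectorial A ω) {μ : ℂ} (hμ : μ ≠ 0) (h : ω < |μ.arg|) :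
    IsResolventAt A μ (res A μ) := by
  have := hA.exists_resolvent μ hμ h
  rw [res, dif_pos this]
  exact this.choose_spec

lemma res_sub_res {μ κ : ℂ} {R R' : X →L[ℂ] X} (h : IsResolventAt A μ R)
    (h' : IsResolventAt A κ R') : R - R' = (κ - μ) • (R * R') := by
  ext x
  obtain ⟨hx, e⟩ := h'.right_inv x
  have e2 := h.left_inv ⟨R' x, hx⟩
  have e3 : μ • R' x - A ⟨R' x, hx⟩ = (μ - κ) • R' x + x := by
    have e' : A ⟨R' x, hx⟩ = κ • R' x - x := by rw [sub_eq_iff_eq_add] at e; rw [e]; abel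
    rw [e']
    module
  simp only at e2
  rw [e3, map_add, map_smul] at e2
  simp only [sub_apply, smul_apply,
    mul_apply_eq_comp]
  nth_rewrite 1 [← e2]
  module

lemma resolvent_commute {μ κ : ℂ} {R R' : X →L[ℂ] X} (h : IsResolventAt A μ R)
    (h' : IsResolventAt A κ R') : R * R' = R' * R := by
  by_cases hμκ : μ = κ
  · subst hμκ; rw [resolvent_unique h h']
  · have h1 := res_sub_res h h'
    have h2 := res_sub_res h' h
    have h3 : (κ - μ) • (R * R') = (κ - μ) • (R' * R) := by
      rw [← h1, ← neg_sub μ κ, neg_smul, ← h2, neg_sub]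
    exact smul_right_injective _ (sub_ne_zero.2 (Ne.symm hμκ)) h3

lemma mem_commutingAlgebra_iff {S : X →L[ℂ] X} :
    S ∈ commutingAlgebra A ω ↔
      ∀ (μ : ℂ) (R : X →L[ℂ] X), μ ≠ 0 → ω < |μ.arg| → IsResolventAt A μ R → R * S = S * R := by
  rw [commutingAlgebra, Subalgebra.mem_centralizer_iff]
  exact ⟨fun h μ R h1 h2 h3 => h R ⟨μ, h1, h2, h3⟩, fun h R ⟨μ, h1, h2, h3⟩ => h μ R h1 h2 h3⟩

lemma resolvent_mem_commutingAlgebra {μ : ℂ} {R : X →L[ℂ] X} (h : IsResolventAt A μ R) :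
    R ∈ commutingAlgebra A ω :=
  mem_commutingAlgebra_iff.2 fun _ _ _ _ h' => resolvent_commute h' h

lemma res_mul_comm (hA : IsSectorial A ω) {μ : ℂ} (hμ : μ ≠ 0) (h : ω < |μ.arg|)
    {S : X →L[ℂ] X} (hS : S ∈ commutingAlgebra A ω) : res A μ * S = S * res A μ :=
  mem_commutingAlgebra_iff.1 hS μ _ hμ h (isResolventAt_res hA hμ h)

lemma mem_commutingAlgebra_of_tendsto {T : ℕ → X →L[ℂ] X} {S : X →L[ℂ] X}
    (hT : ∀ n, T n ∈ commutingAlgebra A ω)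
    (h : ∀ x, Tendsto (fun n => T n x) atTop (𝓝 (S x))) : S ∈ commutingAlgebra A ω := by
  refine mem_commutingAlgebra_iff.2 fun μ R h1 h2 h3 => ?_
  ext x
  have e : ∀ n, R (T n x) = T n (R x) := fun n =>
    congrArg (· x) (mem_commutingAlgebra_iff.1 (hT n) μ R h1 h2 h3)
  refine tendsto_nhds_unique ((R.continuous.tendsto _).comp (h x)) ?_
  exact (h (R x)).congr fun n => (e n).symm

lemma exists_norm_smul_res_le (hA : IsSectorial A ω) {ν : ℝ} (hν : ω < ν) :
    ∃ C, 0 ≤ C ∧ ∀ μ : ℂ, μ ≠ 0 → ν ≤ |μ.arg| → ‖μ • res A μ‖ ≤ C := by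
  obtain ⟨C, hC⟩ := hA.resolvent_bound ν hν
  exact ⟨max C 0, le_max_right _ _, fun μ h1 h2 => (hC μ _ h1 h2
    (isResolventAt_res hA h1 (hν.trans_le h2))).trans (le_max_left _ _)⟩

lemma norm_res_le {μ : ℂ} (hμ : μ ≠ 0) {C : ℝ} (h : ‖μ • res A μ‖ ≤ C) :
    ‖res A μ‖ ≤ C * ‖μ‖⁻¹ := by
  rw [norm_smul] at h
  rw [← div_eq_mul_inv, le_div_iff₀ (norm_pos_iff.2 hμ)]
  linarith

lemma continuousAt_res (hA : IsSectorial A ω) {μ : ℂ} (hμ : μ ≠ 0) (h : ω < |μ.arg|) :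
    ContinuousAt (res A) μ := by
  obtain ⟨ν, h1, h2⟩ := exists_between h
  obtain ⟨C, hC0, hC⟩ := exists_norm_smul_res_le hA h1
  have hopen := (isOpen_compl_sector ν).mem_nhds (⟨hμ, h2⟩ : μ ∈ {z : ℂ | z ≠ 0 ∧ ν < |z.arg|})
  rw [ContinuousAt, tendsto_iff_norm_sub_tendsto_zero]
  have hlim : Tendsto (fun κ : ℂ => ‖μ - κ‖ * (C * ‖κ‖⁻¹ * (C * ‖μ‖⁻¹))) (𝓝 μ) (𝓝 0) := by
    have : ContinuousAt (fun κ : ℂ => ‖μ - κ‖ * (C * ‖κ‖⁻¹ * (C * ‖μ‖⁻¹))) μ := by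
      have : ContinuousAt (fun κ : ℂ => ‖κ‖⁻¹) μ :=
        continuousAt_id.norm.inv₀ (norm_ne_zero_iff.2 hμ)
      fun_prop
    simpa [ContinuousAt] using this
  refine squeeze_zero' (Eventually.of_forall fun _ => norm_nonneg _) ?_ hlim
  filter_upwards [hopen] with κ hκ
  rw [res_sub_res (isResolventAt_res hA hκ.1 (h1.trans hκ.2)) (isResolventAt_res hA hμ h), norm_smul]
  gcongr
  refine (norm_mul_le _ _).trans ?_
  gcongr
  · exact norm_res_le hκ.1 (hC κ hκ.1 hκ.2.le)
  · exact norm_res_le hμ (hC μ hμ h2.le)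

lemma differentiableAt_res (hA : IsSectorial A ω) {μ : ℂ} (hμ : μ ≠ 0) (h : ω < |μ.arg|) :
    DifferentiableAt ℂ (res A) μ := by
  refine HasDerivAt.differentiableAt (f' := -(res A μ * res A μ)) ?_
  rw [hasDerivAt_iff_tendsto_slope]
  have hopen := (isOpen_compl_sector ω).mem_nhds (⟨hμ, h⟩ : μ ∈ {z : ℂ | z ≠ 0 ∧ ω < |z.arg|})
  have hlim : Tendsto (fun κ => -(res A κ * res A μ)) (𝓝[≠] μ) (𝓝 (-(res A μ * res A μ))) :=
    (((continuousAt_res hA hμ h).tendsto.mono_left nhdsWithin_le_nhds).mul_const _).neg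
  refine hlim.congr' ?_
  filter_upwards [mem_nhdsWithin_of_mem_nhds hopen, self_mem_nhdsWithin] with κ hκ hne
  rw [slope_def_module, res_sub_res (isResolventAt_res hA hκ.1 hκ.2) (isResolventAt_res hA hμ h),
    smul_smul, ← neg_sub κ μ, mul_neg, inv_mul_cancel₀ (sub_ne_zero.2 hne), neg_one_smul]

lemma tendsto_of_tendsto_on_dense {ι : Type*} {l : Filter ι} {T : ι → X →L[ℂ] X}
    {U : X →L[ℂ] X} {C : ℝ} (hC : ∀ i, ‖T i‖ ≤ C) {D : Set X} (hD : Dense D)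
    (h : ∀ y ∈ D, Tendsto (fun i => T i y) l (𝓝 (U y))) (x : X) :
    Tendsto (fun i => T i x) l (𝓝 (U x)) := by
  rw [Metric.tendsto_nhds]
  intro ε hε
  have hM : 0 < |C| + ‖U‖ + 1 := by positivity
  obtain ⟨y, hy, hxy⟩ := hD.exists_dist_lt x (ε := ε / 2 / (|C| + ‖U‖ + 1)) (by positivity)
  rw [lt_div_iff₀ hM, dist_eq_norm] at hxy
  filter_upwards [(Metric.tendsto_nhds.1 (h y hy)) (ε / 2) (by positivity)] with i hi
  rw [dist_eq_norm] at hi ⊢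
  have e : T i x - U x = T i (x - y) - U (x - y) + (T i y - U y) := by
    simp only [map_sub]; abel
  have h1 : ‖T i (x - y)‖ ≤ |C| * ‖x - y‖ :=
    (T i).le_of_opNorm_le ((hC i).trans (le_abs_self _)) _
  have h2 : ‖U (x - y)‖ ≤ ‖U‖ * ‖x - y‖ := U.le_opNorm _
  rw [e]
  have h3 := norm_add_le (T i (x - y) - U (x - y)) (T i y - U y)
  have h4 := norm_sub_le (T i (x - y)) (U (x - y))
  nlinarith [norm_nonneg (x - y)]

/-- `e^w R(e^w, A)`. -/
noncomputable def expRes (A : X →ₗ.[ℂ] X) (w : ℂ) : X →L[ℂ] X := exp w • res A (exp w)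

lemma differentiableAt_expRes (hA : IsSectorial A ω) {w : ℂ} (h1 : ω < |w.im|)
    (h2 : |w.im| ≤ Real.pi) : DifferentiableAt ℂ (expRes A) w := by
  have h := differentiableAt_res hA (exp_ne_zero w) (by rwa [abs_arg_exp h2])
  exact differentiableAt_exp.smul (h.comp w differentiableAt_exp)

lemma exists_norm_expRes_le (hA : IsSectorial A ω) {ν : ℝ} (hν : ω < ν) :
    ∃ C, 0 ≤ C ∧ ∀ w : ℂ, ν ≤ |w.im| → |w.im| ≤ Real.pi → ‖expRes A w‖ ≤ C := by
  obtain ⟨C, hC0, hC⟩ := exists_norm_smul_res_le hA hν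
  exact ⟨C, hC0, fun w h1 h2 => hC _ (exp_ne_zero w) (by rwa [abs_arg_exp h2])⟩

lemma expRes_apply_comm (hA : IsSectorial A ω) {w : ℂ} (h1 : ω < |w.im|)
    (h2 : |w.im| ≤ Real.pi) {S : X →L[ℂ] X} (hS : S ∈ commutingAlgebra A ω) (x : X) :
    expRes A w (S x) = S (expRes A w x) := by
  have := congrArg (· x) (res_mul_comm hA (exp_ne_zero w) (by rwa [abs_arg_exp h2]) hS)
  simp only [mul_apply_eq_comp] at this
  simp [expRes, this]

/-- The two edges of the sector of angle `π` are the same ray, so there the contour integral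
collapses to one integral against a difference of weights. -/
lemma expRes_periodic (t : ℝ) :
    expRes A (t + (-Real.pi : ℝ) * I) = expRes A (t + Real.pi * I) := by
  have : exp ((t : ℂ) + (-Real.pi : ℝ) * I) = exp (t + Real.pi * I) := by
    rw [← exp_periodic]; congr 1; push_cast; ring
  rw [expRes, expRes, this]

lemma abs_arg_exp_add_pi (t : ℝ) : |(exp (t + Real.pi * I)).arg| = Real.pi := by
  rw [abs_arg_exp] <;> simp [abs_of_pos Real.pi_pos]

lemma norm_exp_add_pi (t : ℝ) : ‖exp (t + Real.pi * I)‖ = Real.exp t := by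
  simp [norm_exp]

lemma smul_res_apply_domain {μ : ℂ} {R : X →L[ℂ] X} (h : IsResolventAt A μ R) (u : A.domain) :
    μ • R u = u + R (A u) := by
  have := h.left_inv u
  rw [map_sub, map_smul, sub_eq_iff_eq_add] at this
  exact this

lemma exists_norm_expRes_pi_le (hA : IsSectorial A ω) :
    ∃ C, 0 ≤ C ∧ ∀ t : ℝ, ‖expRes A (t + Real.pi * I)‖ ≤ C := by
  obtain ⟨C, hC0, hC⟩ := exists_norm_smul_res_le hA hA.lt_pi
  exact ⟨C, hC0, fun t => hC _ (exp_ne_zero _) (by rw [abs_arg_exp_add_pi])⟩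

lemma isResolventAt_res_exp_add_pi (hA : IsSectorial A ω) (t : ℝ) :
    IsResolventAt A (exp (t + Real.pi * I)) (res A (exp (t + Real.pi * I))) :=
  isResolventAt_res hA (exp_ne_zero _) (by rw [abs_arg_exp_add_pi]; exact hA.lt_pi)

/-- On the domain `λ R(λ, A) u - u = R(λ, A) A u = O(1 / |λ|)`. Uniform boundedness and density give
the rest. -/
lemma tendsto_expRes_atTop (hA : IsSectorial A ω) (x : X) :
    Tendsto (fun t : ℝ => expRes A (t + Real.pi * I) x) atTop (𝓝 x) := by
  obtain ⟨C, hC0, hC⟩ := exists_norm_expRes_pi_le hA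
  refine tendsto_of_tendsto_on_dense (U := ContinuousLinearMap.id ℂ X) hC hA.dense_domain ?_ x
  intro y hy
  rw [tendsto_iff_norm_sub_tendsto_zero]
  have hlim : Tendsto (fun t : ℝ => C * (Real.exp t)⁻¹ * ‖A ⟨y, hy⟩‖) atTop (𝓝 0) := by
    simpa using ((tendsto_inv_atTop_zero.comp Real.tendsto_exp_atTop).const_mul C).mul_const
      ‖A ⟨y, hy⟩‖
  refine squeeze_zero (fun _ => norm_nonneg _) (fun t => ?_) hlim
  have h := smul_res_apply_domain (isResolventAt_res_exp_add_pi hA t) ⟨y, hy⟩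
  simp only at h
  simp only [expRes, smul_apply, ContinuousLinearMap.id_apply]
  rw [h, add_sub_cancel_left]
  have h2 := norm_res_le (exp_ne_zero _) (hC t)
  rw [norm_exp_add_pi] at h2
  exact ContinuousLinearMap.le_of_opNorm_le _ h2 _

/-- On the range `λ R(λ, A) A u = λ (λ R(λ, A) u - u) = O(|λ|)`. Here the density of the range is
used. -/
lemma tendsto_expRes_atBot (hA : IsSectorial A ω) (x : X) :
    Tendsto (fun t : ℝ => expRes A (t + Real.pi * I) x) atBot (𝓝 0) := by
  obtain ⟨C, hC0, hC⟩ := exists_norm_expRes_pi_le hA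
  refine tendsto_of_tendsto_on_dense (U := 0) hC hA.dense_range ?_ x
  rintro _ ⟨u, rfl⟩
  rw [tendsto_iff_norm_sub_tendsto_zero]
  have hlim : Tendsto (fun t : ℝ => Real.exp t * ((C + 1) * ‖(u : X)‖)) atBot (𝓝 0) := by
    simpa using Real.tendsto_exp_atBot.mul_const ((C + 1) * ‖(u : X)‖)
  refine squeeze_zero (fun _ => norm_nonneg _) (fun t => ?_) hlim
  have h := smul_res_apply_domain (isResolventAt_res_exp_add_pi hA t) u
  have h' : res A (exp (t + Real.pi * I)) (A u) = expRes A (t + Real.pi * I) u - u := by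
    simp only [expRes, smul_apply]
    rw [h]; abel
  have e : expRes A (t + Real.pi * I) (A u) =
      exp (t + Real.pi * I) • (expRes A (t + Real.pi * I) u - u) := by
    rw [← h']; rfl
  simp only [zero_apply, sub_zero]
  rw [e, norm_smul, norm_exp_add_pi]
  gcongr
  refine (norm_sub_le _ _).trans ?_
  have := ContinuousLinearMap.le_of_opNorm_le _ (hC t) (u : X)
  linarith

end Resolvent

/-! ### Weighted contour integrals and approximation of the identity -/

section ContourIntegral

variable {X : Type*} [NormedAddCommGroup X] [NormedSpace ℂ X] {A : X →ₗ.[ℂ] X} {ω : ℝ}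

/-- The integrand `φ(λ) λ R(λ, A) F(λ) x` at `λ = e^w`, with the weight
`φ(e^w) = exp (-(ε w)²)`. -/
noncomputable def contourIntegrand (A : X →ₗ.[ℂ] X) (ε : ℝ) (F : ℂ → X →L[ℂ] X) (x : X) (w : ℂ) :
    X :=
  exp (-(ε * w) ^ 2) • expRes A w (F (exp w) x)

/-- `(2πi)⁻¹ ∫ φ(λ) F(λ) R(λ, A) x dλ` over the boundary of the sector `Σ_ν`, with the weight
`φ(λ) = exp (-(ε log λ)²)`, in the coordinate `w = log λ`. -/
noncomputable def contourIntegral (A : X →ₗ.[ℂ] X) (ε ν : ℝ) (F : ℂ → X →L[ℂ] X) (x : X) : X :=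
  (2 * Real.pi * I : ℂ)⁻¹ • ((∫ t : ℝ, contourIntegrand A ε F x (t + (-ν : ℝ) * I)) -
    ∫ t : ℝ, contourIntegrand A ε F x (t + ν * I))

lemma MemOpHInf_mono {𝒜 : Subalgebra ℂ (X →L[ℂ] X)} {σ τ : ℝ} {F : ℂ → X →L[ℂ] X}
    (h : MemOpHInf 𝒜 τ F) (hστ : σ ≤ τ) : MemOpHInf 𝒜 σ F where
  mem z hz := h.mem z (sector_mono hστ hz)
  analytic x := (h.analytic x).mono (sector_mono hστ)
  bounded := h.bounded.imp fun _ hC z hz => hC z (sector_mono hστ hz)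

lemma MemHInf_mono {σ τ : ℝ} {f : ℂ → ℂ} (h : MemHInf τ f) (hστ : σ ≤ τ) : MemHInf σ f where
  analytic := h.analytic.mono (sector_mono hστ)
  bounded := h.bounded.imp fun _ hC z hz => hC z (sector_mono hστ hz)

lemma differentiableOn_comp_exp {E : Type*} [NormedAddCommGroup E] [NormedSpace ℂ E] {G : ℂ → E}
    {σ : ℝ} (hG : DifferentiableOn ℂ G (sector σ)) (hσ : σ ≤ Real.pi) :
    DifferentiableOn ℂ (fun w => G (exp w)) {w | |w.im| < σ} :=
  hG.comp differentiable_exp.differentiableOn fun _ hw => exp_mem_sector hσ hw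

lemma differentiableAt_contourIntegrand (hA : IsSectorial A ω) {ε σ : ℝ} {F : ℂ → X →L[ℂ] X}
    (hF : MemOpHInf (commutingAlgebra A ω) σ F) (hσ : σ ≤ Real.pi) (x : X) {w : ℂ}
    (h1 : ω < |w.im|) (h2 : |w.im| < σ) : DifferentiableAt ℂ (contourIntegrand A ε F x) w := by
  refine DifferentiableAt.smul (by fun_prop) ?_
  exact (differentiableAt_expRes hA h1 (h2.le.trans hσ)).clm_apply
    ((differentiableOn_comp_exp (hF.analytic x) hσ).differentiableAt
      ((isOpen_strip σ).mem_nhds h2))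

/-- `K` depends on `F` only through the bound `C`, so it dominates a whole bounded sequence of
functions. -/
lemma exists_norm_contourIntegrand_le (hA : IsSectorial A ω) {ε ν C : ℝ} (hε : 0 < ε) (hν : ω < ν)
    (hC0 : 0 ≤ C) (x : X) :
    ∃ K, 0 ≤ K ∧ ∀ (F : ℂ → X →L[ℂ] X) (w : ℂ), ‖F (exp w)‖ ≤ C → ν ≤ |w.im| →
      |w.im| ≤ Real.pi → ‖contourIntegrand A ε F x w‖ ≤ K * (1 + w.re ^ 2)⁻¹ := by
  obtain ⟨K, hK0, hK⟩ := exists_norm_gaussian_le hε Real.pi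
  obtain ⟨M, hM0, hM⟩ := exists_norm_expRes_le hA hν
  refine ⟨K * (M * (C * ‖x‖)), by positivity, fun F w hF h1 h2 => ?_⟩
  rw [contourIntegrand, norm_smul]
  calc _ ≤ K * (1 + w.re ^ 2)⁻¹ * (M * (C * ‖x‖)) := by
        gcongr
        · exact hK w h2
        · exact ContinuousLinearMap.le_of_opNorm_le_of_le _ (hM w h1 h2)
            (ContinuousLinearMap.le_of_opNorm_le _ hF x)
    _ = _ := by ring

lemma exists_norm_contourIntegrand_le_of_memOpHInf (hA : IsSectorial A ω) {ε ν σ : ℝ} (hε : 0 < ε)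
    (hν : ω < ν) (hσ : σ ≤ Real.pi) {F : ℂ → X →L[ℂ] X}
    (hF : MemOpHInf (commutingAlgebra A ω) σ F) (x : X) :
    ∃ K, 0 ≤ K ∧ ∀ w : ℂ, ν ≤ |w.im| → |w.im| < σ →
      ‖contourIntegrand A ε F x w‖ ≤ K * (1 + w.re ^ 2)⁻¹ := by
  obtain ⟨C, hC⟩ := hF.bounded
  obtain ⟨K, hK0, hK⟩ := exists_norm_contourIntegrand_le hA (C := |C|) hε hν (abs_nonneg _) x
  exact ⟨K, hK0, fun w h1 h2 =>
    hK F w ((hC _ (exp_mem_sector hσ h2)).trans (le_abs_self _)) h1 (h2.le.trans hσ)⟩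

lemma integrable_contourIntegrand (hA : IsSectorial A ω) {ε σ c : ℝ} (hε : 0 < ε)
    (hσ : σ ≤ Real.pi) {F : ℂ → X →L[ℂ] X} (hF : MemOpHInf (commutingAlgebra A ω) σ F) (x : X)
    (h1 : ω < |c|) (h2 : |c| < σ) :
    Integrable fun t : ℝ => contourIntegrand A ε F x (t + c * I) := by
  obtain ⟨K, hK0, hK⟩ := exists_norm_contourIntegrand_le_of_memOpHInf hA hε h1 hσ hF x
  refine integrable_line (s := {w | ω < |w.im| ∧ |w.im| < σ}) (fun w hw =>
    (differentiableAt_contourIntegrand hA hF hσ x hw.1 hw.2).continuousAt.continuousWithinAt)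
    (fun w hw => by simp [hw, h1, h2]) fun w hw => hK w (by rw [hw]) (by rwa [hw])

lemma integral_contourIntegrand_eq (hA : IsSectorial A ω) {ε σ a b : ℝ} (hε : 0 < ε)
    (hσ : σ ≤ Real.pi) {F : ℂ → X →L[ℂ] X} (hF : MemOpHInf (commutingAlgebra A ω) σ F) (x : X)
    (hab : a ≤ b) {ν : ℝ} (hν : ω < ν) (h : ∀ c ∈ Icc a b, ν ≤ |c| ∧ |c| < σ) :
    ∫ t : ℝ, contourIntegrand A ε F x (t + a * I) =
      ∫ t : ℝ, contourIntegrand A ε F x (t + b * I) := by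
  obtain ⟨K, hK0, hK⟩ := exists_norm_contourIntegrand_le_of_memOpHInf hA hε hν hσ hF x
  have hd : ∀ w : ℂ, w.im ∈ Icc a b → DifferentiableAt ℂ (contourIntegrand A ε F x) w :=
    fun w hw => differentiableAt_contourIntegrand hA hF hσ x (hν.trans_le (h _ hw).1) (h _ hw).2
  exact integral_line_eq_integral_line hab
    (fun w hw => (hd w hw).continuousAt.continuousWithinAt)
    (fun w hw => hd w (Ioo_subset_Icc_self hw)) fun w hw => hK w (h _ hw).1 (h _ hw).2

/-- The contour integral does not depend on the angle of the contour. -/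
lemma contourIntegral_eq (hA : IsSectorial A ω) {ε σ μ ν : ℝ} (hε : 0 < ε) (hσ : σ ≤ Real.pi)
    {F : ℂ → X →L[ℂ] X} (hF : MemOpHInf (commutingAlgebra A ω) σ F) (x : X)
    (h1 : ω < μ) (hμν : μ ≤ ν) (h2 : ν < σ) :
    contourIntegral A ε μ F x = contourIntegral A ε ν F x := by
  have hμ : 0 < μ := hA.nonneg.trans_lt h1
  rw [contourIntegral, contourIntegral, integral_contourIntegrand_eq hA hε hσ hF x hμν h1,
    integral_contourIntegrand_eq hA hε hσ hF x (neg_le_neg hμν) h1]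
  · intro c hc
    rw [abs_of_neg (by linarith [hc.2])]
    constructor <;> linarith [hc.1, hc.2]
  · intro c hc
    rw [abs_of_pos (by linarith [hc.1])]
    constructor <;> linarith [hc.1, hc.2]

/-- For a constant function the contour may be opened up to the negative axis itself, an endpoint
which `contourIntegral_eq` does not reach. -/
lemma contourIntegral_one_eq_pi (hA : IsSectorial A ω) {ε ν : ℝ} (hε : 0 < ε) (x : X)
    (h1 : ω < ν) (h2 : ν ≤ Real.pi) :
    contourIntegral A ε ν (fun _ => 1) x = contourIntegral A ε Real.pi (fun _ => 1) x := by
  have hν : 0 < ν := hA.nonneg.trans_lt h1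
  obtain ⟨K, hK0, hK⟩ := exists_norm_contourIntegrand_le hA (C := 1) hε h1 zero_le_one x
  have key : ∀ a b : ℝ, a ≤ b → (∀ c ∈ Icc a b, ν ≤ |c| ∧ |c| ≤ Real.pi) →
      ∫ t : ℝ, contourIntegrand A ε (fun _ => 1) x (t + a * I) =
      ∫ t : ℝ, contourIntegrand A ε (fun _ => 1) x (t + b * I) := by
    intro a b hab h
    have hd : ∀ w : ℂ, w.im ∈ Icc a b →
        DifferentiableAt ℂ (contourIntegrand A ε (fun _ => 1) x) w := fun w hw =>
      DifferentiableAt.smul (by fun_prop)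
        ((differentiableAt_expRes hA (h1.trans_le (h _ hw).1) (h _ hw).2).clm_apply
          (differentiableAt_const _))
    exact integral_line_eq_integral_line hab
      (fun w hw => (hd w hw).continuousAt.continuousWithinAt)
      (fun w hw => hd w (Ioo_subset_Icc_self hw)) fun w hw =>
        hK _ w ContinuousLinearMap.norm_id_le (h _ hw).1 (h _ hw).2
  rw [contourIntegral, contourIntegral, key ν Real.pi h2, key (-Real.pi) (-ν) (neg_le_neg h2)]
  · intro c hc
    rw [abs_of_neg (by linarith [hc.2])]
    constructor <;> linarith [hc.1, hc.2]
  · intro c hc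
    rw [abs_of_pos (by linarith [hc.1])]
    constructor <;> linarith [hc.1, hc.2]

lemma integral_two_mul_exp_neg_sq : ∫ v in Ioi (0 : ℝ), 2 * v * Real.exp (-v ^ 2) = 1 := by
  have h := integral_Ioi_of_hasDerivAt_of_tendsto' (a := 0) (m := 0)
    (f := fun v : ℝ => -Real.exp (-v ^ 2)) (f' := fun v => 2 * v * Real.exp (-v ^ 2)) ?_ ?_ ?_
  · rw [h]; simp
  · intro v _
    have : HasDerivAt (fun v : ℝ => -v ^ 2) (-(2 * v)) v := by
      simpa using (hasDerivAt_pow 2 v).fun_neg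
    convert! this.exp.fun_neg using 1
    ring
  · have := ((integrable_mul_exp_neg_mul_sq one_pos).const_mul 2).integrableOn (s := Ioi (0 : ℝ))
    refine this.congr_fun (fun v _ => ?_) measurableSet_Ioi
    simp only [neg_mul, one_mul]
    ring
  · rw [← neg_zero]
    refine (Real.tendsto_exp_neg_atTop_nhds_zero.comp (tendsto_pow_atTop two_ne_zero)).neg

/-- On `Im w = ±π` the weights are complex conjugates, so their difference divided by `2πi` is a
real kernel. -/
lemma gaussian_difference (ε t : ℝ) :
    (2 * Real.pi * I : ℂ)⁻¹ * (exp (-(ε * (t + (-Real.pi : ℝ) * I)) ^ 2) -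
      exp (-(ε * (t + Real.pi * I)) ^ 2)) =
    (Real.sin (2 * Real.pi * ε ^ 2 * t) / Real.pi *
      Real.exp (ε ^ 2 * Real.pi ^ 2 - ε ^ 2 * t ^ 2) : ℝ) := by
  have e1 : exp (-(ε * (t + (-Real.pi : ℝ) * I)) ^ 2) =
      exp ((ε ^ 2 * Real.pi ^ 2 - ε ^ 2 * t ^ 2 : ℝ)) *
      exp ((2 * Real.pi * ε ^ 2 * t : ℝ) * I) := by
    rw [← exp_add]; congr 1; push_cast
    linear_combination (-(ε : ℂ) ^ 2 * Real.pi ^ 2) * I_sq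
  have e2 : exp (-(ε * (t + Real.pi * I)) ^ 2) =
      exp ((ε ^ 2 * Real.pi ^ 2 - ε ^ 2 * t ^ 2 : ℝ)) *
      exp (-(2 * Real.pi * ε ^ 2 * t : ℝ) * I) := by
    rw [← exp_add]; congr 1; push_cast
    linear_combination (-(ε : ℂ) ^ 2 * Real.pi ^ 2) * I_sq
  have hpi : (Real.pi : ℂ) ≠ 0 := by exact_mod_cast Real.pi_ne_zero
  rw [e1, e2, exp_mul_I, exp_mul_I, Complex.cos_neg, Complex.sin_neg]
  push_cast
  field_simp
  ring

/-- With `ε = 1 / N`, the substitution `t = N v` gives the Gaussian a fixed width and pushes the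
resolvents to `e^{N v}`, towards infinity for `v > 0` and towards zero for `v < 0`. -/
lemma contourIntegral_pi_eq (hA : IsSectorial A ω) {N : ℝ} (hN : 0 < N) (x : X) :
    contourIntegral A N⁻¹ Real.pi (fun _ => 1) x =
      ∫ v : ℝ, ((N * Real.sin (2 * Real.pi * v * N⁻¹) / Real.pi *
        Real.exp (N⁻¹ ^ 2 * Real.pi ^ 2 - v ^ 2) : ℝ) : ℂ) •
          expRes A ((N * v : ℝ) + Real.pi * I) x := by
  obtain ⟨K, hK0, hK⟩ := exists_norm_contourIntegrand_le hA (C := 1) (inv_pos.2 hN) hA.lt_pi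
    zero_le_one x
  have hint : ∀ c : ℝ, |c| = Real.pi →
      Integrable fun t : ℝ => contourIntegrand A N⁻¹ (fun _ => 1) x (t + c * I) := by
    intro c hc
    refine integrable_line (s := {w | |w.im| = Real.pi}) (C := K) (fun w hw => ?_)
      (fun w hw => by simp [hw, hc]) fun w hw =>
        hK _ w ContinuousLinearMap.norm_id_le (by rw [hw, hc]) (by rw [hw, hc])
    refine ContinuousAt.continuousWithinAt (DifferentiableAt.continuousAt (𝕜 := ℂ) ?_)
    have hw' : |w.im| = Real.pi := hw
    exact DifferentiableAt.smul (by fun_prop)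
        ((differentiableAt_expRes hA (by rw [hw']; exact hA.lt_pi) hw'.le).clm_apply
          (differentiableAt_const _))
  rw [contourIntegral, ← integral_sub (hint _ (by rw [abs_neg, abs_of_pos Real.pi_pos]))
    (hint _ (abs_of_pos Real.pi_pos)), ← integral_smul]
  have h1 := Measure.integral_comp_mul_left (fun t : ℝ => (2 * Real.pi * I : ℂ)⁻¹ •
    (contourIntegrand A N⁻¹ (fun _ => 1) x (t + (-Real.pi : ℝ) * I) -
      contourIntegrand A N⁻¹ (fun _ => 1) x (t + Real.pi * I))) N
  rw [abs_of_pos (inv_pos.2 hN), eq_inv_smul_iff₀ hN.ne'] at h1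
  rw [← h1, ← integral_smul]
  refine integral_congr_ae (Eventually.of_forall fun v => ?_)
  simp only [contourIntegrand, expRes_periodic, one_apply_eq_self]
  rw [← sub_smul, smul_smul, gaussian_difference, ← Complex.coe_smul, smul_smul, ← ofReal_mul]
  congr 2
  have e1 : 2 * Real.pi * N⁻¹ ^ 2 * (N * v) = 2 * Real.pi * v * N⁻¹ := by field_simp
  have e2 : N⁻¹ ^ 2 * (N * v) ^ 2 = v ^ 2 := by field_simp
  rw [e1, e2]
  ring

/-- The regularisations `φ_ε(A)` with `φ_ε(λ) = exp (-(ε log λ)²)` converge strongly to the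
identity. -/
theorem tendsto_contourIntegral_one (hA : IsSectorial A ω) (x : X) [CompleteSpace X] :
    Tendsto (fun n : ℕ => contourIntegral A ((n : ℝ) + 1)⁻¹ Real.pi (fun _ => 1) x) atTop
      (𝓝 x) := by
  obtain ⟨C, hC0, hC⟩ := exists_norm_expRes_pi_le hA
  -- In the limit the kernel is `2 v e^{-v²}`, and `λ R(λ, A) x` becomes `x` for `v > 0` and `0` for
  -- `v < 0`.
  have hlim : ∫ v : ℝ, (Ioi (0 : ℝ)).indicator (fun v => (2 * v * Real.exp (-v ^ 2)) • x) v = x := by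
    rw [integral_indicator measurableSet_Ioi, integral_smul_const, integral_two_mul_exp_neg_sq,
      one_smul]
  simp_rw [fun n : ℕ => contourIntegral_pi_eq hA (N := (n : ℝ) + 1) (by positivity) x]
  nth_rewrite 2 [← hlim]
  have hc0 : Tendsto (fun n : ℕ => ((n : ℝ) + 1)⁻¹) atTop (𝓝 0) := by
    simpa using tendsto_one_div_add_atTop_nhds_zero_nat (𝕜 := ℝ)
  refine tendsto_integral_of_dominated_convergence
    (fun v => Real.exp (Real.pi ^ 2) * (C * ‖x‖) * 2 * ‖v * Real.exp (-1 * v ^ 2)‖) (fun n => ?_)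
    ((integrable_mul_exp_neg_mul_sq one_pos).norm.const_mul _)
    (fun n => Eventually.of_forall fun v => ?_) (Eventually.of_forall fun v => ?_)
  · refine Continuous.aestronglyMeasurable (Continuous.smul (by fun_prop) ?_)
    refine Continuous.clm_apply ?_ continuous_const
    rw [continuous_iff_continuousAt]
    intro v
    have h := (differentiableAt_expRes hA (w := (((n : ℝ) + 1) * v : ℝ) + Real.pi * I)
      (by simpa [abs_of_pos Real.pi_pos] using hA.lt_pi)
      (by simp [abs_of_pos Real.pi_pos])).continuousAt
    exact ContinuousAt.comp (f := fun v : ℝ => ((((n : ℝ) + 1) * v : ℝ) : ℂ) + Real.pi * I) h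
      (by fun_prop)
  · set N : ℝ := (n : ℝ) + 1 with hN
    have hN1 : 1 ≤ N := by rw [hN]; linarith [(Nat.cast_nonneg n : (0 : ℝ) ≤ n)]
    have hN0 : 0 < N := by linarith
    rw [norm_smul, norm_real, Real.norm_eq_abs, abs_mul, Real.abs_exp, abs_div, abs_mul,
      abs_of_pos hN0, abs_of_pos Real.pi_pos, Real.norm_eq_abs, abs_mul, Real.abs_exp]
    -- The bound `|sin s| ≤ |s|` cancels the factor `N`, which makes the majorant independent of
    -- `n`.
    have h1 : N * |Real.sin (2 * Real.pi * v * N⁻¹)| / Real.pi ≤ 2 * |v| := by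
      rw [div_le_iff₀ Real.pi_pos]
      calc N * |Real.sin (2 * Real.pi * v * N⁻¹)| ≤ N * |2 * Real.pi * v * N⁻¹| :=
            mul_le_mul_of_nonneg_left Real.abs_sin_le_abs hN0.le
        _ = 2 * |v| * Real.pi := by
            rw [abs_mul, abs_mul, abs_of_pos (inv_pos.2 hN0), abs_of_pos Real.two_pi_pos]
            field_simp
    have h2 : Real.exp (N⁻¹ ^ 2 * Real.pi ^ 2 - v ^ 2) ≤
        Real.exp (Real.pi ^ 2) * Real.exp (-1 * v ^ 2) := by
      rw [← Real.exp_add]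
      refine Real.exp_le_exp.2 ?_
      have : N⁻¹ ^ 2 ≤ 1 := pow_le_one₀ (by positivity) (inv_le_one_of_one_le₀ hN1)
      nlinarith [sq_nonneg Real.pi]
    have h3 : ‖expRes A ((N * v : ℝ) + Real.pi * I) x‖ ≤ C * ‖x‖ :=
      ContinuousLinearMap.le_of_opNorm_le _ (hC _) x
    calc _ ≤ 2 * |v| * (Real.exp (Real.pi ^ 2) * Real.exp (-1 * v ^ 2)) * (C * ‖x‖) := by gcongr
      _ = _ := by ring
  · have hsin : Tendsto (fun n : ℕ => ((n : ℝ) + 1) *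
        Real.sin (2 * Real.pi * v * ((n : ℝ) + 1)⁻¹)) atTop (𝓝 (2 * Real.pi * v)) := by
      have hd : HasDerivAt (fun c : ℝ => Real.sin (2 * Real.pi * v * c)) (2 * Real.pi * v) 0 := by
        simpa using ((hasDerivAt_id (0 : ℝ)).const_mul (2 * Real.pi * v)).sin
      have := hd.tendsto_slope_zero.comp (tendsto_nhdsWithin_iff.2 ⟨hc0, Eventually.of_forall
        fun n => (by positivity : ((n : ℝ) + 1)⁻¹ ≠ 0)⟩)
      simpa [Function.comp_def] using this
    have hexp : Tendsto (fun n : ℕ => Real.exp (((n : ℝ) + 1)⁻¹ ^ 2 * Real.pi ^ 2 - v ^ 2)) atTop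
        (𝓝 (Real.exp (-v ^ 2))) := by
      have : Continuous fun c : ℝ => Real.exp (c ^ 2 * Real.pi ^ 2 - v ^ 2) := by fun_prop
      simpa [Function.comp_def] using (this.tendsto 0).comp hc0
    have hcoef := (hsin.div_const Real.pi).mul hexp
    rw [show 2 * Real.pi * v / Real.pi = 2 * v by field_simp] at hcoef
    have hcoefC := (continuous_ofReal.tendsto _).comp hcoef
    have hNt : Tendsto (fun n : ℕ => (n : ℝ) + 1) atTop atTop :=
      tendsto_atTop_add_const_right _ _ tendsto_natCast_atTop_atTop
    rcases lt_trichotomy v 0 with hv | rfl | hv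
    · rw [indicator_of_notMem (by simpa using hv.le)]
      have := hcoefC.smul ((tendsto_expRes_atBot hA x).comp (hNt.atTop_mul_const_of_neg hv))
      rwa [smul_zero] at this
    · simp
    · rw [indicator_of_mem (by simpa using hv)]
      have := hcoefC.smul ((tendsto_expRes_atTop hA x).comp (hNt.atTop_mul_const hv))
      rwa [Complex.coe_smul] at this

end ContourIntegral

/-! ### Closure properties of the `H^∞` spaces -/

section HInf

variable {X : Type*} [NormedAddCommGroup X] [NormedSpace ℂ X] {A : X →ₗ.[ℂ] X} {ω : ℝ}

lemma MemHInf_const (σ : ℝ) (c : ℂ) : MemHInf σ fun _ => c where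
  analytic := differentiableOn_const c
  bounded := ⟨‖c‖, fun _ _ => le_rfl⟩

lemma MemHInf_mul {σ : ℝ} {f g : ℂ → ℂ} (hf : MemHInf σ f) (hg : MemHInf σ g) :
    MemHInf σ fun z => f z * g z where
  analytic := hf.analytic.mul hg.analytic
  bounded := by
    obtain ⟨C, hC⟩ := hf.bounded
    obtain ⟨D, hD⟩ := hg.bounded
    refine ⟨C * D, fun z hz => ?_⟩
    rw [norm_mul]
    exact mul_le_mul (hC z hz) (hD z hz) (norm_nonneg _) ((norm_nonneg _).trans (hC z hz))

lemma MemHInf_inv_sub_pow {σ : ℝ} {μ : ℂ} (hμ : μ ≠ 0) (h : σ < |μ.arg|) (p : ℕ) :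
    MemHInf σ fun z => ((μ - z) ^ p)⁻¹ := by
  obtain ⟨c, hc, hcz⟩ := exists_le_norm_sub hμ h
  have hne : ∀ z ∈ sector σ, μ - z ≠ 0 := fun z hz =>
    norm_pos_iff.1 (hc.trans_le (hcz z hz))
  refine ⟨fun z hz => ?_, (c ^ p)⁻¹, fun z hz => ?_⟩
  · refine DifferentiableAt.differentiableWithinAt ?_
    exact (by fun_prop : DifferentiableAt ℂ (fun z => (μ - z) ^ p) z).inv (pow_ne_zero _ (hne z hz))
  · rw [norm_inv, norm_pow]
    exact inv_anti₀ (by positivity) (pow_le_pow_left₀ hc.le (hcz z hz) p)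

lemma MemOpHInf_smul {𝒜 : Subalgebra ℂ (X →L[ℂ] X)} {σ : ℝ} {h : ℂ → ℂ} {F : ℂ → X →L[ℂ] X}
    (hh : MemHInf σ h) (hF : MemOpHInf 𝒜 σ F) : MemOpHInf 𝒜 σ fun z => h z • F z where
  mem z hz := 𝒜.smul_mem (hF.mem z hz) _
  analytic x := hh.analytic.smul (hF.analytic x)
  bounded := by
    obtain ⟨C, hC⟩ := hh.bounded
    obtain ⟨D, hD⟩ := hF.bounded
    refine ⟨C * D, fun z hz => ?_⟩
    rw [norm_smul]
    exact mul_le_mul (hC z hz) (hD z hz) (norm_nonneg _) ((norm_nonneg _).trans (hC z hz))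

lemma MemOpHInf_const {𝒜 : Subalgebra ℂ (X →L[ℂ] X)} (σ : ℝ) {S : X →L[ℂ] X} (hS : S ∈ 𝒜) :
    MemOpHInf 𝒜 σ fun _ => S where
  mem _ _ := hS
  analytic _ := differentiableOn_const _
  bounded := ⟨‖S‖, fun _ _ => le_rfl⟩

lemma MemOpHInf_smul_const {𝒜 : Subalgebra ℂ (X →L[ℂ] X)} {σ : ℝ} {h : ℂ → ℂ} {S : X →L[ℂ] X}
    (hh : MemHInf σ h) (hS : S ∈ 𝒜) : MemOpHInf 𝒜 σ fun z => h z • S :=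
  MemOpHInf_smul hh (MemOpHInf_const σ hS)

lemma MemOpHInf_add {𝒜 : Subalgebra ℂ (X →L[ℂ] X)} {σ : ℝ} {F G : ℂ → X →L[ℂ] X}
    (hF : MemOpHInf 𝒜 σ F) (hG : MemOpHInf 𝒜 σ G) : MemOpHInf 𝒜 σ fun z => F z + G z where
  mem z hz := 𝒜.add_mem (hF.mem z hz) (hG.mem z hz)
  analytic x := (hF.analytic x).add (hG.analytic x)
  bounded := by
    obtain ⟨C, hC⟩ := hF.bounded
    obtain ⟨D, hD⟩ := hG.bounded
    exact ⟨C + D, fun z hz => norm_add_le_of_le (hC z hz) (hD z hz)⟩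

lemma MemOpHInf_sum {𝒜 : Subalgebra ℂ (X →L[ℂ] X)} {σ : ℝ} {ι : Type*} (s : Finset ι)
    {F : ι → ℂ → X →L[ℂ] X} (hF : ∀ i ∈ s, MemOpHInf 𝒜 σ (F i)) :
    MemOpHInf 𝒜 σ fun z => ∑ i ∈ s, F i z := by
  classical
  induction s using Finset.induction_on with
  | empty => simpa using MemOpHInf_const σ 𝒜.zero_mem
  | insert a s ha ih =>
    simp_rw [Finset.sum_insert ha]
    exact MemOpHInf_add (hF a (Finset.mem_insert_self a s))
      (ih fun i hi => hF i (Finset.mem_insert_of_mem hi))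

end HInf

/-! ### Representation of `F(A)` by contour integrals, and uniqueness -/

section Representation

variable {X : Type*} [NormedAddCommGroup X] [NormedSpace ℂ X] {A : X →ₗ.[ℂ] X} {ω : ℝ}

lemma tendsto_contourIntegral (hA : IsSectorial A ω) {ε σ ν C : ℝ} (hε : 0 < ε)
    (hσ : σ ≤ Real.pi) {Fs : ℕ → ℂ → X →L[ℂ] X} {F : ℂ → X →L[ℂ] X}
    (hFs : ∀ n, MemOpHInf (commutingAlgebra A ω) σ (Fs n))
    (hC : ∀ n, ∀ z ∈ sector σ, ‖Fs n z‖ ≤ C)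
    (hlim : ∀ z ∈ sector σ, ∀ x : X, Tendsto (fun n => Fs n z x) atTop (𝓝 (F z x)))
    (h1 : ω < ν) (h2 : ν < σ) (x : X) :
    Tendsto (fun n => contourIntegral A ε ν (Fs n) x) atTop (𝓝 (contourIntegral A ε ν F x)) := by
  have hν : 0 < ν := hA.nonneg.trans_lt h1
  obtain ⟨K, hK0, hK⟩ := exists_norm_contourIntegrand_le hA (C := |C|) hε h1 (abs_nonneg _) x
  have key : ∀ c : ℝ, |c| = ν →
      Tendsto (fun n => ∫ t : ℝ, contourIntegrand A ε (Fs n) x (t + c * I)) atTop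
        (𝓝 (∫ t : ℝ, contourIntegrand A ε F x (t + c * I))) := by
    intro c hc
    have hmem : ∀ t : ℝ, exp ((t : ℂ) + c * I) ∈ sector σ := fun t =>
      exp_mem_sector hσ (by simpa [hc] using h2)
    refine tendsto_integral_of_dominated_convergence (fun t => K * (1 + t ^ 2)⁻¹) (fun n => ?_)
      (integrable_const_mul_inv_one_add_sq K) (fun n => Eventually.of_forall fun t => ?_)
      (Eventually.of_forall fun t => ?_)
    · exact (integrable_contourIntegrand hA hε hσ (hFs n) x (by rwa [hc])
        (by rwa [hc])).aestronglyMeasurable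
    · simpa using hK (Fs n) (t + c * I) ((hC n _ (hmem t)).trans (le_abs_self _))
        (by simp [hc]) (by simpa [hc] using (h2.le.trans hσ))
    · exact (((expRes A _).continuous.tendsto _).comp (hlim _ (hmem t) x)).const_smul _
  exact ((key _ (by rw [abs_neg, abs_of_pos hν])).sub (key _ (abs_of_pos hν))).const_smul _

lemma contourIntegral_add (hA : IsSectorial A ω) {ε σ ν : ℝ} (hε : 0 < ε) (hσ : σ ≤ Real.pi)
    {F G : ℂ → X →L[ℂ] X} (hF : MemOpHInf (commutingAlgebra A ω) σ F)
    (hG : MemOpHInf (commutingAlgebra A ω) σ G) (h1 : ω < ν) (h2 : ν < σ) (x : X) :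
    contourIntegral A ε ν (fun z => F z + G z) x =
      contourIntegral A ε ν F x + contourIntegral A ε ν G x := by
  have hν : 0 < ν := hA.nonneg.trans_lt h1
  have e : ∀ w, contourIntegrand A ε (fun z => F z + G z) x w =
      contourIntegrand A ε F x w + contourIntegrand A ε G x w := by
    intro w; simp [contourIntegrand]
  have hp : |ν| = ν := abs_of_pos hν
  have hm : |-ν| = ν := by rw [abs_neg, hp]
  simp only [contourIntegral, e]
  rw [integral_add, integral_add, ← smul_add, add_sub_add_comm]
  all_goals
    refine integrable_contourIntegrand hA hε hσ ‹_› x ?_ ?_ <;> simpa [hp]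

lemma contourIntegral_sum (hA : IsSectorial A ω) {ε σ ν : ℝ} (hε : 0 < ε) (hσ : σ ≤ Real.pi)
    {ι : Type*} (s : Finset ι) {F : ι → ℂ → X →L[ℂ] X}
    (hF : ∀ i ∈ s, MemOpHInf (commutingAlgebra A ω) σ (F i)) (h1 : ω < ν) (h2 : ν < σ) (x : X) :
    contourIntegral A ε ν (fun z => ∑ i ∈ s, F i z) x =
      ∑ i ∈ s, contourIntegral A ε ν (F i) x := by
  classical
  induction s using Finset.induction_on with
  | empty => simp [contourIntegral, contourIntegrand]
  | insert a s ha ih =>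
    have hs : ∀ i ∈ s, MemOpHInf (commutingAlgebra A ω) σ (F i) :=
      fun i hi => hF i (Finset.mem_insert_of_mem hi)
    simp_rw [Finset.sum_insert ha]
    rw [contourIntegral_add hA hε hσ (hF a (Finset.mem_insert_self a s))
      (MemOpHInf_sum s hs) h1 h2, ih hs]

lemma apply_contourIntegral [CompleteSpace X] (hA : IsSectorial A ω) {ε σ ν : ℝ} (hε : 0 < ε) (hσ : σ ≤ Real.pi)
    {F : ℂ → X →L[ℂ] X} (hF : MemOpHInf (commutingAlgebra A ω) σ F) (h1 : ω < ν) (h2 : ν < σ)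
    (S : X →L[ℂ] X) (x : X) :
    S (contourIntegral A ε ν F x) = (2 * Real.pi * I : ℂ)⁻¹ •
      ((∫ t : ℝ, S (contourIntegrand A ε F x (t + (-ν : ℝ) * I))) -
        ∫ t : ℝ, S (contourIntegrand A ε F x (t + ν * I))) := by
  have hν : 0 < ν := hA.nonneg.trans_lt h1
  have hp : |ν| = ν := abs_of_pos hν
  have hm : |-ν| = ν := by rw [abs_neg, hp]
  rw [contourIntegral, map_smul, map_sub, ContinuousLinearMap.integral_comp_comm,
    ContinuousLinearMap.integral_comp_comm]
  all_goals
    refine integrable_contourIntegrand hA hε hσ hF x ?_ ?_ <;> simpa [hp]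

lemma apply_contourIntegral_smul_one [CompleteSpace X] (hA : IsSectorial A ω) {ε σ ν : ℝ} (hε : 0 < ε)
    (hσ : σ ≤ Real.pi) {h : ℂ → ℂ} (hh : MemHInf σ h) (h1 : ω < ν) (h2 : ν < σ)
    {S : X →L[ℂ] X} (hS : S ∈ commutingAlgebra A ω) (x : X) :
    S (contourIntegral A ε ν (fun z => h z • 1) x) =
      contourIntegral A ε ν (fun z => h z • S) x := by
  have hν : 0 < ν := hA.nonneg.trans_lt h1
  have e : ∀ w : ℂ, |w.im| = ν → S (contourIntegrand A ε (fun z => h z • 1) x w) =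
      contourIntegrand A ε (fun z => h z • S) x w := by
    intro w hw
    simp only [contourIntegrand, map_smul, smul_apply, one_apply_eq_self]
    rw [expRes_apply_comm hA (by rwa [hw]) (by rw [hw]; linarith) hS]
  rw [apply_contourIntegral hA hε hσ (MemOpHInf_smul_const hh (Subalgebra.one_mem _)) h1 h2,
    contourIntegral]
  congr 3 <;>
  · ext t
    exact e _ (by simp [abs_of_pos hν])

/-- The scalar integrand is analytic between the two lines. This removes the remainder which the
resolvent identity produces in `resolvent_apply_contourIntegral`. -/
lemma integral_scalar_line_eq {ε τ ν : ℝ} (hε : 0 < ε) (hτ : τ ≤ Real.pi) {h : ℂ → ℂ}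
    (hh : MemHInf τ h) (hν : 0 < ν) (h2 : ν < τ) (y : X) :
    ∫ t : ℝ, (exp (-(ε * (t + (-ν : ℝ) * I)) ^ 2) * h (exp (t + (-ν : ℝ) * I))) • y =
      ∫ t : ℝ, (exp (-(ε * (t + ν * I)) ^ 2) * h (exp (t + ν * I))) • y := by
  obtain ⟨C, hC⟩ := hh.bounded
  obtain ⟨K, hK0, hK⟩ := exists_norm_gaussian_le hε ν
  have hsub : ∀ w : ℂ, w.im ∈ Icc (-ν) ν → |w.im| < τ := fun w hw => (abs_le.2 hw).trans_lt h2
  have hd : ∀ w : ℂ, w.im ∈ Icc (-ν) ν →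
      DifferentiableAt ℂ (fun w : ℂ => (exp (-(ε * w) ^ 2) * h (exp w)) • y) w := by
    intro w hw
    have := (differentiableOn_comp_exp hh.analytic hτ).differentiableAt
      ((isOpen_strip τ).mem_nhds (hsub w hw))
    exact ((differentiable_gaussian ε w).mul this).smul_const y
  refine integral_line_eq_integral_line
    (f := fun w : ℂ => (exp (-(ε * w) ^ 2) * h (exp w)) • y) (C := K * C * ‖y‖) (by linarith)
    (fun w hw => (hd w hw).continuousAt.continuousWithinAt)
    (fun w hw => hd w (Ioo_subset_Icc_self hw)) fun w hw => ?_
  rw [norm_smul, norm_mul]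
  calc _ ≤ K * (1 + w.re ^ 2)⁻¹ * C * ‖y‖ := by
        gcongr
        · exact hK w (abs_le.2 hw)
        · exact hC _ (exp_mem_sector hτ (hsub w hw))
    _ = _ := by ring

/-- By the resolvent identity `R(μ, A) R(λ, A) = (μ - λ)⁻¹ (R(λ, A) - R(μ, A))`. The last term
contributes a scalar integral times `R(μ, A) x`, which cancels between the two lines because `μ`
lies outside the sector. -/
lemma resolvent_apply_contourIntegral [CompleteSpace X] (hA : IsSectorial A ω) {ε τ ν : ℝ} (hε : 0 < ε)
    (hτ : τ ≤ Real.pi) {h : ℂ → ℂ} (hh : MemHInf τ h) (h1 : ω < ν) (h2 : ν < τ)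
    {μ : ℂ} {R : X →L[ℂ] X} (hμ : μ ≠ 0) (hμτ : τ < |μ.arg|) (hR : IsResolventAt A μ R) (x : X) :
    R (contourIntegral A ε ν (fun z => h z • 1) x) =
      contourIntegral A ε ν (fun z => (h z * (μ - z)⁻¹) • 1) x := by
  have hν : 0 < ν := hA.nonneg.trans_lt h1
  have hinv : MemHInf τ fun z => (μ - z)⁻¹ := by simpa using MemHInf_inv_sub_pow hμ hμτ 1
  -- The factor `z` comes from `dλ = e^w dw`; boundedness follows from `z / (μ - z) = μ / (μ - z) -
  -- 1`.
  have hk : MemHInf τ fun z => h z * (z * (μ - z)⁻¹) := by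
    refine MemHInf_mul hh ⟨differentiableOn_id.mul hinv.analytic, ?_⟩
    obtain ⟨C, hC⟩ := hinv.bounded
    obtain ⟨c, hc, hcz⟩ := exists_le_norm_sub hμ hμτ
    refine ⟨‖μ‖ * C + 1, fun z hz => ?_⟩
    have hne : μ - z ≠ 0 := norm_pos_iff.1 (hc.trans_le (hcz z hz))
    have : z * (μ - z)⁻¹ = μ * (μ - z)⁻¹ - 1 := by field_simp; ring
    rw [this]
    refine (norm_sub_le _ _).trans ?_
    rw [norm_mul, norm_one]
    gcongr
    exact hC z hz
  have hG := MemOpHInf_smul_const (𝒜 := commutingAlgebra A ω) (MemHInf_mul hh hinv)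
    (Subalgebra.one_mem _)
  have e : ∀ w : ℂ, |w.im| = ν → R (contourIntegrand A ε (fun z => h z • 1) x w) =
      contourIntegrand A ε (fun z => (h z * (μ - z)⁻¹) • 1) x w -
        (exp (-(ε * w) ^ 2) * (h (exp w) * (exp w * (μ - exp w)⁻¹))) • R x := by
    intro w hw
    have hwm : exp w ∈ sector τ := exp_mem_sector hτ (by rwa [hw])
    obtain ⟨c, hc, hcz⟩ := exists_le_norm_sub hμ hμτ
    have hne : μ - exp w ≠ 0 := norm_pos_iff.1 (hc.trans_le (hcz _ hwm))
    have hres := isResolventAt_res hA (exp_ne_zero w)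
      (by rw [abs_arg_exp] <;> rw [hw] <;> linarith)
    have h3 : R (res A (exp w) x) = (μ - exp w)⁻¹ • (res A (exp w) x - R x) := by
      have := congrArg (· x) (res_sub_res hres hR)
      simp only [sub_apply, smul_apply, mul_apply_eq_comp] at this
      have h4 := congrArg (· x) (resolvent_commute hres hR)
      simp only [mul_apply_eq_comp] at h4
      rw [this, smul_smul, inv_mul_cancel₀ hne, one_smul, h4]
    simp only [contourIntegrand, map_smul, smul_apply, one_apply_eq_self, expRes, h3]
    module
  have hp : |ν| = ν := abs_of_pos hν
  have hm : |-ν| = ν := by rw [abs_neg, hp]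
  have hint : ∀ c : ℝ, |c| = ν → Integrable fun t : ℝ =>
      (exp (-(ε * (t + c * I)) ^ 2) * (h (exp (t + c * I)) *
        (exp (t + c * I) * (μ - exp (t + c * I))⁻¹))) • R x := by
    intro c hc
    have h1' := (integrable_contourIntegrand hA hε hτ
      (MemOpHInf_smul_const (𝒜 := commutingAlgebra A ω) hh (Subalgebra.one_mem _)) x
      (by rwa [hc]) (by rwa [hc]))
    have h2' := (integrable_contourIntegrand hA hε hτ hG x (by rwa [hc]) (by rwa [hc]) (ε := ε))
    refine (h2'.sub (R.integrable_comp h1')).congr (Eventually.of_forall fun t => ?_)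
    simp only [Pi.sub_apply]
    rw [e _ (by simpa using hc)]
    abel
  rw [apply_contourIntegral hA hε hτ (MemOpHInf_smul_const hh (Subalgebra.one_mem _)) h1 h2,
    contourIntegral]
  have e2 : ∀ c : ℝ, |c| = ν →
      ∫ t : ℝ, R (contourIntegrand A ε (fun z => h z • 1) x (t + c * I)) =
      (∫ t : ℝ, contourIntegrand A ε (fun z => (h z * (μ - z)⁻¹) • 1) x (t + c * I)) -
        ∫ t : ℝ, (exp (-(ε * (t + c * I)) ^ 2) * (h (exp (t + c * I)) *
          (exp (t + c * I) * (μ - exp (t + c * I))⁻¹))) • R x := by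
    intro c hc
    rw [← integral_sub (integrable_contourIntegrand hA hε hτ hG x (by rwa [hc]) (by rwa [hc]))
      (hint c hc)]
    congr 1
    ext t
    exact e _ (by simpa using hc)
  rw [e2 _ hm, e2 _ hp, integral_scalar_line_eq hε hτ hk hν h2 (R x), sub_sub_sub_cancel_right]

lemma resolvent_pow_apply_contourIntegral [CompleteSpace X] (hA : IsSectorial A ω) {ε τ ν : ℝ} (hε : 0 < ε)
    (hτ : τ ≤ Real.pi) {h : ℂ → ℂ} (hh : MemHInf τ h) (h1 : ω < ν) (h2 : ν < τ)
    {μ : ℂ} {R : X →L[ℂ] X} (hμ : μ ≠ 0) (hμτ : τ < |μ.arg|) (hR : IsResolventAt A μ R)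
    (p : ℕ) (x : X) :
    (R ^ p) (contourIntegral A ε ν (fun z => h z • 1) x) =
      contourIntegral A ε ν (fun z => (h z * ((μ - z) ^ p)⁻¹) • 1) x := by
  induction p with
  | zero => simp
  | succ p ih =>
    rw [pow_succ', mul_apply_eq_comp, ih, resolvent_apply_contourIntegral hA hε hτ
      (MemHInf_mul hh (MemHInf_inv_sub_pow hμ hμτ p)) h1 h2 hμ hμτ hR]
    simp_rw [pow_succ, mul_inv, mul_assoc]

/-- `T` is related to `F` by the contour integrals
`T (hφ)(A) = (2πi)⁻¹ ∫ h(λ) φ(λ) F(λ) R(λ, A) dλ`. -/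
def IsRepresented (A : X →ₗ.[ℂ] X) (ω σ : ℝ) (F : ℂ → X →L[ℂ] X) (T : X →L[ℂ] X) : Prop :=
  MemOpHInf (commutingAlgebra A ω) σ F ∧ T ∈ commutingAlgebra A ω ∧
    ∀ τ ≤ σ, ∀ h : ℂ → ℂ, MemHInf τ h → ∀ ε : ℝ, 0 < ε → ∀ ν : ℝ, ω < ν → ν < τ → ∀ x : X,
      T (contourIntegral A ε ν (fun z => h z • 1) x) =
        contourIntegral A ε ν (fun z => h z • F z) x

/-- The sector on which a pair is known to be represented may be smaller than the one on which `F`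
is bounded. Moving the contour to an angle `κ` below both transfers the formula. -/
lemma apply_contourIntegral_of_isRepresented (hA : IsSectorial A ω) {σ τ : ℝ}
    {F : ℂ → X →L[ℂ] X} {T : X →L[ℂ] X} (hωσ : ω < σ) (hFT : IsRepresented A ω σ F T)
    (hτ : τ ≤ Real.pi) (hF : MemOpHInf (commutingAlgebra A ω) τ F) {h : ℂ → ℂ} (hh : MemHInf τ h)
    {ε ν : ℝ} (hε : 0 < ε) (h1 : ω < ν) (h2 : ν < τ) (x : X) :
    T (contourIntegral A ε ν (fun z => h z • 1) x) =
      contourIntegral A ε ν (fun z => h z • F z) x := by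
  obtain ⟨κ, hκ1, hκ2⟩ := exists_between (lt_min hωσ h1)
  have hκσ := hκ2.trans_le (min_le_left _ _)
  have hκν := hκ2.trans_le (min_le_right _ _)
  rw [← contourIntegral_eq hA hε hτ
    (MemOpHInf_smul_const hh (Subalgebra.one_mem _)) x hκ1 hκν.le h2,
    ← contourIntegral_eq hA hε hτ (MemOpHInf_smul hh hF) x hκ1 hκν.le h2]
  exact hFT.2.2 (min σ τ) (min_le_left _ _) h (MemHInf_mono hh (min_le_right _ _)) ε hε κ hκ1
    (lt_min hκσ (hκν.trans h2)) x

lemma exists_isRepresented_rational [CompleteSpace X] (hA : IsSectorial A ω) {n : ℕ} {μ : Fin n → ℂ} {p : Fin n → ℕ}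
    {R S : Fin n → X →L[ℂ] X} (hμ : ∀ i, μ i ≠ 0 ∧ ω < |(μ i).arg|)
    (hR : ∀ i, IsResolventAt A (μ i) (R i)) (hS : ∀ i, S i ∈ commutingAlgebra A ω) :
    ∃ σ, ω < σ ∧ σ < Real.pi ∧ IsRepresented A ω σ
      (fun z => ∑ i, ((μ i - z) ^ p i)⁻¹ • S i) (∑ i, R i ^ p i * S i) := by
  -- There are finitely many poles, so some sector larger than `Σ_ω` avoids all of them.
  have hev : ∀ᶠ σ in 𝓝[>] ω, ω < σ ∧ σ < Real.pi ∧ ∀ i, σ < |(μ i).arg| := by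
    refine eventually_mem_nhdsWithin.and ((eventually_nhdsWithin_of_eventually_nhds
      (eventually_lt_nhds hA.lt_pi)).and (eventually_all.2 fun i =>
        eventually_nhdsWithin_of_eventually_nhds (eventually_lt_nhds (hμ i).2)))
  obtain ⟨σ, h1, h2, h3⟩ := hev.exists
  have hmem : ∀ τ ≤ σ, ∀ i, MemHInf τ fun z => ((μ i - z) ^ p i)⁻¹ := fun τ hτ i =>
    MemHInf_inv_sub_pow (hμ i).1 (hτ.trans_lt (h3 i)) _
  refine ⟨σ, h1, h2, MemOpHInf_sum _ fun i _ => MemOpHInf_smul_const (hmem σ le_rfl i) (hS i), ?_, ?_⟩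
  · exact Subalgebra.sum_mem _ fun i _ => Subalgebra.mul_mem _
      (Subalgebra.pow_mem _ (resolvent_mem_commutingAlgebra (hR i)) _) (hS i)
  · intro τ hτ h hh ε hε ν hν1 hν2 x
    have hτpi : τ ≤ Real.pi := hτ.trans h2.le
    have hhi := fun i => MemHInf_mul hh (hmem τ hτ i)
    have e1 : (fun z => h z • ∑ i, ((μ i - z) ^ p i)⁻¹ • S i) =
        fun z => ∑ i, (h z * ((μ i - z) ^ p i)⁻¹) • S i := by
      ext1 z; rw [Finset.smul_sum]; simp_rw [mul_smul]
    rw [e1, contourIntegral_sum hA hε hτpi Finset.univ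
      (fun i _ => MemOpHInf_smul_const (hhi i) (hS i)) hν1 hν2]
    rw [sum_apply]
    refine Finset.sum_congr rfl fun i _ => ?_
    have hcomm : R i ^ p i * S i = S i * R i ^ p i := by
      have : Commute (R i) (S i) :=
        mem_commutingAlgebra_iff.1 (hS i) (μ i) (R i) (hμ i).1 (hμ i).2 (hR i)
      exact (this.pow_left _).eq
    rw [hcomm, mul_apply_eq_comp, resolvent_pow_apply_contourIntegral hA hε hτpi hh hν1 hν2
      (hμ i).1 (hτ.trans_lt (h3 i)) (hR i), apply_contourIntegral_smul_one hA hε hτpi (hhi i) hν1 hν2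
      (hS i)]

/-- Induction over the graph. In a limit, both sides pass to the limit, the contour integrals by
dominated convergence. The angles supplied by the induction hypothesis may shrink to `ω` as `n`
grows; each formula is first transferred to the common angle `σ`. -/
theorem exists_isRepresented [CompleteSpace X] (hA : IsSectorial A ω) {F : ℂ → X →L[ℂ] X} {T : X →L[ℂ] X}
    (h : CalculusGraph A ω F T) : ∃ σ, ω < σ ∧ σ < Real.pi ∧ IsRepresented A ω σ F T := by
  induction h with
  | rational n μ p R S hμ hR hS => exact exists_isRepresented_rational hA hμ hR hS
  | limit Fs Ts F T σ C h hωσ hσ hFs hF hT hC hlim hTlim ih =>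
    refine ⟨σ, hωσ, hσ, hF, hT, fun τ hτ g hg ε hε ν hν1 hν2 x => ?_⟩
    have hsub := sector_mono hτ
    obtain ⟨D, hD⟩ := hg.bounded
    refine tendsto_nhds_unique (hTlim _) ?_
    refine (tendsto_contourIntegral hA (C := D * C) hε (hτ.trans hσ.le)
      (fun n => MemOpHInf_smul hg (MemOpHInf_mono (hFs n) hτ)) ?_ ?_ hν1 hν2 x).congr fun n => ?_
    · intro n z hz
      rw [norm_smul]
      exact mul_le_mul (hD z hz) (hC n z (hsub hz)) (norm_nonneg _)
        ((norm_nonneg _).trans (hD z hz))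
    · exact fun z hz y => (hlim z (hsub hz) y).const_smul _
    · obtain ⟨κ, hκ1, hκ2, hκ⟩ := ih n
      exact (apply_contourIntegral_of_isRepresented hA hκ1 hκ (hτ.trans hσ.le)
        (MemOpHInf_mono (hFs n) hτ) hg hε hν1 hν2 x).symm

lemma apply_contourIntegral_of_graph [CompleteSpace X] (hA : IsSectorial A ω) {τ : ℝ} {F : ℂ → X →L[ℂ] X}
    {T : X →L[ℂ] X} (hFT : CalculusGraph A ω F T) (hτ : τ ≤ Real.pi)
    (hF : MemOpHInf (commutingAlgebra A ω) τ F) {h : ℂ → ℂ} (hh : MemHInf τ h) {ε ν : ℝ}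
    (hε : 0 < ε) (h1 : ω < ν) (h2 : ν < τ) (x : X) :
    T (contourIntegral A ε ν (fun z => h z • 1) x) =
      contourIntegral A ε ν (fun z => h z • F z) x := by
  obtain ⟨σ, hσ, -, hrep⟩ := exists_isRepresented hA hFT
  exact apply_contourIntegral_of_isRepresented hA hσ hrep hτ hF hh hε h1 h2 x

/-- A bounded operator is determined by its values on the regularised vectors. -/
lemma eq_of_apply_contourIntegral_eq [CompleteSpace X] (hA : IsSectorial A ω) {T U : X →L[ℂ] X} {ν : ℝ} (h1 : ω < ν)
    (h2 : ν ≤ Real.pi)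
    (h : ∀ ε : ℝ, 0 < ε → ∀ x, T (contourIntegral A ε ν (fun _ => 1) x) =
      U (contourIntegral A ε ν (fun _ => 1) x)) : T = U := by
  -- The regularised vectors converge to `x` along the contour of angle `π`, to which the hypothesis
  -- at angle `ν` is carried over.
  ext x
  have hlim := tendsto_contourIntegral_one hA x
  refine tendsto_nhds_unique ((T.continuous.tendsto x).comp hlim)
    (((U.continuous.tendsto x).comp hlim).congr fun n => ?_)
  have := h ((n : ℝ) + 1)⁻¹ (by positivity) x
  rw [contourIntegral_one_eq_pi hA (by positivity) x h1 h2] at this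
  exact this.symm

/-- The operator `F(A)` is unique. -/
theorem calculusGraph_unique [CompleteSpace X] (hA : IsSectorial A ω) {F : ℂ → X →L[ℂ] X} {T U : X →L[ℂ] X}
    (hT : CalculusGraph A ω F T) (hU : CalculusGraph A ω F U) : T = U := by
  obtain ⟨σ, hσ, hσpi, hF, -⟩ := exists_isRepresented hA hT
  obtain ⟨ν, hν1, hν2⟩ := exists_between hσ
  refine eq_of_apply_contourIntegral_eq hA hν1 (hν2.le.trans hσpi.le) fun ε hε x => ?_
  have h1 := apply_contourIntegral_of_graph hA hT hσpi.le hF (MemHInf_const σ 1) hε hν1 hν2 x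
  have h2 := apply_contourIntegral_of_graph hA hU hσpi.le hF (MemHInf_const σ 1) hε hν1 hν2 x
  simp only [one_smul] at h1 h2
  rw [h1, h2]

end Representation

/-! ### Algebraic properties of the calculus -/

section Graph

variable {X : Type*} [NormedAddCommGroup X] [NormedSpace ℂ X] {A : X →ₗ.[ℂ] X} {ω : ℝ}

lemma graph_congr {σ : ℝ} {F G : ℂ → X →L[ℂ] X} {T : X →L[ℂ] X} (hωσ : ω < σ) (hσ : σ < Real.pi)
    (hFT : CalculusGraph A ω F T) (hT : T ∈ commutingAlgebra A ω)
    (hF : MemOpHInf (commutingAlgebra A ω) σ F) (hG : ∀ z ∈ sector σ, F z = G z) :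
    CalculusGraph A ω G T := by
  obtain ⟨C, hC⟩ := hF.bounded
  have hG' : MemOpHInf (commutingAlgebra A ω) σ G :=
    ⟨fun z hz => hG z hz ▸ hF.mem z hz,
      fun x => (hF.analytic x).congr fun z hz => by rw [hG z hz],
      ⟨C, fun z hz => hG z hz ▸ hC z hz⟩⟩
  exact .limit (fun _ => F) (fun _ => T) G T σ C (fun _ => hFT) hωσ hσ (fun _ => hF) hG' hT
    (fun _ => hC) (fun z hz x => by rw [hG z hz]; exact tendsto_const_nhds)
    fun _ => tendsto_const_nhds

lemma graph_mul_left {F : ℂ → X →L[ℂ] X} {T S : X →L[ℂ] X} (hFT : CalculusGraph A ω F T)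
    (hS : S ∈ commutingAlgebra A ω) : CalculusGraph A ω (fun z => S * F z) (S * T) := by
  induction hFT with
  | rational n μ p R U hμ hR hU =>
    convert! CalculusGraph.rational n μ p R (fun i => S * U i) hμ hR
      (fun i => Subalgebra.mul_mem _ hS (hU i)) using 1
    · ext1 z
      rw [Finset.mul_sum]
      simp_rw [mul_smul_comm]
    · rw [Finset.mul_sum]
      refine Finset.sum_congr rfl fun i _ => ?_
      have : Commute (R i) S :=
        mem_commutingAlgebra_iff.1 hS (μ i) (R i) (hμ i).1 (hμ i).2 (hR i)
      rw [← mul_assoc, ← mul_assoc, (this.pow_left _).eq]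
  | limit Fs Ts F T σ C h hωσ hσ hFs hF hT hC hlim hTlim ih =>
    have key : ∀ G, MemOpHInf (commutingAlgebra A ω) σ G →
        MemOpHInf (commutingAlgebra A ω) σ fun z => S * G z := fun G hG =>
      ⟨fun z hz => Subalgebra.mul_mem _ hS (hG.mem z hz),
        fun x => S.differentiable.comp_differentiableOn (hG.analytic x),
        hG.bounded.imp' (‖S‖ * ·) fun D hD z hz => (norm_mul_le _ _).trans
          (mul_le_mul_of_nonneg_left (hD z hz) (norm_nonneg _))⟩
    exact .limit _ _ _ _ σ (‖S‖ * C) ih hωσ hσ (fun n => key _ (hFs n)) (key _ hF)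
      (Subalgebra.mul_mem _ hS hT) (fun n z hz => (norm_mul_le _ _).trans
        (mul_le_mul_of_nonneg_left (hC n z hz) (norm_nonneg _)))
      (fun z hz x => (S.continuous.tendsto _).comp (hlim z hz x))
      fun x => (S.continuous.tendsto _).comp (hTlim x)

lemma graph_mul_right {F : ℂ → X →L[ℂ] X} {T S : X →L[ℂ] X} (hFT : CalculusGraph A ω F T)
    (hS : S ∈ commutingAlgebra A ω) : CalculusGraph A ω (fun z => F z * S) (T * S) := by
  induction hFT with
  | rational n μ p R U hμ hR hU =>
    convert! CalculusGraph.rational n μ p R (fun i => U i * S) hμ hR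
      (fun i => Subalgebra.mul_mem _ (hU i) hS) using 1
    · ext1 z
      rw [Finset.sum_mul]
      simp_rw [smul_mul_assoc]
    · rw [Finset.sum_mul]
      simp_rw [mul_assoc]
  | limit Fs Ts F T σ C h hωσ hσ hFs hF hT hC hlim hTlim ih =>
    have key : ∀ G, MemOpHInf (commutingAlgebra A ω) σ G →
        MemOpHInf (commutingAlgebra A ω) σ fun z => G z * S := fun G hG =>
      ⟨fun z hz => Subalgebra.mul_mem _ (hG.mem z hz) hS, fun x => hG.analytic (S x),
        hG.bounded.imp' (· * ‖S‖) fun D hD z hz => (norm_mul_le _ _).trans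
          (mul_le_mul_of_nonneg_right (hD z hz) (norm_nonneg _))⟩
    exact .limit _ _ _ _ σ (C * ‖S‖) ih hωσ hσ (fun n => key _ (hFs n)) (key _ hF)
      (Subalgebra.mul_mem _ hT hS) (fun n z hz => (norm_mul_le _ _).trans
        (mul_le_mul_of_nonneg_right (hC n z hz) (norm_nonneg _)))
      (fun z hz x => hlim z hz (S x)) fun x => hTlim (S x)

lemma mem_commutingAlgebra_of_graph [CompleteSpace X] (hA : IsSectorial A ω) {F : ℂ → X →L[ℂ] X} {T : X →L[ℂ] X}
    (h : CalculusGraph A ω F T) : T ∈ commutingAlgebra A ω := by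
  obtain ⟨σ, -, -, hrep⟩ := exists_isRepresented hA h
  exact hrep.2.1

/-- The limit step for sums, isolated because the double induction in `graph_add` needs it in either
summand. The two functions may live on different sectors, so the smaller one is used. -/
lemma graph_add_of_tendsto [CompleteSpace X] (hA : IsSectorial A ω) {Fs : ℕ → ℂ → X →L[ℂ] X} {Ts : ℕ → X →L[ℂ] X}
    {F G : ℂ → X →L[ℂ] X} {T U : X →L[ℂ] X} {σ C : ℝ} (hGU : CalculusGraph A ω G U)
    (h : ∀ n, CalculusGraph A ω (fun z => Fs n z + G z) (Ts n + U))
    (hωσ : ω < σ) (hσ : σ < Real.pi)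
    (hFs : ∀ n, MemOpHInf (commutingAlgebra A ω) σ (Fs n))
    (hF : MemOpHInf (commutingAlgebra A ω) σ F) (hT : T ∈ commutingAlgebra A ω)
    (hC : ∀ n, ∀ z ∈ sector σ, ‖Fs n z‖ ≤ C)
    (hlim : ∀ z ∈ sector σ, ∀ x : X, Tendsto (fun n => Fs n z x) atTop (𝓝 (F z x)))
    (hTlim : ∀ x : X, Tendsto (fun n => Ts n x) atTop (𝓝 (T x))) :
    CalculusGraph A ω (fun z => F z + G z) (T + U) := by
  obtain ⟨τ, hτ, -, hG, hU, -⟩ := exists_isRepresented hA hGU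
  obtain ⟨D, hD⟩ := hG.bounded
  have h1 : min σ τ ≤ σ := min_le_left _ _
  have h2 : min σ τ ≤ τ := min_le_right _ _
  exact .limit _ _ _ _ (min σ τ) (C + D) h (lt_min hωσ hτ) (h1.trans_lt hσ)
    (fun n => MemOpHInf_add (MemOpHInf_mono (hFs n) h1) (MemOpHInf_mono hG h2))
    (MemOpHInf_add (MemOpHInf_mono hF h1) (MemOpHInf_mono hG h2)) (Subalgebra.add_mem _ hT hU)
    (fun n z hz => norm_add_le_of_le (hC n z (sector_mono h1 hz)) (hD z (sector_mono h2 hz)))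
    (fun z hz x => (hlim z (sector_mono h1 hz) x).add_const _)
    fun x => (hTlim x).add_const _

lemma graph_add [CompleteSpace X] (hA : IsSectorial A ω) {F G : ℂ → X →L[ℂ] X} {T U : X →L[ℂ] X}
    (hFT : CalculusGraph A ω F T) (hGU : CalculusGraph A ω G U) :
    CalculusGraph A ω (fun z => F z + G z) (T + U) := by
  induction hFT with
  | rational n μ p R S hμ hR hS =>
    induction hGU with
    | rational m κ q R' S' hκ hR' hS' =>
      convert! CalculusGraph.rational (n + m) (Fin.append μ κ) (Fin.append p q) (Fin.append R R')
        (Fin.append S S') (Fin.addCases (fun i => by simpa using hμ i) fun i => by simpa using hκ i)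
        (Fin.addCases (fun i => by simpa using hR i) fun i => by simpa using hR' i)
        (Fin.addCases (fun i => by simpa using hS i) fun i => by simpa using hS' i) using 1
      · ext1 z; simp [Fin.sum_univ_add]
      · simp [Fin.sum_univ_add]
    | limit Gs Us G U σ C h hωσ hσ hGs hG hU hC hlim hUlim ih =>
      have := graph_add_of_tendsto hA (CalculusGraph.rational n μ p R S hμ hR hS)
        (fun n => by simpa only [add_comm] using ih n) hωσ hσ hGs hG hU hC hlim hUlim
      simpa only [add_comm] using this
  | limit Fs Ts F T σ C h hωσ hσ hFs hF hT hC hlim hTlim ih =>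
    exact graph_add_of_tendsto hA hGU ih hωσ hσ hFs hF hT hC hlim hTlim

lemma graph_zero : CalculusGraph A ω (fun _ => 0) 0 := by
  simpa using CalculusGraph.rational (A := A) (ω := ω) 0 Fin.elim0 Fin.elim0 Fin.elim0 Fin.elim0
    (fun i => i.elim0) (fun i => i.elim0) fun i => i.elim0

lemma graph_sum [CompleteSpace X] (hA : IsSectorial A ω) {ι : Type*} (s : Finset ι) {F : ι → ℂ → X →L[ℂ] X}
    {T : ι → X →L[ℂ] X} (h : ∀ i ∈ s, CalculusGraph A ω (F i) (T i)) :
    CalculusGraph A ω (fun z => ∑ i ∈ s, F i z) (∑ i ∈ s, T i) := by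
  classical
  induction s using Finset.induction_on with
  | empty => simpa using graph_zero
  | insert a s ha ih =>
    simp_rw [Finset.sum_insert ha]
    exact graph_add hA (h a (Finset.mem_insert_self a s))
      (ih fun i hi => h i (Finset.mem_insert_of_mem hi))

lemma graph_const_smul {F : ℂ → X →L[ℂ] X} {T : X →L[ℂ] X}
    (hFT : CalculusGraph A ω F T) (c : ℂ) : CalculusGraph A ω (fun z => c • F z) (c • T) := by
  simpa using graph_mul_left hFT (S := c • 1) (Subalgebra.smul_mem _ (Subalgebra.one_mem _) c)

/-- Scalar functions commute with `S`, so `S * T` and `T * S` both belong to the function `z ↦ f z •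
S`, and uniqueness applies. -/
lemma graph_smul_commute [CompleteSpace X] (hA : IsSectorial A ω) {f : ℂ → ℂ} {T S : X →L[ℂ] X}
    (hT : CalculusGraph A ω (fun z => f z • 1) T) (hS : S ∈ commutingAlgebra A ω) :
    S * T = T * S := by
  refine calculusGraph_unique hA (graph_mul_left hT hS) ?_
  convert! graph_mul_right hT hS using 1
  ext1 z
  simp

/-- Checked on regularised vectors: `U` turns `φ(A) x` into the contour integral with factor `g`,
and the representation of `T` with `h = g` then yields the factor `f g`. -/
lemma graph_smul_mul [CompleteSpace X] (hA : IsSectorial A ω) {σ : ℝ} (hωσ : ω < σ) (hσ : σ < Real.pi)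
    {f g : ℂ → ℂ} (hf : MemHInf σ f) (hg : MemHInf σ g) {T U V : X →L[ℂ] X}
    (hT : CalculusGraph A ω (fun z => f z • 1) T) (hU : CalculusGraph A ω (fun z => g z • 1) U)
    (hV : CalculusGraph A ω (fun z => (f z * g z) • 1) V) : V = T * U := by
  obtain ⟨ν, hν1, hν2⟩ := exists_between hωσ
  have h1 := Subalgebra.one_mem (commutingAlgebra A ω)
  refine eq_of_apply_contourIntegral_eq hA hν1 (hν2.le.trans hσ.le) fun ε hε x => ?_
  have e1 := apply_contourIntegral_of_graph hA hV hσ.le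
    (MemOpHInf_smul_const (MemHInf_mul hf hg) h1) (MemHInf_const σ 1) hε hν1 hν2 x
  have e2 := apply_contourIntegral_of_graph hA hU hσ.le
    (MemOpHInf_smul_const hg h1) (MemHInf_const σ 1) hε hν1 hν2 x
  have e3 := apply_contourIntegral_of_graph hA hT hσ.le
    (MemOpHInf_smul_const hf h1) hg hε hν1 hν2 x
  simp only [one_smul] at e1 e2 e3
  rw [mul_apply_eq_comp, e2, e3, e1]
  simp_rw [smul_smul, mul_comm]

end Graph

/-! ### Boundedness of the `H^∞`-calculus -/

section BoundedCalculus

/-- Extension by zero of a function on a sector. -/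
noncomputable def extendZero (σ : ℝ) (f : sector σ → ℂ) : ℂ → ℂ :=
  Function.extend Subtype.val f 0

lemma extendZero_apply {σ : ℝ} (f : sector σ → ℂ) {z : ℂ} (hz : z ∈ sector σ) :
    extendZero σ f z = f ⟨z, hz⟩ :=
  Subtype.val_injective.extend_apply f 0 ⟨z, hz⟩

lemma extendZero_apply_of_notMem {σ : ℝ} (f : sector σ → ℂ) {z : ℂ} (hz : z ∉ sector σ) :
    extendZero σ f z = 0 := by
  refine Function.extend_apply' f (0 : ℂ → ℂ) z ?_
  rintro ⟨w, rfl⟩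
  exact hz w.2

lemma extendZero_add {σ : ℝ} (f g : sector σ → ℂ) (z : ℂ) :
    extendZero σ (f + g) z = extendZero σ f z + extendZero σ g z := by
  by_cases hz : z ∈ sector σ
  · simp [extendZero_apply, hz]
  · simp [extendZero_apply_of_notMem, hz]

lemma extendZero_smul {σ : ℝ} (c : ℂ) (f : sector σ → ℂ) (z : ℂ) :
    extendZero σ (c • f) z = c * extendZero σ f z := by
  by_cases hz : z ∈ sector σ
  · simp [extendZero_apply, hz]
  · simp [extendZero_apply_of_notMem, hz]

open scoped BoundedContinuousFunction

/-- `H^∞(Σ_σ)` as a subspace of the bounded continuous functions. -/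
noncomputable def hInfSubmodule (σ : ℝ) : Submodule ℂ (sector σ →ᵇ ℂ) where
  carrier := {f | DifferentiableOn ℂ (extendZero σ f) (sector σ)}
  add_mem' {f g} hf hg := (hf.add hg).congr fun z _ => extendZero_add f g z
  zero_mem' := (differentiableOn_const (0 : ℂ)).congr fun z hz => by simp [extendZero_apply _ hz]
  smul_mem' c f hf := (hf.const_smul c).congr fun z _ => extendZero_smul c f z

lemma isClosed_hInfSubmodule (σ : ℝ) : IsClosed (hInfSubmodule σ : Set (sector σ →ᵇ ℂ)) := by
  refine isClosed_of_closure_subset fun f hf => ?_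
  obtain ⟨u, hu, hlim⟩ := mem_closure_iff_seq_limit.1 hf
  have huf : TendstoUniformlyOn (fun n => extendZero σ (u n)) (extendZero σ f) atTop (sector σ) := by
    rw [Metric.tendstoUniformlyOn_iff]
    intro ε hε
    filter_upwards [Metric.tendsto_nhds.1 hlim ε hε] with n hn z hz
    rw [extendZero_apply _ hz, extendZero_apply _ hz, dist_comm]
    exact (BoundedContinuousFunction.dist_coe_le_dist _).trans_lt hn
  exact huf.tendstoLocallyUniformlyOn.differentiableOn (Eventually.of_forall hu) (isOpen_sector σ)

instance completeSpace_hInfSubmodule (σ : ℝ) : CompleteSpace (hInfSubmodule σ) :=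
  (isClosed_hInfSubmodule σ).completeSpace_coe

lemma memHInf_extendZero {σ : ℝ} (f : hInfSubmodule σ) : MemHInf σ (extendZero σ f.1) where
  analytic := f.2
  bounded := ⟨‖f.1‖, fun z hz => by rw [extendZero_apply _ hz]; exact f.1.norm_coe_le_norm _⟩

variable {X : Type*} [NormedAddCommGroup X] [NormedSpace ℂ X] [CompleteSpace X]
  {A : X →ₗ.[ℂ] X} {ω σ : ℝ}

/-- The functional calculus `f ↦ f(A)` on `H^∞(Σ_σ)`. -/
noncomputable def calculusMap (hA : IsSectorial A ω) (hcalc : HasHInfCalculus A ω σ) :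
    hInfSubmodule σ →ₗ[ℂ] X →L[ℂ] X where
  toFun f := (hcalc _ (memHInf_extendZero f)).choose
  map_add' f g := by
    refine calculusGraph_unique hA (hcalc _ (memHInf_extendZero (f + g))).choose_spec ?_
    convert! graph_add hA (hcalc _ (memHInf_extendZero f)).choose_spec
      (hcalc _ (memHInf_extendZero g)).choose_spec using 1
    ext1 z
    rw [← add_smul, ← extendZero_add]
    rfl
  map_smul' c f := by
    refine calculusGraph_unique hA (hcalc _ (memHInf_extendZero (c • f))).choose_spec ?_
    convert! graph_const_smul (hcalc _ (memHInf_extendZero f)).choose_spec c using 1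
    ext1 z
    rw [smul_smul, ← extendZero_smul]
    rfl

lemma graph_calculusMap (hA : IsSectorial A ω) (hcalc : HasHInfCalculus A ω σ)
    (f : hInfSubmodule σ) :
    CalculusGraph A ω (fun z => extendZero σ f.1 z • 1) (calculusMap hA hcalc f) :=
  (hcalc _ (memHInf_extendZero f)).choose_spec

/-- Closed graph theorem: uniform convergence of functions together with convergence of operators is
an admissible limit in the calculus, and uniqueness identifies the limit operator. -/
lemma continuous_calculusMap (hA : IsSectorial A ω) (hcalc : HasHInfCalculus A ω σ)
    (hωσ : ω < σ) (hσ : σ < Real.pi) : Continuous (calculusMap hA hcalc) := by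
  refine LinearMap.continuous_of_seq_closed_graph _ fun u f T hu hT => ?_
  have hT' : ∀ x, Tendsto (fun n => calculusMap hA hcalc (u n) x) atTop (𝓝 (T x)) := fun x =>
    ((ContinuousLinearMap.apply ℂ X x).continuous.tendsto T).comp hT
  have hu' : Tendsto (fun n => (u n).1) atTop (𝓝 f.1) := (continuous_subtype_val.tendsto f).comp hu
  obtain ⟨C, hC⟩ := (Metric.isBounded_range_of_tendsto _ hu').exists_norm_le
  have h1 := Subalgebra.one_mem (commutingAlgebra A ω)
  refine calculusGraph_unique hA ?_ (graph_calculusMap hA hcalc f)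
  refine .limit _ _ _ _ σ C (fun n => graph_calculusMap hA hcalc (u n)) hωσ hσ
    (fun n => MemOpHInf_smul_const (memHInf_extendZero _) h1)
    (MemOpHInf_smul_const (memHInf_extendZero _) h1)
    (mem_commutingAlgebra_of_tendsto
      (fun n => mem_commutingAlgebra_of_graph hA (graph_calculusMap hA hcalc (u n))) hT')
    (fun n z hz => ?_) (fun z hz x => ?_) hT'
  · rw [norm_smul]
    refine (mul_le_mul_of_nonneg_left ContinuousLinearMap.norm_id_le (norm_nonneg _)).trans ?_
    rw [mul_one, extendZero_apply _ hz]
    exact ((u n).1.norm_coe_le_norm _).trans (hC _ (mem_range_self n))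
  · simp only [smul_apply, one_apply_eq_self, extendZero_apply _ hz]
    exact (((continuous_eval_const (F := sector σ →ᵇ ℂ) (⟨z, hz⟩ : sector σ)).tendsto f.1).comp
      hu').smul_const x

/-- An `H^∞`-calculus is bounded. -/
theorem exists_norm_calculus_le (hA : IsSectorial A ω) (hcalc : HasHInfCalculus A ω σ)
    (hωσ : ω < σ) (hσ : σ < Real.pi) :
    ∃ K, 0 ≤ K ∧ ∀ (f : ℂ → ℂ) (M : ℝ) (T : X →L[ℂ] X), MemHInf σ f → 0 ≤ M →
      (∀ z ∈ sector σ, ‖f z‖ ≤ M) → CalculusGraph A ω (fun z => f z • 1) T → ‖T‖ ≤ K * M := by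
  let Φ : hInfSubmodule σ →L[ℂ] X →L[ℂ] X :=
    ⟨calculusMap hA hcalc, continuous_calculusMap hA hcalc hωσ hσ⟩
  refine ⟨‖Φ‖, Φ.opNorm_nonneg, fun f M T hf hM hfM hT => ?_⟩
  let g : sector σ →ᵇ ℂ := BoundedContinuousFunction.ofNormedAddCommGroup
    (fun z => f z) (continuousOn_iff_continuous_domRestrict.1 hf.analytic.continuousOn) M
    fun z => hfM z z.2
  have hg : ∀ z ∈ sector σ, extendZero σ g z = f z := fun z hz => extendZero_apply _ hz
  let g' : hInfSubmodule σ := ⟨g, hf.analytic.congr hg⟩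
  -- `f` and the zero extension of `g` agree only on the sector, so they are compared as germs.
  have hTΦ : T = Φ g' := by
    refine calculusGraph_unique hA ?_ (graph_calculusMap hA hcalc g')
    refine graph_congr hωσ hσ hT (mem_commutingAlgebra_of_graph hA hT)
      (MemOpHInf_smul_const hf (Subalgebra.one_mem _)) fun z hz => ?_
    rw [← hg z hz]
  rw [hTΦ]
  refine Φ.le_of_opNorm_le_of_le le_rfl ?_
  exact BoundedContinuousFunction.norm_ofNormedAddCommGroup_le _ hM fun z : sector σ => hfM z z.2

end BoundedCalculus

/-! ### U-, WR- and R-boundedness -/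

section Rademacher

variable {Y : Type*} [NormedAddCommGroup Y] {n : ℕ}

lemma norm_sum_sign_le_maxSignNorm (x : Fin n → Y) (ε : Fin n → ℤˣ) :
    ‖∑ k, (ε k : ℤ) • x k‖ ≤ maxSignNorm x :=
  le_ciSup (f := fun ε : Fin n → ℤˣ => ‖∑ k, (ε k : ℤ) • x k‖) (finite_range _).bddAbove ε

lemma maxSignNorm_le {x : Fin n → Y} {M : ℝ}
    (h : ∀ ε : Fin n → ℤˣ, ‖∑ k, (ε k : ℤ) • x k‖ ≤ M) : maxSignNorm x ≤ M :=
  ciSup_le h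

lemma maxSignNorm_nonneg (x : Fin n → Y) : 0 ≤ maxSignNorm x :=
  (norm_nonneg _).trans (norm_sum_sign_le_maxSignNorm x 1)

lemma rademacherNorm_nonneg (x : Fin n → Y) : 0 ≤ rademacherNorm x := Real.sqrt_nonneg _

lemma card_signs : Fintype.card (Fin n → ℤˣ) = 2 ^ n := by
  rw [Fintype.card_fun, Fintype.card_fin]; rfl

lemma rademacherNorm_le_maxSignNorm (x : Fin n → Y) : rademacherNorm x ≤ maxSignNorm x := by
  rw [rademacherNorm, Real.sqrt_le_left (maxSignNorm_nonneg x), div_le_iff₀ (by positivity)]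
  calc ∑ ε : Fin n → ℤˣ, ‖∑ k, (ε k : ℤ) • x k‖ ^ 2
      ≤ ∑ _ε : Fin n → ℤˣ, maxSignNorm x ^ 2 := by
        gcongr with ε
        exact norm_sum_sign_le_maxSignNorm x ε
    _ = _ := by
        rw [Finset.sum_const, Finset.card_univ, card_signs, nsmul_eq_mul, mul_comm]
        push_cast
        rfl

lemma maxSignNorm_sign_smul_le (x : Fin n → Y) (δ : Fin n → ℤˣ) :
    maxSignNorm (fun k => (δ k : ℤ) • x k) ≤ maxSignNorm x := by
  refine maxSignNorm_le fun ε => ?_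
  simp_rw [smul_smul]
  exact_mod_cast norm_sum_sign_le_maxSignNorm x (ε * δ)

lemma sum_sign_mul_sign (j k : Fin n) :
    ∑ ε : Fin n → ℤˣ, ((ε j : ℤ) * (ε k : ℤ)) = if j = k then 2 ^ n else 0 := by
  split_ifs with h
  · subst h
    have : ∀ ε : Fin n → ℤˣ, (ε j : ℤ) * (ε j : ℤ) = 1 := fun ε => by
      rw [← Units.val_mul, Int.units_mul_self, Units.val_one]
    simp_rw [this]
    rw [Finset.sum_const, Finset.card_univ, card_signs]
    simp
  -- Flipping the `j`-th sign permutes the sign vectors and negates every term.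
  · have h1 := Equiv.sum_comp (Equiv.mulRight (Pi.mulSingle j (-1) : Fin n → ℤˣ))
      fun ε : Fin n → ℤˣ => (ε j : ℤ) * (ε k : ℤ)
    simp only [Equiv.coe_mulRight, Pi.mul_apply, Pi.mulSingle_eq_same,
      Pi.mulSingle_eq_of_ne (Ne.symm h), mul_one, Units.val_neg,
      mul_neg, neg_mul, Finset.sum_neg_distrib] at h1
    linarith

variable {X : Type*} [NormedAddCommGroup X] [NormedSpace ℂ X]

lemma sum_dual_apply_signs (x : Fin n → X) (x' : Fin n → X →L[ℂ] ℂ) :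
    ∑ ε : Fin n → ℤˣ, (∑ j, (ε j : ℤ) • x' j) (∑ k, (ε k : ℤ) • x k) =
      2 ^ n * ∑ k, x' k (x k) := by
  have h1 : ∀ ε : Fin n → ℤˣ, (∑ j, (ε j : ℤ) • x' j) (∑ k, (ε k : ℤ) • x k) =
      ∑ j, ∑ k, (((ε j : ℤ) * (ε k : ℤ) : ℤ) : ℂ) * x' j (x k) := by
    intro ε
    rw [sum_apply]
    refine Finset.sum_congr rfl fun j _ => ?_
    rw [map_sum]
    refine Finset.sum_congr rfl fun k _ => ?_
    rw [map_zsmul, smul_apply, smul_smul, zsmul_eq_mul, mul_comm (ε k : ℤ)]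
  simp_rw [h1]
  rw [Finset.sum_comm, Finset.mul_sum]
  refine Finset.sum_congr rfl fun j _ => ?_
  rw [Finset.sum_comm]
  simp_rw [← Finset.sum_mul, ← Int.cast_sum, sum_sign_mul_sign]
  simp

/-- By orthogonality of the signs, `∑ₖ x'ₖ(xₖ)` is the mean of `(∑ⱼ εⱼ x'ⱼ)(∑ₖ εₖ xₖ)`; then
Cauchy–Schwarz. -/
lemma norm_sum_dual_apply_le (x : Fin n → X) (x' : Fin n → X →L[ℂ] ℂ) :
    ‖∑ k, x' k (x k)‖ ≤ rademacherNorm x' * rademacherNorm x := by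
  have h2 : (0 : ℝ) < 2 ^ n := by positivity
  have h : 2 ^ n * ‖∑ k, x' k (x k)‖ ≤ 2 ^ n * (rademacherNorm x' * rademacherNorm x) := by
    calc 2 ^ n * ‖∑ k, x' k (x k)‖ = ‖(2 ^ n * ∑ k, x' k (x k) : ℂ)‖ := by simp
      _ = ‖∑ ε : Fin n → ℤˣ, (∑ j, (ε j : ℤ) • x' j) (∑ k, (ε k : ℤ) • x k)‖ := by
          rw [sum_dual_apply_signs]
      _ ≤ ∑ ε : Fin n → ℤˣ, ‖∑ j, (ε j : ℤ) • x' j‖ * ‖∑ k, (ε k : ℤ) • x k‖ :=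
          norm_sum_le_of_le _ fun ε _ => ContinuousLinearMap.le_opNorm _ _
      _ ≤ √(∑ ε : Fin n → ℤˣ, ‖∑ j, (ε j : ℤ) • x' j‖ ^ 2) *
          √(∑ ε : Fin n → ℤˣ, ‖∑ j, (ε j : ℤ) • x j‖ ^ 2) :=
          Real.sum_mul_le_sqrt_mul_sqrt _ _ _
      _ = _ := by
          rw [rademacherNorm, rademacherNorm, Real.sqrt_div' _ h2.le, Real.sqrt_div' _ h2.le]
          have : √(2 ^ n : ℝ) * √(2 ^ n : ℝ) = 2 ^ n := Real.mul_self_sqrt h2.le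
          have h3 : √(2 ^ n : ℝ) ≠ 0 := (Real.sqrt_pos.2 h2).ne'
          rw [div_mul_div_comm, this]
          field_simp
  exact le_of_mul_le_mul_left h h2

lemma exists_sign_mul_eq_abs (a : ℝ) : ∃ δ : ℤˣ, ((δ : ℤ) : ℝ) * a = |a| := by
  rcases le_total 0 a with h | h
  · exact ⟨1, by simp [abs_of_nonneg h]⟩
  · exact ⟨-1, by simp [abs_of_nonpos h]⟩

/-- Real signs cannot align complex numbers, so real and imaginary parts are aligned separately;
this is the factor `2`. -/
lemma sum_norm_le_of_norm_sum_sign_le {a : Fin n → ℂ} {M : ℝ}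
    (h : ∀ δ : Fin n → ℤˣ, ‖∑ k, ((δ k : ℤ) : ℂ) * a k‖ ≤ M) : ∑ k, ‖a k‖ ≤ 2 * M := by
  choose δ hδ using fun k => exists_sign_mul_eq_abs (a k).re
  choose η hη using fun k => exists_sign_mul_eq_abs (a k).im
  have h1 : ∑ k, |(a k).re| ≤ M := by
    refine le_trans (le_of_eq ?_) ((re_le_norm _).trans (h δ))
    rw [re_sum]
    refine Finset.sum_congr rfl fun k _ => ?_
    rw [← hδ k, ← ofReal_intCast, re_ofReal_mul]
  have h2 : ∑ k, |(a k).im| ≤ M := by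
    refine le_trans (le_of_eq ?_) (((le_abs_self _).trans (abs_im_le_norm _)).trans (h η))
    rw [im_sum]
    refine Finset.sum_congr rfl fun k _ => ?_
    rw [← hη k, ← ofReal_intCast, im_ofReal_mul]
  calc ∑ k, ‖a k‖ ≤ ∑ k, (|(a k).re| + |(a k).im|) :=
        Finset.sum_le_sum fun k _ => norm_le_abs_re_add_abs_im _
    _ ≤ 2 * M := by rw [Finset.sum_add_distrib]; linarith

theorem isUBounded_of_isWRBounded {𝓕 : Set (X →L[ℂ] X)} (h : IsWRBounded 𝓕) : IsUBounded 𝓕 := by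
  obtain ⟨C, hC⟩ := h
  refine ⟨|C|, fun n x x' T hT => (hC n x x' T hT).trans ?_⟩
  have h1 := rademacherNorm_le_maxSignNorm x
  have h2 := rademacherNorm_le_maxSignNorm x'
  have h3 := rademacherNorm_nonneg x
  have h4 := rademacherNorm_nonneg x'
  have h5 := maxSignNorm_nonneg x
  gcongr
  exact le_abs_self C

/-- The moduli are replaced by signs, and the signs are moved onto the vectors `xₖ`, which does not
increase their maximal signed sum. Duality and R-boundedness estimate what is left. -/
theorem isUBounded_of_isRBounded {𝓕 : Set (X →L[ℂ] X)} (h : IsRBounded 𝓕) : IsUBounded 𝓕 := by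
  obtain ⟨C, hC⟩ := h
  refine ⟨2 * |C|, fun n x x' T hT => ?_⟩
  rw [mul_assoc, mul_assoc]
  refine sum_norm_le_of_norm_sum_sign_le fun δ => ?_
  have e : ∑ k, ((δ k : ℤ) : ℂ) * x' k (T k (x k)) =
      ∑ k, x' k (T k ((δ k : ℤ) • x k)) := by simp
  have h1 := hC n (fun k => (δ k : ℤ) • x k) T hT
  have h2 := rademacherNorm_nonneg fun k => (δ k : ℤ) • x k
  have h3 := (rademacherNorm_le_maxSignNorm _).trans (maxSignNorm_sign_smul_le x δ)
  have h4 := rademacherNorm_nonneg x'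
  have h5 := maxSignNorm_nonneg x
  rw [e]
  calc _ ≤ rademacherNorm x' * rademacherNorm (fun k => T k ((δ k : ℤ) • x k)) :=
        norm_sum_dual_apply_le _ _
    _ ≤ maxSignNorm x' * (|C| * maxSignNorm x) := by
        gcongr
        · exact rademacherNorm_nonneg _
        · exact maxSignNorm_nonneg x'
        · exact rademacherNorm_le_maxSignNorm x'
        · refine h1.trans ?_
          gcongr
          exact le_abs_self C
    _ = _ := by ring

end Rademacher

/-! ### Strong convergence and the U-boundedness estimate -/

section Existence

variable {X : Type*} [NormedAddCommGroup X] [NormedSpace ℂ X] {A : X →ₗ.[ℂ] X} {ω σ : ℝ}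

/-- Bounded operators `Fₙ(A)` converge strongly if the functions `Fₙ` converge. -/
theorem exists_graph_of_norm_le [CompleteSpace X] (hA : IsSectorial A ω) (hωσ : ω < σ)
    (hσ : σ < Real.pi) {Fs : ℕ → ℂ → X →L[ℂ] X} {Ts : ℕ → X →L[ℂ] X} {F : ℂ → X →L[ℂ] X} {B C : ℝ}
    (hg : ∀ n, CalculusGraph A ω (Fs n) (Ts n))
    (hFs : ∀ n, MemOpHInf (commutingAlgebra A ω) σ (Fs n))
    (hF : MemOpHInf (commutingAlgebra A ω) σ F)
    (hC : ∀ n, ∀ z ∈ sector σ, ‖Fs n z‖ ≤ C)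
    (hlim : ∀ z ∈ sector σ, ∀ x : X, Tendsto (fun n => Fs n z x) atTop (𝓝 (F z x)))
    (hB : ∀ n, ‖Ts n‖ ≤ B) : ∃ T, CalculusGraph A ω F T := by
  obtain ⟨ν, hν1, hν2⟩ := exists_between hωσ
  have hcauchy : ∀ x, CauchySeq fun n => Ts n x := by
    intro x
    rw [Metric.cauchySeq_iff']
    intro ε hε
    have hB0 : 0 ≤ B := (norm_nonneg _).trans (hB 0)
    -- A three-epsilon argument: `x` is replaced by a regularised vector `y` so close that the bound
    -- `B` makes the error at most `ε / 3` for every `n`.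
    obtain ⟨k, hk⟩ := ((Metric.tendsto_nhds.1 (tendsto_contourIntegral_one hA x))
      (ε / 3 / (B + 1)) (by positivity)).exists
    set δ : ℝ := ((k : ℝ) + 1)⁻¹ with hδ
    have hδ0 : 0 < δ := by positivity
    rw [← contourIntegral_one_eq_pi hA hδ0 x hν1 (hν2.le.trans hσ.le)] at hk
    set y := contourIntegral A δ ν (fun _ => 1) x with hy
    -- On a regularised vector `Ts n` acts as the contour integral of `Fs n`, which converges by
    -- dominated convergence.
    have hconv : Tendsto (fun n => Ts n y) atTop (𝓝 (contourIntegral A δ ν F x)) := by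
      refine (tendsto_contourIntegral hA hδ0 hσ.le hFs hC hlim hν1 hν2 x).congr fun n => ?_
      have := apply_contourIntegral_of_graph hA (hg n) hσ.le (hFs n) (MemHInf_const σ 1)
        hδ0 hν1 hν2 x
      simpa only [one_smul] using this.symm
    obtain ⟨N, hN⟩ := Metric.cauchySeq_iff'.1 hconv.cauchySeq (ε / 3) (by positivity)
    have hyx : ∀ n, dist (Ts n x) (Ts n y) < ε / 3 := by
      intro n
      rw [dist_eq_norm, ← map_sub]
      rw [dist_comm, dist_eq_norm, lt_div_iff₀ (by positivity)] at hk
      have := (Ts n).le_of_opNorm_le (hB n) (x - y)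
      nlinarith [norm_nonneg (x - y)]
    refine ⟨N, fun n hn => ?_⟩
    have h1 := hyx n
    have h2 := hN n hn
    have h3 := hyx N
    rw [dist_comm] at h3
    have h4 := dist_triangle4 (Ts n x) (Ts n y) (Ts N y) (Ts N x)
    linarith
  choose f hf using fun x => cauchySeq_tendsto_of_complete (hcauchy x)
  let T := continuousLinearMapOfTendsto Ts (tendsto_pi_nhds.2 hf)
  have hT : ∀ x, Tendsto (fun n => Ts n x) atTop (𝓝 (T x)) := hf
  exact ⟨T, .limit Fs Ts F T σ C hg hωσ hσ hFs hF
    (mem_commutingAlgebra_of_tendsto (fun n => mem_commutingAlgebra_of_graph hA (hg n)) hT)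
    hC hlim hT⟩

/-- `K` is a bound for the `H^∞(Σ_σ)`-calculus of `A`. -/
def IsCalculusBound (A : X →ₗ.[ℂ] X) (ω σ K : ℝ) : Prop :=
  ∀ (f : ℂ → ℂ) (M : ℝ) (T : X →L[ℂ] X), MemHInf σ f → 0 ≤ M →
    (∀ z ∈ sector σ, ‖f z‖ ≤ M) → CalculusGraph A ω (fun z => f z • 1) T → ‖T‖ ≤ K * M

lemma MemHInf_sum {ι : Type*} (s : Finset ι) {f : ι → ℂ → ℂ} (hf : ∀ i ∈ s, MemHInf σ (f i)) :
    MemHInf σ fun z => ∑ i ∈ s, f i z where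
  analytic := DifferentiableOn.fun_sum fun i hi => (hf i hi).analytic
  bounded := by
    choose! C hC using fun i hi => (hf i hi).bounded
    exact ⟨∑ i ∈ s, C i, fun z hz => norm_sum_le_of_le s fun i hi => hC i hi z hz⟩

/-- Whatever the signs, `∑ₖ εₖ aₖ` is bounded by `M` on the sector, so one bound for the calculus
serves all sign choices. -/
lemma norm_sum_sign_smul_le [CompleteSpace X] (hA : IsSectorial A ω) {K M : ℝ}
    (hK : IsCalculusBound A ω σ K) (hM : 0 ≤ M) {n : ℕ} {a : Fin n → ℂ → ℂ}
    {T : Fin n → X →L[ℂ] X} (ha : ∀ k, MemHInf σ (a k))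
    (haM : ∀ z ∈ sector σ, ∑ k, ‖a k z‖ ≤ M)
    (hT : ∀ k, CalculusGraph A ω (fun z => a k z • 1) (T k)) (ε : Fin n → ℤˣ) :
    ‖∑ k, (ε k : ℤ) • T k‖ ≤ K * M := by
  have hnorm : ∀ k, ‖((ε k : ℤ) : ℂ)‖ = 1 := fun k => by
    rcases Int.units_eq_one_or (ε k) with h | h <;> simp [h]
  refine hK (fun z => ∑ k, ((ε k : ℤ) : ℂ) * a k z) M _
    (MemHInf_sum _ fun k _ => MemHInf_mul (MemHInf_const σ _) (ha k)) hM (fun z hz => ?_) ?_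
  · refine (norm_sum_le _ _).trans ((haM z hz).trans' (le_of_eq ?_))
    simp_rw [norm_mul, hnorm, one_mul]
  · convert! graph_sum hA Finset.univ fun k _ => graph_const_smul (hT k) ((ε k : ℤ) : ℂ) using 1
    · ext1 z
      rw [Finset.sum_smul]
      simp_rw [mul_smul]
    · simp_rw [Int.cast_smul_eq_zsmul]

/-- The key estimate. Pairing with `x'` gives `∑ₖ (x' ∘ Uₖ)(Sₖ (Tₖ x))`, to which U-boundedness
applies with the vectors `Tₖ x` and the functionals `x' ∘ Uₖ`; the signed sums of both families are
controlled by the calculus. -/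
lemma norm_sum_mul_mul_le [CompleteSpace X] (hA : IsSectorial A ω) {K C M N : ℝ} (hK0 : 0 ≤ K)
    (hK : IsCalculusBound A ω σ K) {𝓕 : Set (X →L[ℂ] X)} (hC0 : 0 ≤ C)
    (hC : ∀ (n : ℕ) (x : Fin n → X) (x' : Fin n → X →L[ℂ] ℂ) (T : Fin n → X →L[ℂ] X),
      (∀ k, T k ∈ 𝓕) → ∑ k, ‖x' k (T k (x k))‖ ≤ C * maxSignNorm x * maxSignNorm x')
    (hM : 0 ≤ M) (hN : 0 ≤ N) {n : ℕ} {a b : Fin n → ℂ → ℂ} {T U S : Fin n → X →L[ℂ] X}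
    (ha : ∀ k, MemHInf σ (a k)) (haM : ∀ z ∈ sector σ, ∑ k, ‖a k z‖ ≤ M)
    (hT : ∀ k, CalculusGraph A ω (fun z => a k z • 1) (T k))
    (hb : ∀ k, MemHInf σ (b k)) (hbN : ∀ z ∈ sector σ, ∑ k, ‖b k z‖ ≤ N)
    (hU : ∀ k, CalculusGraph A ω (fun z => b k z • 1) (U k)) (hS : ∀ k, S k ∈ 𝓕) :
    ‖∑ k, U k * (S k * T k)‖ ≤ C * (K * M) * (K * N) := by
  refine ContinuousLinearMap.opNorm_le_bound _ (by positivity) fun x => ?_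
  refine NormedSpace.norm_le_dual_bound ℂ _ (by positivity) fun x' => ?_
  have h1 : maxSignNorm (fun k => T k x) ≤ K * M * ‖x‖ := maxSignNorm_le fun ε => by
    have : ∑ k, (ε k : ℤ) • T k x = (∑ k, (ε k : ℤ) • T k) x := by simp [sum_apply]
    rw [this]
    exact ContinuousLinearMap.le_of_opNorm_le _ (norm_sum_sign_smul_le hA hK hM ha haM hT ε) x
  have h2 : maxSignNorm (fun k => x' ∘L U k) ≤ ‖x'‖ * (K * N) := maxSignNorm_le fun ε => by
    have : ∑ k, (ε k : ℤ) • x' ∘L U k = x' ∘L (∑ k, (ε k : ℤ) • U k) := by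
      ext y; simp [sum_apply]
    rw [this]
    exact (ContinuousLinearMap.opNorm_comp_le _ _).trans
      (mul_le_mul_of_nonneg_left (norm_sum_sign_smul_le hA hK hN hb hbN hU ε) (norm_nonneg _))
  have h3 : x' ((∑ k, U k * (S k * T k)) x) = ∑ k, (x' ∘L U k) (S k (T k x)) := by
    simp [sum_apply]
  rw [h3]
  refine (norm_sum_le _ _).trans ((hC n (fun k => T k x) (fun k => x' ∘L U k) S hS).trans ?_)
  calc _ ≤ C * (K * M * ‖x‖) * (‖x'‖ * (K * N)) := by
        gcongr
        exact maxSignNorm_nonneg _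
    _ = _ := by ring

end Existence

/-! ### Cauchy's formula on a sector with a factored kernel -/

section Kernels

/-- `e^{-(w - log z)²}`. -/
noncomputable def gaussAt (w z : ℂ) : ℂ := exp (-(w - log z) ^ 2)

/-- `e^{-(w - log z)²} / (w - log z)`. -/
noncomputable def cauchyAt (w z : ℂ) : ℂ := cauchyKernel (w - log z)

variable {σ ν : ℝ}

lemma differentiableOn_log_sector (hσ : σ ≤ Real.pi) : DifferentiableOn ℂ log (sector σ) := by
  intro z hz
  refine (differentiableAt_log ?_).differentiableWithinAt
  rw [mem_slitPlane_iff_arg]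
  exact ⟨fun h => absurd hz.2 (by rw [h, abs_of_pos Real.pi_pos]; exact hσ.not_gt), hz.1⟩

/-- The contour keeps the distance `ν - σ` from every `log z`, `z ∈ Σ_σ`, which makes the kernel
estimates uniform in `z`. -/
lemma abs_im_sub_log_le (hσν : σ < ν) (hν : ν ≤ Real.pi) {w z : ℂ} (hw : |w.im| = ν)
    (hz : z ∈ sector σ) : ν - σ ≤ |(w - log z).im| ∧ |(w - log z).im| ≤ 2 * Real.pi := by
  rw [sub_im, log_im]
  have h := hz.2
  constructor
  · have := abs_sub_abs_le_abs_sub w.im z.arg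
    linarith
  · have := abs_sub w.im z.arg
    linarith

lemma exists_norm_gaussAt_le (hσν : σ < ν) (hν : ν ≤ Real.pi) :
    ∃ C, 0 ≤ C ∧ ∀ w : ℂ, |w.im| = ν → ∀ z ∈ sector σ,
      ‖gaussAt w z‖ ≤ C * (1 + (w.re - (log z).re) ^ 2)⁻¹ := by
  obtain ⟨C, hC0, hC⟩ := exists_norm_gaussian_le one_pos (2 * Real.pi)
  refine ⟨C, hC0, fun w hw z hz => ?_⟩
  simpa [gaussAt] using hC (w - log z) (abs_im_sub_log_le hσν hν hw hz).2

lemma exists_norm_cauchyAt_le (hσν : σ < ν) (hν : ν ≤ Real.pi) :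
    ∃ C, 0 ≤ C ∧ ∀ w : ℂ, |w.im| = ν → ∀ z ∈ sector σ,
      ‖cauchyAt w z‖ ≤ C * (1 + (w.re - (log z).re) ^ 2)⁻¹ := by
  obtain ⟨C, hC0, hC⟩ := exists_norm_cauchyKernel_le (sub_pos.2 hσν) (2 * Real.pi)
  refine ⟨C, hC0, fun w hw z hz => ?_⟩
  have := abs_im_sub_log_le hσν hν hw hz
  simpa [cauchyAt] using hC (w - log z) this.1 this.2

lemma const_mul_inv_one_add_sq_le {C : ℝ} (hC : 0 ≤ C) (t : ℝ) : C * (1 + t ^ 2)⁻¹ ≤ C :=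
  mul_le_of_le_one_right hC (inv_le_one_of_one_le₀ (by nlinarith [sq_nonneg t]))

lemma memHInf_gaussAt (hσν : σ < ν) (hν : ν ≤ Real.pi) {w : ℂ} (hw : |w.im| = ν) :
    MemHInf σ (gaussAt w) where
  analytic := by
    have := differentiableOn_log_sector (hσν.le.trans hν)
    unfold gaussAt
    fun_prop
  bounded := by
    obtain ⟨C, hC0, hC⟩ := exists_norm_gaussAt_le hσν hν
    exact ⟨C, fun z hz => (hC w hw z hz).trans (const_mul_inv_one_add_sq_le hC0 _)⟩

lemma memHInf_cauchyAt (hσν : σ < ν) (hν : ν ≤ Real.pi) {w : ℂ} (hw : |w.im| = ν) :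
    MemHInf σ (cauchyAt w) where
  analytic := by
    intro z hz
    have hne : w - log z ≠ 0 := fun h => by
      have := (abs_im_sub_log_le hσν hν hw hz).1
      rw [h] at this
      simp at this
      linarith
    exact (differentiableAt_cauchyKernel hne).comp_differentiableWithinAt z
      ((differentiableWithinAt_const w).sub (differentiableOn_log_sector (hσν.le.trans hν) z hz))
  bounded := by
    obtain ⟨C, hC0, hC⟩ := exists_norm_cauchyAt_le hσν hν
    exact ⟨C, fun z hz => (hC w hw z hz).trans (const_mul_inv_one_add_sq_le hC0 _)⟩

/-- Cauchy's formula on a sector in logarithmic coordinates, with a rapidly decreasing kernel. -/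
lemma cauchy_formula_sector {E : Type*} [NormedAddCommGroup E] [NormedSpace ℂ E] [CompleteSpace E]
    {G : ℂ → E} {ρ C : ℝ} (hσν : σ < ν) (hνρ : ν < ρ) (hρ : ρ ≤ Real.pi)
    (hG : DifferentiableOn ℂ G (sector ρ)) (hC : ∀ z ∈ sector ρ, ‖G z‖ ≤ C) {z : ℂ}
    (hz : z ∈ sector σ) :
    (∫ t : ℝ, (gaussAt (t + (-ν : ℝ) * I) z * cauchyAt (t + (-ν : ℝ) * I) z) •
        G (exp (t + (-ν : ℝ) * I))) -
      ∫ t : ℝ, (gaussAt (t + ν * I) z * cauchyAt (t + ν * I) z) • G (exp (t + ν * I)) =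
      (2 * Real.pi * I : ℂ) • G z := by
  have hlog : |(log z).im| < ν := by rw [log_im]; exact hz.2.trans hσν
  -- The strip formula is applied to `G(e^w)` multiplied by a second Gaussian which equals `1` at `w
  -- = log z`. Both factors of the kernel then decay.
  have hd : DifferentiableOn ℂ (fun w => exp (-(w - log z) ^ 2) • G (exp w)) {w | |w.im| < ρ} :=
    (by fun_prop : Differentiable ℂ fun w : ℂ => exp (-(w - log z) ^ 2)).differentiableOn.smul
      (differentiableOn_comp_exp hG hρ)
  have hb : ∀ w : ℂ, |w.im| < ρ →
      ‖exp (-(w - log z) ^ 2) • G (exp w)‖ ≤ Real.exp (1 ^ 2 * (2 * Real.pi) ^ 2) * C := by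
    intro w hw
    rw [norm_smul]
    have h1 : |(w - log z).im| ≤ 2 * Real.pi := by
      rw [sub_im]
      have := abs_sub w.im (log z).im
      linarith
    have h2 := norm_gaussian_le 1 h1
    rw [ofReal_one, one_mul] at h2
    exact mul_le_mul h2 (hC _ (exp_mem_sector hρ hw)) (norm_nonneg _) (Real.exp_nonneg _)
  have h := cauchy_formula_strip hνρ hd hb hlog
  simp only [sub_self, exp_log hz.1, smul_smul] at h
  simp only [gaussAt, cauchyAt, mul_comm (exp _)]
  simpa using h

end Kernels

/-! ### Riemann sums of the Cauchy integral and existence of `F(A)` -/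

section RiemannSumsOfCauchy

variable {X : Type*} [NormedAddCommGroup X] [NormedSpace ℂ X] {A : X →ₗ.[ℂ] X} {ω σ ν ρ : ℝ}

/-- The node `(m + r / N) + i c`. -/
noncomputable def node (c : ℝ) (N r : ℕ) (m : ℤ) : ℂ := ((m + r / N : ℝ) : ℂ) + c * I

lemma node_im (c : ℝ) (N r : ℕ) (m : ℤ) : (node c N r m).im = c := by simp [node]

lemma node_re (c : ℝ) (N r : ℕ) (m : ℤ) : (node c N r m).re = m + r / N := by simp [node]

/-- The average over `r < N` of the sums of `g` over the nodes with `-N ≤ m < N`. -/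
noncomputable def nodeSum {E : Type*} [AddCommGroup E] [Module ℂ E] (c : ℝ) (N : ℕ) (g : ℂ → E) :
    E :=
  ((N : ℝ)⁻¹ : ℂ) • ∑ r ∈ Finset.range N, ∑ m ∈ Finset.Ico (-(N : ℤ)) N, g (node c N r m)

lemma norm_nodeSum_le {E : Type*} [NormedAddCommGroup E] [NormedSpace ℂ E] {c B : ℝ} (hB : 0 ≤ B)
    {N : ℕ} {g : ℂ → E}
    (h : ∀ r, ‖∑ m ∈ Finset.Ico (-(N : ℤ)) N, g (node c N r m)‖ ≤ B) : ‖nodeSum c N g‖ ≤ B := by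
  rw [nodeSum, norm_smul, ← ofReal_inv, norm_real, norm_inv, Real.norm_natCast]
  have h1 := norm_sum_le_of_le (Finset.range N) fun r _ => h r
  rw [Finset.sum_const, Finset.card_range, nsmul_eq_mul] at h1
  rcases N.eq_zero_or_pos with rfl | hN
  · simpa using hB
  · rw [inv_mul_le_iff₀ (by exact_mod_cast hN)]
    exact h1

lemma nodeSum_graph [CompleteSpace X] (hA : IsSectorial A ω) {c : ℝ} {N : ℕ}
    {g : ℂ → ℂ → X →L[ℂ] X} {T : ℂ → X →L[ℂ] X}
    (h : ∀ w : ℂ, w.im = c → CalculusGraph A ω (g w) (T w)) :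
    CalculusGraph A ω (fun z => nodeSum c N fun w => g w z) (nodeSum c N T) :=
  graph_const_smul (graph_sum hA _ fun _ _ => graph_sum hA _ fun _ _ => h _ (node_im _ _ _ _)) _

lemma nodeSum_memOpHInf {𝒜 : Subalgebra ℂ (X →L[ℂ] X)} {c : ℝ} {N : ℕ} {g : ℂ → ℂ → X →L[ℂ] X}
    (h : ∀ w : ℂ, w.im = c → MemOpHInf 𝒜 σ (g w)) :
    MemOpHInf 𝒜 σ fun z => nodeSum c N fun w => g w z :=
  MemOpHInf_smul (MemHInf_const σ _) (MemOpHInf_sum _ fun _ _ =>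
    MemOpHInf_sum _ fun _ _ => h _ (node_im _ _ _ _))

lemma tendsto_nodeSum {E : Type*} [NormedAddCommGroup E] [NormedSpace ℂ E] [CompleteSpace E]
    {c C : ℝ} {g : ℂ → E} (hg : Continuous fun t : ℝ => g (t + c * I))
    (hb : ∀ t : ℝ, ‖g (t + c * I)‖ ≤ C * (1 + t ^ 2)⁻¹) :
    Tendsto (fun N : ℕ => nodeSum c N g) atTop (𝓝 (∫ t : ℝ, g (t + c * I))) := by
  refine (tendsto_riemann_sum hg hb).congr fun N => ?_
  rw [nodeSum, ← ofReal_inv, Complex.coe_smul]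
  rfl

/-- The bound depends neither on the offset `r / N` nor on `u`, which will be `log |z|`. -/
lemma sum_norm_node_le {f : ℂ → ℂ} {c C K u : ℝ} (hC0 : 0 ≤ C)
    (hK : ∀ (s : Finset ℤ) (u : ℝ), ∑ m ∈ s, (1 + (m + u) ^ 2)⁻¹ ≤ K)
    (hf : ∀ w : ℂ, w.im = c → ‖f w‖ ≤ C * (1 + (w.re - u) ^ 2)⁻¹) (N r : ℕ) (s : Finset ℤ) :
    ∑ m ∈ s, ‖f (node c N r m)‖ ≤ C * K := by
  refine le_trans ?_ (mul_le_mul_of_nonneg_left (hK s (r / N - u)) hC0)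
  rw [Finset.mul_sum]
  refine Finset.sum_le_sum fun m _ => (hf _ (node_im _ _ _ _)).trans_eq ?_
  rw [node_re, add_sub_assoc]

lemma sum_equivFin {M : Type*} [AddCommMonoid M] (s : Finset ℤ) (f : ℤ → M) :
    ∑ k : Fin s.card, f (s.equivFin.symm k) = ∑ m ∈ s, f m := by
  rw [← Finset.sum_coe_sort s f]
  exact Equiv.sum_comp s.equivFin.symm fun m : s => f m

variable [CompleteSpace X]

/-- The Riemann sums of Cauchy's integral for `F` over the line `Im w = c` belong to the
functional calculus and are bounded, together with the corresponding operators. -/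
theorem exists_graph_nodeSum (hA : IsSectorial A ω) (hωσ : ω < σ) (hσν : σ < ν) (hνρ : ν < ρ)
    (hρ : ρ < Real.pi) (hcalc : HasHInfCalculus A ω σ) {F : ℂ → X →L[ℂ] X}
    (hF : MemOpHInf (commutingAlgebra A ω) ρ F) (hU : IsUBounded (F '' sector ρ)) {c : ℝ}
    (hc : |c| = ν) :
    ∃ (T : ℕ → X →L[ℂ] X) (B D : ℝ),
      (∀ N, CalculusGraph A ω
        (fun z => nodeSum c N fun w => (gaussAt w z * cauchyAt w z) • F (exp w)) (T N)) ∧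
      (∀ N, ‖T N‖ ≤ B) ∧
      ∀ N, ∀ z ∈ sector σ,
        ‖nodeSum c N fun w => (gaussAt w z * cauchyAt w z) • F (exp w)‖ ≤ D := by
  have hσ : σ < Real.pi := (hσν.trans hνρ).trans hρ
  have hν : ν ≤ Real.pi := (hνρ.trans hρ).le
  obtain ⟨K, hK0, hK⟩ := exists_norm_calculus_le hA hcalc hωσ hσ
  obtain ⟨L, hL0, hL⟩ := exists_sum_inv_one_add_sq_le
  obtain ⟨Ca, hCa0, hCa⟩ := exists_norm_gaussAt_le hσν hν
  obtain ⟨Cb, hCb0, hCb⟩ := exists_norm_cauchyAt_le hσν hν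
  obtain ⟨CF, hCF⟩ := hF.bounded
  obtain ⟨CU, hCU⟩ := hU
  have him : ∀ w : ℂ, w.im = c → |w.im| = ν := fun w hw => by rw [hw, hc]
  have hexp : ∀ w : ℂ, w.im = c → exp w ∈ sector ρ := fun w hw =>
    exp_mem_sector hρ.le (by rwa [him w hw])
  have hma : ∀ w : ℂ, w.im = c → MemHInf σ (gaussAt w) := fun w hw =>
    memHInf_gaussAt hσν hν (him w hw)
  have hmb : ∀ w : ℂ, w.im = c → MemHInf σ (cauchyAt w) := fun w hw =>
    memHInf_cauchyAt hσν hν (him w hw)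
  choose! Ta hTa using fun (w : ℂ) (hw : w.im = c) => hcalc _ (hma w hw)
  choose! Tb hTb using fun (w : ℂ) (hw : w.im = c) => hcalc _ (hmb w hw)
  -- `F (exp w)` is placed between the two scalar factors, the form required by
  -- `norm_sum_mul_mul_le`; all three operators commute, so the product still belongs to the
  -- integrand.
  refine ⟨fun N => nodeSum c N fun w => Tb w * (F (exp w) * Ta w),
    |CU| * (K * (Ca * L)) * (K * (Cb * L)), Ca * (|CF| * (Cb * L)), fun N => ?_, fun N => ?_,
    fun N z hz => ?_⟩
  · refine nodeSum_graph hA fun w hw => ?_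
    have hFw := hF.mem _ (hexp w hw)
    obtain ⟨V, hV⟩ := hcalc _ (MemHInf_mul (hma w hw) (hmb w hw))
    have hVe : V = Ta w * Tb w :=
      graph_smul_mul hA hωσ hσ (hma w hw) (hmb w hw) (hTa w hw) (hTb w hw) hV
    have h1 : Tb w * (F (exp w) * Ta w) = F (exp w) * V := by
      rw [hVe, ← mul_assoc, ← graph_smul_commute hA (hTb w hw) hFw, mul_assoc,
        ← graph_smul_commute hA (hTb w hw) (mem_commutingAlgebra_of_graph hA (hTa w hw))]
    rw [h1]
    convert! graph_mul_left hV hFw using 1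
    ext1 z
    change _ = F (exp w) * ((gaussAt w z * cauchyAt w z) • (1 : X →L[ℂ] X))
    rw [mul_smul_comm, mul_one]
  -- An average over `r` is bounded by its worst grid, and on a single grid the nodes have integer
  -- spacing.
  · refine norm_nodeSum_le (by positivity) fun r => ?_
    rw [← sum_equivFin]
    refine norm_sum_mul_mul_le hA hK0 hK (abs_nonneg CU)
      (fun n x x' T hT => (hCU n x x' T hT).trans ?_) (by positivity) (by positivity)
      (fun k => hma _ (node_im c N r _)) (fun z hz => ?_) (fun k => hTa _ (node_im c N r _))
      (fun k => hmb _ (node_im c N r _)) (fun z hz => ?_) (fun k => hTb _ (node_im c N r _))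
      fun k => mem_image_of_mem F (hexp _ (node_im c N r _))
    · have h5 := maxSignNorm_nonneg x
      have h6 := maxSignNorm_nonneg x'
      gcongr
      exact le_abs_self CU
    · rw [sum_equivFin _ fun m => ‖gaussAt (node c N r m) z‖]
      exact sum_norm_node_le (f := fun w => gaussAt w z) hCa0 hL
        (fun w hw => hCa w (him w hw) z hz) _ _ _
    · rw [sum_equivFin _ fun m => ‖cauchyAt (node c N r m) z‖]
      exact sum_norm_node_le (f := fun w => cauchyAt w z) hCb0 hL
        (fun w hw => hCb w (him w hw) z hz) _ _ _
  -- For the functions themselves the decay of `cauchyAt` suffices; `gaussAt` and `F` are merely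
  -- bounded.
  · refine norm_nodeSum_le (by positivity) fun r => ?_
    refine (norm_sum_le_of_le (f := fun m => (gaussAt (node c N r m) z * cauchyAt (node c N r m) z) •
      F (exp (node c N r m))) _ (n := fun m => Ca * (|CF| * ‖cauchyAt (node c N r m) z‖))
      fun m _ => ?_).trans ?_
    · have him' := node_im c N r m
      rw [norm_smul, norm_mul]
      have h1 := (hCa _ (him _ him') z hz).trans (const_mul_inv_one_add_sq_le hCa0 _)
      have h2 := (hCF _ (hexp _ him')).trans (le_abs_self CF)
      calc _ ≤ Ca * ‖cauchyAt (node c N r m) z‖ * |CF| := by gcongr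
        _ = _ := by ring
    · rw [← Finset.mul_sum, ← Finset.mul_sum]
      gcongr
      exact sum_norm_node_le (f := fun w => cauchyAt w z) hCb0 hL
        (fun w hw => hCb w (him w hw) z hz) _ _ _

lemma tendsto_nodeSum_cauchy (hσν : σ < ν) (hνρ : ν < ρ) (hρ : ρ < Real.pi)
    {𝒜 : Subalgebra ℂ (X →L[ℂ] X)} {F : ℂ → X →L[ℂ] X} (hF : MemOpHInf 𝒜 ρ F) {c : ℝ}
    (hc : |c| = ν) {z : ℂ} (hz : z ∈ sector σ) (x : X) :
    Tendsto (fun N : ℕ => (nodeSum c N fun w => (gaussAt w z * cauchyAt w z) • F (exp w)) x) atTop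
      (𝓝 (∫ t : ℝ, (gaussAt (t + c * I) z * cauchyAt (t + c * I) z) • F (exp (t + c * I)) x)) := by
  have hν : ν ≤ Real.pi := (hνρ.trans hρ).le
  obtain ⟨Ca, hCa0, hCa⟩ := exists_norm_gaussAt_le hσν hν
  obtain ⟨Cb, hCb0, hCb⟩ := exists_norm_cauchyAt_le hσν hν
  obtain ⟨CF, hCF⟩ := hF.bounded
  have him : ∀ t : ℝ, |((t : ℂ) + c * I).im| = ν := fun t => by simp [hc]
  have hexp : ∀ t : ℝ, exp ((t : ℂ) + c * I) ∈ sector ρ := fun t =>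
    exp_mem_sector hρ.le (by rwa [him t])
  have e : ∀ N : ℕ, (nodeSum c N fun w => (gaussAt w z * cauchyAt w z) • F (exp w)) x =
      nodeSum c N fun w => (gaussAt w z * cauchyAt w z) • F (exp w) x := by
    intro N
    simp [nodeSum, sum_apply]
  simp_rw [e]
  refine tendsto_nodeSum (C := Ca * (2 * (1 + (log z).re ^ 2)) * Cb * (|CF| * ‖x‖)) ?_ fun t => ?_
  · refine Continuous.smul (Continuous.mul ?_ ?_) ?_
    · unfold gaussAt
      fun_prop
    · refine continuousOn_cauchyKernel.comp_continuous (by fun_prop) fun t h => ?_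
      have := (abs_im_sub_log_le hσν hν (him t) hz).1
      rw [h] at this
      simp at this
      linarith
    · exact (hF.analytic x).continuousOn.comp_continuous (by fun_prop) hexp
  · have h1 := hCa _ (him t) z hz
    have h2 := (hCb _ (him t) z hz).trans (const_mul_inv_one_add_sq_le hCb0 _)
    have h3 : ‖F (exp (t + c * I)) x‖ ≤ |CF| * ‖x‖ :=
      ContinuousLinearMap.le_of_opNorm_le _ ((hCF _ (hexp t)).trans (le_abs_self CF)) x
    have h4 : ((t : ℂ) + c * I).re = t := by simp
    rw [h4] at h1
    rw [norm_smul, norm_mul]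
    calc _ ≤ Ca * (1 + (t - (log z).re) ^ 2)⁻¹ * Cb * (|CF| * ‖x‖) := by gcongr
      _ ≤ Ca * (2 * (1 + (log z).re ^ 2) * (1 + t ^ 2)⁻¹) * Cb * (|CF| * ‖x‖) := by
          gcongr
          exact inv_one_add_sub_sq_le _ _
      _ = _ := by ring

/-- Functions with U-bounded range belong to the functional calculus. -/
theorem exists_graph_of_isUBounded (hA : IsSectorial A ω) (hωσ : ω < σ) (hσρ : σ < ρ)
    (hρ : ρ < Real.pi) (hcalc : HasHInfCalculus A ω σ) {F : ℂ → X →L[ℂ] X}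
    (hF : MemOpHInf (commutingAlgebra A ω) ρ F) (hU : IsUBounded (F '' sector ρ)) :
    ∃ T, CalculusGraph A ω F T := by
  obtain ⟨ν, hσν, hνρ⟩ := exists_between hσρ
  have hν0 : 0 < ν := hA.nonneg.trans_lt (hωσ.trans hσν)
  have hνpi : ν ≤ Real.pi := (hνρ.trans hρ).le
  have hp : |ν| = ν := abs_of_pos hν0
  have hm : |-ν| = ν := by rw [abs_neg, hp]
  obtain ⟨T, B, D, hT, hB, hD⟩ := exists_graph_nodeSum hA hωσ hσν hνρ hρ hcalc hF hU hm
  obtain ⟨T', B', D', hT', hB', hD'⟩ := exists_graph_nodeSum hA hωσ hσν hνρ hρ hcalc hF hU hp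
  have hmem : ∀ c : ℝ, |c| = ν → ∀ N, MemOpHInf (commutingAlgebra A ω) σ
      fun z => nodeSum c N fun w => (gaussAt w z * cauchyAt w z) • F (exp w) := by
    intro c hc N
    refine nodeSum_memOpHInf fun w hw => ?_
    have hw' : |w.im| = ν := by rw [hw, hc]
    exact MemOpHInf_smul_const
      (MemHInf_mul (memHInf_gaussAt hσν hνpi hw') (memHInf_cauchyAt hσν hνpi hw'))
      (hF.mem _ (exp_mem_sector hρ.le (by rwa [hw'])))
  -- The approximants are the Riemann sums for the lower line minus those for the upper line, the
  -- orientation of Cauchy's formula.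
  refine exists_graph_of_norm_le hA hωσ (hσρ.trans hρ)
    (Fs := fun N z => (2 * Real.pi * I : ℂ)⁻¹ •
      ((nodeSum (-ν) N fun w => (gaussAt w z * cauchyAt w z) • F (exp w)) +
        (-1 : ℂ) • nodeSum ν N fun w => (gaussAt w z * cauchyAt w z) • F (exp w)))
    (Ts := fun N => (2 * Real.pi * I : ℂ)⁻¹ • (T N + (-1 : ℂ) • T' N))
    (C := ‖(2 * Real.pi * I : ℂ)⁻¹‖ * (D + D')) (B := ‖(2 * Real.pi * I : ℂ)⁻¹‖ * (B + B'))
    (fun N => graph_const_smul (graph_add hA (hT N) (graph_const_smul (hT' N) _)) _)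
    (fun N => MemOpHInf_smul (MemHInf_const σ _) (MemOpHInf_add (hmem _ hm N)
      (MemOpHInf_smul (MemHInf_const σ _) (hmem _ hp N))))
    (MemOpHInf_mono hF hσρ.le) (fun N z hz => ?_) (fun z hz x => ?_) fun N => ?_
  · rw [norm_smul]
    refine mul_le_mul_of_nonneg_left (norm_add_le_of_le (hD N z hz) ?_) (norm_nonneg _)
    rw [norm_smul, norm_neg, norm_one, one_mul]
    exact hD' N z hz
  · obtain ⟨C, hC⟩ := hF.bounded
    have hcauchy := cauchy_formula_sector (C := C * ‖x‖) hσν hνρ hρ.le (hF.analytic x)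
      (fun z hz => ContinuousLinearMap.le_of_opNorm_le _ (hC z hz) x) hz
    have hlim := ((tendsto_nodeSum_cauchy hσν hνρ hρ hF hm hz x).sub
      (tendsto_nodeSum_cauchy hσν hνρ hρ hF hp hz x)).const_smul (2 * Real.pi * I : ℂ)⁻¹
    rw [hcauchy, inv_smul_smul₀ (by simp [Real.pi_ne_zero])] at hlim
    refine hlim.congr fun N => ?_
    simp only [smul_apply, add_apply, neg_one_smul, neg_apply, sub_eq_add_neg]
  · rw [norm_smul]
    refine mul_le_mul_of_nonneg_left (norm_add_le_of_le (hB N) ?_) (norm_nonneg _)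
    rw [norm_smul, norm_neg, norm_one, one_mul]
    exact hB' N

end RiemannSumsOfCauchy

end HInftyCalculus

theorem theorem4p4 {X : Type*} [NormedAddCommGroup X] [NormedSpace ℂ X] [CompleteSpace X]
    (A : X →ₗ.[ℂ] X) (ω σ ρ : ℝ) (hA : IsSectorial A ω)
    (hωσ : ω < σ) (hσρ : σ < ρ) (hρ : ρ < Real.pi)
    (hcalc : HasHInfCalculus A ω σ)
    (F : ℂ → X →L[ℂ] X) (hF : MemOpHInf (commutingAlgebra A ω) ρ F)
    (hbdd : IsUBounded (F '' sector ρ) ∨ IsWRBounded (F '' sector ρ) ∨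
      IsRBounded (F '' sector ρ)) :
    ∃! T : X →L[ℂ] X, CalculusGraph A ω F T := by
  have hU : IsUBounded (F '' sector ρ) := by
    rcases hbdd with h | h | h
    · exact h
    · exact HInftyCalculus.isUBounded_of_isWRBounded h
    · exact HInftyCalculus.isUBounded_of_isRBounded h
  obtain ⟨T, hT⟩ := HInftyCalculus.exists_graph_of_isUBounded hA hωσ hσρ hρ hcalc hF hU
  exact ⟨T, hT, fun U hTU => HInftyCalculus.calculusGraph_unique hA hTU hT⟩
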